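/- Let $X$ be a smooth complex variety (a smooth separated scheme of finite type over $\mathbf{C}$), $Z\subset X$ a smooth closed subvariety with ideal sheaf $\mathcal{I}\subset\mathcal{O}_X$, and $\mathcal{D}_X$ the sheaf of algebraic differential operators. For $j\in\mathbf{Z}$ let $$V^j\mathcal{D}_X=\{P\in\mathcal{D}_X \mid P\,\mathcal{I}^k\subset\mathcal{I}^{k+j}\text{ for all }k\in\mathbf{Z}\},\qquad \mathcal{I}^k=\mathcal{O}_X \text{ for } k\le 0.$$ Below, $(x,t)$ are arbitrary local coordinates on open subsets of $X$ such that $\mathcal{I}$ is generated by $t=(t_1,\dots,t_r)$. Let $M$ be a coherent left $\mathcal{D}_X$-module. A $V$-filtration along $Z$ on $M$ is an exhaustive decreasing filtration of $M$ by coherent $V^0\mathcal{D}_X$-submodules $V^\alpha=V^\alpha M$, $\alpha\in\mathbf{R}$, such that, with $V^{>\alpha}=\bigcup_{\beta>\alpha}V^\beta$ and $\mathrm{Gr}_V^\alpha=V^\alpha/V^{>\alpha}$: (i) $V^\alpha=\bigcap_{\beta<\alpha}V^\beta$ for all $\alpha$, every bounded interval contains only finitely many $\alpha$ with $\mathrm{Gr}_V^\alpha\neq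 0$, and all these $\alpha$ are rational; (ii) $(V^j\mathcal{D}_X)(V^\alpha M)\subset V^{\alpha+j}M$ for all $\alpha$ and all $j\in\mathbf{Z}$; (iii) $\sum_j t_jV^\alpha=V^{\alpha+1}$ for $\alpha\gg 0$; (iv) $\sum_j\partial_{t_j}t_j-\alpha$ acts nilpotently on $\mathrm{Gr}_V^\alpha$ for every $\alpha$. For a local section $u$ of $M$ (over any open subset of $X$), the Bernstein–Sato polynomial $b_u(s)\in\mathbf{C}[s]$ is the monic minimal polynomial, if it exists, of the action of $s=-\sum_j\partial_{t_j}t_j$ on $V^0\mathcal{D}_X u/V^1\mathcal{D}_X u$, that is, the monic generator of the ideal of polynomials in $s$ that act on this quotient as zero. **Proposition (Sabbah).** Suppose that a $V$-filtration along $Z$ exists on $M$. Then for every local section $u$ of $M$ the polynomial $b_u(s)$ exists, is non-zero and has rational coefficients; moreover, all its complex roots are rational. For every $\alpha$, $$V^\alpha M=\{\,u\in M \mid \alpha\le c\ \text{ whenever } b_u(-c)=0\,\}.$$ -/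

import Mathlib

open CategoryTheory AlgebraicGeometry Opposite

namespace VFilt

noncomputable section

/-! ### Functions on open subsets -/

/-- Restriction of regular functions. -/
def resO {X : Scheme.{0}} {U W : X.Opens} (h : W ≤ U) : Γ(X, U) →+* Γ(X, W) :=
  (X.presheaf.map (homOfLE h).op).hom

/-- The constant function on `U` with value a given complex number, for a scheme over `ℂ`. -/
def cst {X : Scheme.{0}} (f : X ⟶ Spec (.of ℂ)) (U : X.Opens) : ℂ →+* Γ(X, U) :=
  (resO le_top).comp (((Scheme.ΓSpecIso (.of ℂ)).inv ≫ f.appTop).hom)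

/-- A property of opens holds locally on `U`: every point of `U` has an open neighbourhood
contained in `U` with this property. -/
def LocallyOn {X : Scheme.{0}} (U : X.Opens) (P : ∀ W : X.Opens, W ≤ U → Prop) : Prop :=
  ∀ x ∈ U, ∃ (W : X.Opens) (h : W ≤ U), x ∈ W ∧ P W h

/-! ### The sheaf of differential operators -/

/-- Families of additive endomorphisms of `Γ(X, W)`, `W ≤ U`; a ring under composition. The
endomorphisms of the abelian sheaf `𝒪_U` are the families satisfying `IsNatural` below. -/
abbrev Fam (X : Scheme.{0}) (U : X.Opens) : Type :=
  ∀ W : {W : X.Opens // W ≤ U}, AddMonoid.End Γ(X, W.1)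

/-- Restriction of families to a smaller open subset. -/
def Fam.res {X : Scheme.{0}} {U W : X.Opens} (h : W ≤ U) : Fam X U →+* Fam X W where
  toFun P := fun W' => P ⟨W'.1, W'.2.trans h⟩
  map_one' := rfl
  map_mul' _ _ := rfl
  map_zero' := rfl
  map_add' _ _ := rfl

/-- Compatibility with restriction: the family is an endomorphism of the sheaf `𝒪_U`. -/
def Fam.IsNatural {X : Scheme.{0}} {U : X.Opens} (P : Fam X U) : Prop :=
  ∀ (W W' : X.Opens) (h : W ≤ U) (h' : W' ≤ W) (g : Γ(X, W)),
    resO h' (P ⟨W, h⟩ g) = P ⟨W', h'.trans h⟩ (resO h' g)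

/-- Multiplication by a regular function. -/
def Fam.mulBy {X : Scheme.{0}} {U : X.Opens} (g : Γ(X, U)) : Fam X U :=
  fun W => AddMonoidHom.mulLeft (resO W.2 g)

/-- `δ` is a section over `U` of the tangent sheaf of `X` over `ℂ`: a `ℂ`-derivation of `𝒪_U`. -/
structure Fam.IsVectorField {X : Scheme.{0}} (f : X ⟶ Spec (.of ℂ)) {U : X.Opens}
    (δ : Fam X U) : Prop where
  natural : δ.IsNatural
  leibniz : ∀ (W : {W : X.Opens // W ≤ U}) (g h : Γ(X, W.1)), δ W (g * h) = g * δ W h + h * δ W g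
  const : ∀ (W : {W : X.Opens // W ≤ U}) (c : ℂ), δ W (cst f W.1 c) = 0

/-- The functions and vector fields on `U`. -/
def opGens {X : Scheme.{0}} (f : X ⟶ Spec (.of ℂ)) (U : X.Opens) : Set (Fam X U) :=
  Set.range Fam.mulBy ∪ {δ | δ.IsVectorField f}

lemma res_mem_closure {X : Scheme.{0}} (f : X ⟶ Spec (.of ℂ)) {U W : X.Opens} (h : W ≤ U)
    {P : Fam X U} (hP : P ∈ Subring.closure (opGens f U)) :
    Fam.res h P ∈ Subring.closure (opGens f W) := by
  have : Subring.closure (opGens f U) ≤ (Subring.closure (opGens f W)).comap (Fam.res h) := by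
    rw [Subring.closure_le]
    rintro P (⟨g, rfl⟩ | hP)
    · refine Subring.subset_closure (Or.inl ⟨resO h g, ?_⟩)
      funext W'
      refine AddMonoidHom.ext fun y => ?_
      change resO _ (resO h g) * y = resO _ g * y
      congr 1
      simp only [resO, ← CommRingCat.comp_apply, ← Functor.map_comp]
      rfl
    · exact Subring.subset_closure (Or.inr
        ⟨fun V V' hV hV' g => hP.natural V V' (hV.trans h) hV' g,
          fun V => hP.leibniz ⟨V.1, V.2.trans h⟩, fun V => hP.const ⟨V.1, V.2.trans h⟩⟩)
  exact this hP

/-- The ring `𝒟_X(U)` of algebraic differential operators on `U`: endomorphisms of the sheaf `𝒪_U`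
that locally are in the ring generated by functions and vector fields. -/
def diffOp {X : Scheme.{0}} (f : X ⟶ Spec (.of ℂ)) (U : X.Opens) : Subring (Fam X U) where
  carrier := {P | P.IsNatural ∧
    LocallyOn U fun W h => Fam.res h P ∈ Subring.closure (opGens f W)}
  zero_mem' := ⟨fun _ _ _ h' _ => map_zero (resO h'),
    fun x hx => ⟨U, le_rfl, hx, by beta_reduce; rw [map_zero]; exact zero_mem _⟩⟩
  one_mem' := ⟨fun _ _ _ _ _ => rfl,
    fun x hx => ⟨U, le_rfl, hx, by beta_reduce; rw [map_one]; exact one_mem _⟩⟩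
  add_mem' := by
    rintro P Q ⟨hP, hP'⟩ ⟨hQ, hQ'⟩
    refine ⟨fun W W' h h' g => ?_, fun x hx => ?_⟩
    · change resO h' (P ⟨W, h⟩ g + Q ⟨W, h⟩ g) = _
      rw [map_add, hP, hQ]; rfl
    · obtain ⟨W, h, hxW, hW⟩ := hP' x hx
      obtain ⟨W', h', hxW', hW'⟩ := hQ' x hx
      refine ⟨W ⊓ W', inf_le_left.trans h, ⟨hxW, hxW'⟩, ?_⟩
      beta_reduce
      rw [map_add]
      exact add_mem (res_mem_closure f (inf_le_left : W ⊓ W' ≤ W) hW)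
        (res_mem_closure f (inf_le_right : W ⊓ W' ≤ W') hW')
  neg_mem' := by
    rintro P ⟨hP, hP'⟩
    refine ⟨fun W W' h h' g => ?_, fun x hx => ?_⟩
    · change resO h' (-(P ⟨W, h⟩ g)) = _
      rw [map_neg, hP]; rfl
    · obtain ⟨W, h, hxW, hW⟩ := hP' x hx
      exact ⟨W, h, hxW, by beta_reduce; rw [map_neg]; exact neg_mem hW⟩
  mul_mem' := by
    rintro P Q ⟨hP, hP'⟩ ⟨hQ, hQ'⟩
    refine ⟨fun W W' h h' g => ?_, fun x hx => ?_⟩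
    · change resO h' (P ⟨W, h⟩ (Q ⟨W, h⟩ g)) = _
      rw [hP, hQ]; rfl
    · obtain ⟨W, h, hxW, hW⟩ := hP' x hx
      obtain ⟨W', h', hxW', hW'⟩ := hQ' x hx
      refine ⟨W ⊓ W', inf_le_left.trans h, ⟨hxW, hxW'⟩, ?_⟩
      beta_reduce
      rw [map_mul]
      exact mul_mem (res_mem_closure f (inf_le_left : W ⊓ W' ≤ W) hW)
        (res_mem_closure f (inf_le_right : W ⊓ W' ≤ W') hW')

/-- Restriction of differential operators. -/
def diffOpRes {X : Scheme.{0}} (f : X ⟶ Spec (.of ℂ)) {U W : X.Opens} (h : W ≤ U) :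
    diffOp f U →+* diffOp f W :=
  ((Fam.res h).comp (diffOp f U).subtype).codRestrict (diffOp f W) fun P =>
    ⟨fun V V' hV hV' g => P.2.1 V V' (hV.trans h) hV' g, fun x hx => by
      obtain ⟨W', h', hxW', hW'⟩ := P.2.2 x (h hx)
      exact ⟨W ⊓ W', inf_le_left, ⟨hx, hxW'⟩,
        res_mem_closure f (inf_le_right : W ⊓ W' ≤ W') hW'⟩⟩

/-- The sheaf of rings `𝒟_X`. -/
def diffOpPresheaf {X : Scheme.{0}} (f : X ⟶ Spec (.of ℂ)) : X.Opensᵒᵖ ⥤ RingCat.{0} where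
  obj U := .of (diffOp f U.unop)
  map h := RingCat.ofHom (diffOpRes f h.unop.le)
  map_id _ := rfl
  map_comp _ _ := rfl

/-- A function as a differential operator of order zero. -/
def mulOp {X : Scheme.{0}} (f : X ⟶ Spec (.of ℂ)) {U : X.Opens} (g : Γ(X, U)) : diffOp f U :=
  ⟨Fam.mulBy g, by
    refine ⟨fun W W' h h' y => ?_, fun _ hx => ⟨U, le_rfl, hx,
      Subring.subset_closure (Or.inl ⟨g, rfl⟩)⟩⟩
    change resO h' (resO h g * y) = resO (h'.trans h) g * resO h' y
    rw [map_mul]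
    congr 1
    simp only [resO, ← CommRingCat.comp_apply, ← Functor.map_comp]
    rfl⟩

/-- A vector field as a differential operator. -/
def vfOp {X : Scheme.{0}} (f : X ⟶ Spec (.of ℂ)) {U : X.Opens} (δ : Fam X U)
    (hδ : δ.IsVectorField f) : diffOp f U :=
  ⟨δ, hδ.natural, fun _ hx => ⟨U, le_rfl, hx, Subring.subset_closure (Or.inr hδ)⟩⟩

/-- Constants as differential operators. -/
def cstOp {X : Scheme.{0}} (f : X ⟶ Spec (.of ℂ)) (U : X.Opens) : ℂ →+* diffOp f U where
  toFun c := mulOp f (cst f U c)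
  map_one' := Subtype.ext <| funext fun W => AddMonoidHom.ext fun y => by
    change resO W.2 (cst f U 1) * y = y
    simp
  map_mul' a b := Subtype.ext <| funext fun W => AddMonoidHom.ext fun y => by
    change resO W.2 (cst f U (a * b)) * y = resO W.2 (cst f U a) * (resO W.2 (cst f U b) * y)
    simp [mul_assoc]
  map_zero' := Subtype.ext <| funext fun W => AddMonoidHom.ext fun y => by
    change resO W.2 (cst f U 0) * y = 0
    simp
  map_add' a b := Subtype.ext <| funext fun W => AddMonoidHom.ext fun y => by
    change resO W.2 (cst f U (a + b)) * y = resO W.2 (cst f U a) * y + resO W.2 (cst f U b) * y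
    simp [add_mul]

/-! ### The filtration on differential operators -/

/-- The ideal of the closed subscheme `Z` (embedded by `i`) on the open subset `W`. -/
def idealOf {X Z : Scheme.{0}} (i : Z ⟶ X) (W : X.Opens) : Ideal Γ(X, W) :=
  RingHom.ker (i.app W).hom

/-- `V^j 𝒟_X (U) = {P | P 𝓘^k ⊆ 𝓘^{k+j} for all integers k}`, with `𝓘^k = 𝒪_X` for `k ≤ 0`. The
inclusion of sheaves is tested on affine opens, where `𝓘^k` is the power of the ideal. -/
def VD {X Z : Scheme.{0}} (f : X ⟶ Spec (.of ℂ)) (i : Z ⟶ X) (j : ℤ) (U : X.Opens) :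
    AddSubgroup (diffOp f U) where
  carrier := {P | ∀ W : {W : X.Opens // W ≤ U}, IsAffineOpen W.1 → ∀ k : ℤ,
    ∀ g ∈ idealOf i W.1 ^ k.toNat, P.1 W g ∈ idealOf i W.1 ^ (k + j).toNat}
  zero_mem' := fun _ _ _ _ _ => Ideal.zero_mem _
  add_mem' := fun hP hQ W hW k g hg => Ideal.add_mem _ (hP W hW k g hg) (hQ W hW k g hg)
  neg_mem' := fun {P} hP W hW k g hg => by
    change -(P.1 W g) ∈ _
    exact (Ideal.neg_mem_iff _).2 (hP W hW k g hg)

/-- The subring `V^0 𝒟_X (U)`. -/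
def V0D {X Z : Scheme.{0}} (f : X ⟶ Spec (.of ℂ)) (i : Z ⟶ X) (U : X.Opens) :
    Subring (diffOp f U) where
  __ := VD f i 0 U
  one_mem' := fun W _ k g hg => by simpa using hg
  mul_mem' := fun {P Q} hP hQ W hW k g hg => by
    have h1 := hQ W hW k g hg
    rw [add_zero] at h1
    exact hP W hW k _ h1

/-! ### Local coordinates -/

/-- Local coordinates `(x, t)` of `X` on the open subset `W` such that `Z ∩ W = {t = 0}`: functions
`t`, `x`, together with the coordinate vector fields, which are dual to the coordinates and form a
basis of the tangent sheaf of `W`; the ideal of `Z` is generated by the `t`'s. -/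
structure Coords {X Z : Scheme.{0}} (f : X ⟶ Spec (.of ℂ)) (i : Z ⟶ X) (W : X.Opens) where
  r : ℕ
  n : ℕ
  t : Fin r → Γ(X, W)
  x : Fin n → Γ(X, W)
  dt : Fin r → Fam X W
  dx : Fin n → Fam X W
  dt_vf : ∀ j, (dt j).IsVectorField f
  dx_vf : ∀ j, (dx j).IsVectorField f
  dt_t : ∀ j k, dt j ⟨W, le_rfl⟩ (t k) = if j = k then 1 else 0
  dt_x : ∀ j k, dt j ⟨W, le_rfl⟩ (x k) = 0
  dx_t : ∀ j k, dx j ⟨W, le_rfl⟩ (t k) = 0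
  dx_x : ∀ j k, dx j ⟨W, le_rfl⟩ (x k) = if j = k then 1 else 0
  span_vf : ∀ (W' : X.Opens) (h : W' ≤ W) (δ : Fam X W'), δ.IsVectorField f →
    δ = ∑ j, Fam.mulBy (δ ⟨W', le_rfl⟩ (resO h (t j))) * Fam.res h (dt j) +
      ∑ j, Fam.mulBy (δ ⟨W', le_rfl⟩ (resO h (x j))) * Fam.res h (dx j)
  ideal_eq : ∀ (W' : X.Opens) (h : W' ≤ W), IsAffineOpen W' →
    idealOf i W' = Ideal.span (Set.range fun j => resO h (t j))

/-- The operator `∑_j ∂_{t_j} t_j` in local coordinates. -/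
def Coords.euler {X Z : Scheme.{0}} {f : X ⟶ Spec (.of ℂ)} {i : Z ⟶ X} {W : X.Opens}
    (C : Coords f i W) : diffOp f W :=
  ∑ j, vfOp f (C.dt j) (C.dt_vf j) * mulOp f (C.t j)

/-! ### Modules over differential operators -/

section Modules

variable {X Z : Scheme.{0}} {f : X ⟶ Spec (.of ℂ)}

/-- The sections of `M` over `U`. -/
abbrev Sec (M : PresheafOfModules.{0} (diffOpPresheaf f)) (U : X.Opens) : Type :=
  M.obj (op U)

instance (M : PresheafOfModules.{0} (diffOpPresheaf f)) (U : X.Opens) :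
    Module (diffOp f U) (Sec M U) :=
  (M.obj (op U)).isModule

/-- Restriction of sections. -/
def resM (M : PresheafOfModules.{0} (diffOpPresheaf f)) {U W : X.Opens} (h : W ≤ U) :
    Sec M U →+ Sec M W where
  toFun m := M.map (homOfLE h).op m
  map_zero' := map_zero (M.map (homOfLE h).op).hom
  map_add' := map_add (M.map (homOfLE h).op).hom

/-- `F` is a subsheaf of abelian groups of `M`. -/
structure IsSubsheaf (M : PresheafOfModules.{0} (diffOpPresheaf f))
    (F : ∀ U : X.Opens, AddSubgroup (Sec M U)) : Prop where
  res_mem : ∀ (U W : X.Opens) (h : W ≤ U), ∀ m ∈ F U, resM M h m ∈ F W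
  of_local : ∀ (U : X.Opens) (m : Sec M U),
    LocallyOn U (fun W h => resM M h m ∈ F W) → m ∈ F U

/-- Let `A` be a sheaf of subrings of `𝒟_X` and `F ⊆ M` a subsheaf of `A`-modules. Then `F` is
coherent over `A`: it is locally finitely generated, and so is the sheaf of relations between
finitely many sections of `F` over any open subset. -/
structure IsCoherentOver (M : PresheafOfModules.{0} (diffOpPresheaf f))
    (A : ∀ U : X.Opens, Subring (diffOp f U))
    (F : ∀ U : X.Opens, AddSubgroup (Sec M U)) : Prop where
  finite_type : LocallyOn ⊤ fun W _ => ∃ (n : ℕ) (g : Fin n → Sec M W), (∀ k, g k ∈ F W) ∧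
    ∀ (W' : X.Opens) (h : W' ≤ W), ∀ m ∈ F W', LocallyOn W' fun W'' h' =>
      ∃ a : Fin n → diffOp f W'', (∀ k, a k ∈ A W'') ∧
        resM M h' m = ∑ k, a k • resM M (h'.trans h) (g k)
  relations : ∀ (U : X.Opens) (n : ℕ) (g : Fin n → Sec M U), (∀ k, g k ∈ F U) →
    LocallyOn U fun W h => ∃ (l : ℕ) (ρ : Fin l → Fin n → diffOp f W),
      (∀ q, (∀ k, ρ q k ∈ A W) ∧ ∑ k, ρ q k • resM M h (g k) = 0) ∧
      ∀ (W' : X.Opens) (h' : W' ≤ W) (σ : Fin n → diffOp f W'), (∀ k, σ k ∈ A W') →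
        ∑ k, σ k • resM M (h'.trans h) (g k) = 0 →
        LocallyOn W' fun W'' h'' => ∃ a : Fin l → diffOp f W'', (∀ q, a q ∈ A W'') ∧
          ∀ k, diffOpRes f h'' (σ k) = ∑ q, a q * diffOpRes f (h''.trans h') (ρ q k)

/-- `M` is a coherent left `𝒟_X`-module: a sheaf of left modules, coherent over `𝒟_X`. -/
structure IsCoherentDModule (M : PresheafOfModules.{0} (diffOpPresheaf f)) : Prop where
  isSheaf : TopCat.Presheaf.IsSheaf M.presheaf
  coherent : IsCoherentOver M (fun _ => ⊤) (fun _ => ⊤)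

/-- The section `m` of `M` over `U` belongs to `V^{>α} = ⋃_{β > α} V^β` (a union of sheaves, so
membership is local). -/
def InVgt (M : PresheafOfModules.{0} (diffOpPresheaf f))
    (V : ℝ → ∀ U : X.Opens, AddSubgroup (Sec M U)) (α : ℝ) (U : X.Opens) (m : Sec M U) : Prop :=
  LocallyOn U fun W h => ∃ β > α, resM M h m ∈ V β W

/-- `Gr_V^α ≠ 0`. -/
def GrNonzero (M : PresheafOfModules.{0} (diffOpPresheaf f))
    (V : ℝ → ∀ U : X.Opens, AddSubgroup (Sec M U)) (α : ℝ) : Prop :=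
  ∃ (U : X.Opens) (m : Sec M U), m ∈ V α U ∧ ¬ InVgt M V α U m

/-- `V` is a `V`-filtration along `Z` on the `𝒟_X`-module `M`. -/
structure IsVFiltration (i : Z ⟶ X) (M : PresheafOfModules.{0} (diffOpPresheaf f))
    (V : ℝ → ∀ U : X.Opens, AddSubgroup (Sec M U)) : Prop where
  /-- Each `V^α` is a subsheaf of `M`. -/
  subsheaf : ∀ α, IsSubsheaf M (V α)
  /-- The filtration is decreasing. -/
  decreasing : ∀ α β, α ≤ β → ∀ U, V β U ≤ V α U
  /-- The filtration is exhaustive. -/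
  exhaustive : ∀ (U : X.Opens) (m : Sec M U), LocallyOn U fun W h => ∃ α, resM M h m ∈ V α W
  /-- Each `V^α` is coherent over `V^0 𝒟_X` (it is stable under `V^0 𝒟_X` by `VD_smul`). -/
  coherent : ∀ α, IsCoherentOver M (V0D f i) (V α)
  /-- Left-continuity: `V^α = ⋂_{β < α} V^β`. -/
  left_continuous : ∀ (α : ℝ) (U : X.Opens) (m : Sec M U), (∀ β < α, m ∈ V β U) → m ∈ V α U
  /-- Every bounded interval contains only finitely many `α` with `Gr_V^α ≠ 0`. -/
  discrete : ∀ a b : ℝ, {α | α ∈ Set.Icc a b ∧ GrNonzero M V α}.Finite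
  /-- All `α` with `Gr_V^α ≠ 0` are rational. -/
  rational : ∀ α, GrNonzero M V α → ∃ q : ℚ, α = q
  /-- `(V^j 𝒟_X)(V^α M) ⊆ V^{α+j} M`. -/
  VD_smul : ∀ (α : ℝ) (j : ℤ) (U : X.Opens), ∀ P ∈ VD f i j U, ∀ m ∈ V α U, P • m ∈ V (α + j) U
  /-- `∑_j t_j V^α = V^{α+1}` for `α ≫ 0`. -/
  sum_t : ∃ α₀ : ℝ, ∀ α ≥ α₀, ∀ (W : X.Opens) (C : Coords f i W) (m : Sec M W),
    m ∈ V (α + 1) W ↔ LocallyOn W fun W' h => ∃ v : Fin C.r → Sec M W', (∀ j, v j ∈ V α W') ∧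
      resM M h m = ∑ j, mulOp f (resO h (C.t j)) • v j
  /-- `∑_j ∂_{t_j} t_j - α` is nilpotent on `Gr_V^α`. -/
  nilpotent : ∀ α : ℝ, ∃ N : ℕ, ∀ (W : X.Opens) (C : Coords f i W), ∀ m ∈ V α W,
    InVgt M V α W ((C.euler - cstOp f W (α : ℂ)) ^ N • m)

/-! ### Bernstein–Sato polynomials -/

/-- The section `m` of `M` over `W ≤ U` belongs to the subsheaf `V^j 𝒟_X u`, where `u` is a section
over `U`. -/
def InVDu (i : Z ⟶ X) (M : PresheafOfModules.{0} (diffOpPresheaf f)) (j : ℤ)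
    {U : X.Opens} (u : Sec M U) {W : X.Opens} (h : W ≤ U) (m : Sec M W) : Prop :=
  LocallyOn W fun W' h' => ∃ P ∈ VD f i j W', resM M h' m = P • resM M (h'.trans h) u

/-- The polynomial `p(s)` acts as zero on `V^0 𝒟_X u / V^1 𝒟_X u`, where `s = -∑_j ∂_{t_j} t_j` in
local coordinates. -/
def Annihilates (i : Z ⟶ X) (M : PresheafOfModules.{0} (diffOpPresheaf f))
    {U : X.Opens} (u : Sec M U) (p : Polynomial ℂ) : Prop :=
  ∀ (W : X.Opens) (h : W ≤ U) (C : Coords f i W) (m : Sec M W),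
    InVDu i M 0 u h m → InVDu i M 1 u h (p.eval₂ (cstOp f W) (-C.euler) • m)

/-- `b` is the Bernstein–Sato polynomial of `u`: the monic minimal polynomial of the action of
`s = -∑_j ∂_{t_j} t_j` on `V^0 𝒟_X u / V^1 𝒟_X u`. -/
structure IsBernsteinSato (i : Z ⟶ X) (M : PresheafOfModules.{0} (diffOpPresheaf f))
    {U : X.Opens} (u : Sec M U) (b : Polynomial ℂ) : Prop where
  monic : b.Monic
  annihilates : Annihilates i M u b
  minimal : ∀ p : Polynomial ℂ, Annihilates i M u p → b ∣ p

end Modules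

end

end VFilt

/-! Write `s` for `-∑ ∂_{t_j} t_j`. On `Gr_V^a` the operator `s + a` is nilpotent, so a product of
powers of `s + a`, taken over the finitely many jumps `a` in `[α, β]`, sends `V^α` into `V^β`
(`IsVFiltration.polyOp_smul_mem`). The essential input is an Artin–Rees property
(`IsVFiltration.artinRees`): for a given `u` there is `β` such that sections of `V^β` lying in `V^0
𝒟 u` already lie in `V^1 𝒟 u`. If `u` is in `V^α`, then `V^0 𝒟 u ⊆ V^α`, and the product above
annihilates `V^0 𝒟 u / V^1 𝒟 u` (`IsVFiltration.exists_annihilates`). Hence `b_u` exists, and its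
roots are among the `-a` with `a ≥ α` a jump, in particular rational; being monic, `b_u` has
rational coefficients.

Conversely, suppose `u` is not in `V^α`. By left-continuity and quasi-compactness `u` lies in some
`V^s` with `s < α` but not in `V^{>s}` (`IsVFiltration.mem_or_exists_jump`). If `-s` were not a root
of `b_u`, then `b_u` would be coprime to every power of `X + s`. Since `b_u` sends `u` into `V^1 𝒟 u
⊆ V^{s+1}` and some power of `X + s` sends it into `V^{>s}`, a Bézout identity would put `u` itself
in `V^{>s}` (`IsVFiltration.inVgt_of_isBernsteinSato`). So `-s` is a root, with `s < α`.

The Artin–Rees property is proved near points of `Z`, as `V^j 𝒟 = 𝒟` elsewhere. Take coordinates on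
an affine `W` (`exists_coords`) and the Rees ring generated over `𝒪(W)` by `∂_x` and `t_j ∂_{t_k}`
in degree 0 and by the `t_j` in degree 1. Its generators commute up to lower order, so it is left
Noetherian by Hilbert's argument with symbols (`AlmostCommuting.isNoetherianRing`), and the usual
proof of Artin–Rees applies (`ReesRelations.artinRees`). Up to denominators the degree-0 part is all
of `V^0 𝒟` (`Coords.exists_mulOp_mul_eq`), and `V^{α₀+d}` is generated from `V^{α₀}` by degree `d`
of the Rees ring (`exists_reesRing_combination`). This yields a statement on germs
(`artinRees_germ`); coherence of the `V^α` spreads it to a neighbourhood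
(`IsVFiltration.artinRees_of_mem_range`), and quasi-compactness makes `β` uniform. -/

namespace VFilt

/-! ### A Hilbert basis theorem for almost commuting generators. -/

section HilbertBasis

open MvPolynomial

variable {A E ι : Type*} [CommRing A] [Ring E] (φ : A →+* E) (y : ι → E)

/-- The additive group spanned by the words in `y` of length less than `d`, with coefficients. -/
def wordFilt (d : ℕ) : AddSubgroup E :=
  AddSubgroup.closure {w | ∃ (a : A) (l : List ι), l.length < d ∧ w = φ a * (l.map y).prod}

/-- The ring `E` contains `A`, and the elements `y` commute with `A` and with each other up to terms
of lower degree. -/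
structure AlmostCommuting : Prop where
  coeff : ∀ i a, ∃ b, y i * φ a - φ a * y i = φ b
  gens : ∀ i j, y i * y j - y j * y i ∈ wordFilt φ y 2

/-- The ring generated by `A` and the `y`. -/
def genRing : Subring E := Subring.closure (Set.range φ ∪ Set.range y)

variable {φ y}

lemma word_mem_wordFilt (a : A) {l : List ι} {d : ℕ} (h : l.length < d) :
    φ a * (l.map y).prod ∈ wordFilt φ y d :=
  AddSubgroup.subset_closure ⟨a, l, h, rfl⟩

lemma wordFilt_mono {d e : ℕ} (h : d ≤ e) : wordFilt φ y d ≤ wordFilt φ y e :=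
  AddSubgroup.closure_mono fun _ ⟨a, l, hl, hw⟩ => ⟨a, l, hl.trans_le h, hw⟩

lemma wordFilt_zero {w : E} (h : w ∈ wordFilt φ y 0) : w = 0 := by
  have : wordFilt φ y 0 ≤ ⊥ := by
    rw [wordFilt, AddSubgroup.closure_le]
    rintro w ⟨a, l, hl, -⟩
    exact absurd hl (Nat.not_lt_zero _)
  exact this h

lemma coeff_mul_mem_wordFilt (a : A) {d : ℕ} {w : E} (hw : w ∈ wordFilt φ y d) :
    φ a * w ∈ wordFilt φ y d := by
  induction hw using AddSubgroup.closure_induction with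
  | mem w hw =>
    obtain ⟨b, l, hl, rfl⟩ := hw
    rw [← mul_assoc, ← map_mul]
    exact word_mem_wordFilt _ hl
  | zero => simp
  | add u v _ _ hu hv => rw [mul_add]; exact add_mem hu hv
  | neg u _ hu => rw [mul_neg]; exact neg_mem hu

lemma AlmostCommuting.gen_mul_mem (H : AlmostCommuting φ y) (i : ι) {d : ℕ} {w : E}
    (hw : w ∈ wordFilt φ y d) : y i * w ∈ wordFilt φ y (d + 1) := by
  induction hw using AddSubgroup.closure_induction with
  | mem w hw =>
    obtain ⟨a, l, hl, rfl⟩ := hw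
    obtain ⟨b, hb⟩ := H.coeff i a
    have : y i * (φ a * (l.map y).prod) =
        φ a * ((i :: l).map y).prod + φ b * (l.map y).prod := by
      rw [← hb, List.map_cons, List.prod_cons]; noncomm_ring
    rw [this]
    exact add_mem (word_mem_wordFilt _ (by simpa using hl)) (word_mem_wordFilt _ (by omega))
  | zero => simp
  | add u v _ _ hu hv => rw [mul_add]; exact add_mem hu hv
  | neg u _ hu => rw [mul_neg]; exact neg_mem hu

lemma AlmostCommuting.word_mul_mem (H : AlmostCommuting φ y) (l : List ι) {d : ℕ} {w : E}
    (hw : w ∈ wordFilt φ y d) : (l.map y).prod * w ∈ wordFilt φ y (d + l.length) := by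
  induction l with
  | nil => simpa using hw
  | cons i l ih =>
    rw [List.map_cons, List.prod_cons, mul_assoc]
    exact H.gen_mul_mem i ih

lemma AlmostCommuting.mul_mem (H : AlmostCommuting φ y) {d e : ℕ} {v w : E}
    (hv : v ∈ wordFilt φ y (d + 1)) (hw : w ∈ wordFilt φ y e) :
    v * w ∈ wordFilt φ y (d + e) := by
  induction hv using AddSubgroup.closure_induction with
  | mem v hv =>
    obtain ⟨a, l, hl, rfl⟩ := hv
    rw [mul_assoc]
    exact coeff_mul_mem_wordFilt _ (wordFilt_mono (by omega) (H.word_mul_mem l hw))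
  | zero => simp
  | add u v _ _ hu hv => rw [add_mul]; exact add_mem hu hv
  | neg u _ hu => rw [neg_mul]; exact neg_mem hu

/-- Transposing two neighbouring letters costs a commutator, a term of degree at most one, in place
of two letters. The filtration index bounds the length strictly, so the error sits exactly at index
`l.length`. -/
lemma AlmostCommuting.perm (H : AlmostCommuting φ y) {l l' : List ι} (h : l.Perm l') :
    (l.map y).prod - (l'.map y).prod ∈ wordFilt φ y l.length := by
  induction h with
  | nil => simp
  | cons i _ ih =>
    simp only [List.map_cons, List.prod_cons, ← mul_sub]
    exact H.gen_mul_mem i ih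
  | swap i j l =>
    simp only [List.map_cons, List.prod_cons, ← mul_assoc, ← sub_mul]
    have h1 : (l.map y).prod ∈ wordFilt φ y (l.length + 1) := by
      simpa using word_mem_wordFilt (φ := φ) (y := y) 1 (Nat.lt_succ_self l.length)
    have := H.mul_mem (H.gens j i) h1
    refine wordFilt_mono ?_ this
    simp only [List.length_cons]; omega
  | trans h1 _ ih1 ih2 =>
    rw [← h1.length_eq] at ih2
    simpa using add_mem ih1 ih2

/-- The substitution of `y` for the variables, in some order in each monomial. -/
noncomputable def ordEval (φ : A →+* E) (y : ι → E) : MvPolynomial ι A →+ E :=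
  (Finsupp.liftAddHom (fun e => (AddMonoidHom.mulRight
    ((Finsupp.toMultiset e).toList.map y).prod).comp φ.toAddMonoidHom)).comp
    AddMonoidAlgebra.coeffAddEquiv.toAddMonoidHom

lemma ordEval_monomial (e : ι →₀ ℕ) (a : A) :
    ordEval φ y (monomial e a) = φ a * ((Finsupp.toMultiset e).toList.map y).prod :=
  Finsupp.liftAddHom_apply_single _ _ _

lemma ordEval_C_mul (a : A) (p : MvPolynomial ι A) :
    ordEval φ y (C a * p) = φ a * ordEval φ y p := by
  induction p using MvPolynomial.induction_on' with
  | monomial e b =>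
    rw [C_mul_monomial, ordEval_monomial, ordEval_monomial, map_mul, mul_assoc]
  | add p q hp hq => rw [mul_add, map_add, map_add, mul_add, hp, hq]

/-- Both moving `y i` past the coefficient and sorting it into the monomial produce only terms of
degree at most `d`. This is what makes the set of symbols of a left ideal stable under
multiplication by variables. -/
lemma AlmostCommuting.ordEval_X_mul (H : AlmostCommuting φ y) (i : ι) {d : ℕ}
    (p : MvPolynomial ι A) (hp : p.IsHomogeneous d) :
    y i * ordEval φ y p - ordEval φ y (X i * p) ∈ wordFilt φ y (d + 1) := by
  rw [p.as_sum, Finset.mul_sum, map_sum, map_sum, Finset.mul_sum, ← Finset.sum_sub_distrib]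
  refine sum_mem fun e he => ?_
  have hd : e.degree = d := by
    rw [← hp (mem_support_iff.1 he), Finsupp.degree_eq_weight_one]; rfl
  obtain ⟨b, hb⟩ := H.coeff i (p.coeff e)
  have hX : (X i : MvPolynomial ι A) * monomial e (p.coeff e) =
      monomial (Finsupp.single i 1 + e) (p.coeff e) := by
    rw [X, monomial_mul, one_mul]
  have hlen : (Finsupp.toMultiset e).toList.length = d := by
    rw [Multiset.length_toList, Finsupp.card_toMultiset, ← hd]; rfl
  have hperm : (i :: (Finsupp.toMultiset e).toList).Perm
      (Finsupp.toMultiset (Finsupp.single i 1 + e)).toList := by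
    rw [← Multiset.coe_eq_coe, ← Multiset.cons_coe, Multiset.coe_toList, Multiset.coe_toList,
      map_add, Finsupp.toMultiset_single, one_smul, Multiset.singleton_add]
  have key := coeff_mul_mem_wordFilt (p.coeff e) (H.perm hperm)
  rw [hX, ordEval_monomial, ordEval_monomial]
  rw [List.length_cons, hlen, List.map_cons, List.prod_cons] at key
  have h2 := word_mem_wordFilt (φ := φ) (y := y) b (hlen.trans_lt (Nat.lt_succ_self d))
  rw [← hb] at h2
  convert add_mem key h2 using 1
  noncomm_ring

lemma AlmostCommuting.exists_symbol (H : AlmostCommuting φ y) {d : ℕ} {w : E}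
    (hw : w ∈ wordFilt φ y (d + 1)) :
    ∃ p : MvPolynomial ι A, p.IsHomogeneous d ∧ w - ordEval φ y p ∈ wordFilt φ y d := by
  induction hw using AddSubgroup.closure_induction with
  | mem w hw =>
    obtain ⟨a, l, hl, rfl⟩ := hw
    rcases Nat.lt_succ_iff_lt_or_eq.1 hl with hl | hl
    · exact ⟨0, isHomogeneous_zero _ _ _, by simpa using word_mem_wordFilt a hl⟩
    · classical
      refine ⟨monomial (Multiset.toFinsupp (l : Multiset ι)) a, ?_, ?_⟩
      · apply isHomogeneous_monomial
        rw [← hl, ← Multiset.coe_card, ← Multiset.toFinsupp_sum_eq]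
        rfl
      · rw [ordEval_monomial, ← mul_sub, ← hl]
        refine coeff_mul_mem_wordFilt _ (H.perm ?_)
        rw [← Multiset.coe_eq_coe, Multiset.coe_toList]
        simp
  | zero => exact ⟨0, isHomogeneous_zero _ _ _, by simp⟩
  | add u v _ _ hu hv =>
    obtain ⟨p, hp, hp'⟩ := hu
    obtain ⟨q, hq, hq'⟩ := hv
    refine ⟨p + q, hp.add hq, ?_⟩
    rw [map_add, add_sub_add_comm]
    exact add_mem hp' hq'
  | neg u _ hu =>
    obtain ⟨p, hp, hp'⟩ := hu
    refine ⟨-p, hp.neg, ?_⟩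
    rw [map_neg, ← neg_sub']
    exact neg_mem hp'

lemma range_subset_genRing (a : A) : φ a ∈ genRing φ y := Subring.subset_closure (Or.inl ⟨a, rfl⟩)

lemma gen_mem_genRing (i : ι) : y i ∈ genRing φ y := Subring.subset_closure (Or.inr ⟨i, rfl⟩)

lemma AlmostCommuting.exists_mem_wordFilt (H : AlmostCommuting φ y) {w : E}
    (hw : w ∈ genRing φ y) : ∃ d, w ∈ wordFilt φ y (d + 1) := by
  induction hw using Subring.closure_induction with
  | mem w hw =>
    rcases hw with ⟨a, rfl⟩ | ⟨i, rfl⟩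
    · exact ⟨0, by simpa using word_mem_wordFilt (y := y) a (l := []) (Nat.succ_pos 0)⟩
    · exact ⟨1, by simpa using word_mem_wordFilt (φ := φ) (y := y) 1 (l := [i]) (d := 2) (by simp)⟩
  | zero => exact ⟨0, zero_mem _⟩
  | one => exact ⟨0, by simpa using word_mem_wordFilt (φ := φ) (y := y) 1 (l := []) (Nat.succ_pos 0)⟩
  | add u v _ _ hu hv =>
    obtain ⟨d, hd⟩ := hu
    obtain ⟨e, he⟩ := hv
    exact ⟨max d e, add_mem (wordFilt_mono (by omega) hd) (wordFilt_mono (by omega) he)⟩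
  | neg u _ hu =>
    obtain ⟨d, hd⟩ := hu
    exact ⟨d, neg_mem hd⟩
  | mul u v _ _ hu hv =>
    obtain ⟨d, hd⟩ := hu
    obtain ⟨e, he⟩ := hv
    exact ⟨d + e, H.mul_mem hd (e := e + 1) he⟩

/-- The ideal of symbols of the elements of a left ideal. -/
noncomputable def AlmostCommuting.symbolIdeal (H : AlmostCommuting φ y)
    (N : Submodule (genRing φ y) (genRing φ y)) : Ideal (MvPolynomial ι A) where
  -- Symbols need not be unique: a form whose ordered evaluation has lower order counts as a symbol
  -- of `0`. Thus no PBW-type independence of the monomials is required.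
  carrier := {p | ∀ d, ∃ w ∈ N, (w : E) - ordEval φ y (homogeneousComponent d p) ∈ wordFilt φ y d}
  zero_mem' d := ⟨0, zero_mem _, by simp⟩
  add_mem' {p q} hp hq d := by
    obtain ⟨v, hv, hv'⟩ := hp d
    obtain ⟨w, hw, hw'⟩ := hq d
    refine ⟨v + w, add_mem hv hw, ?_⟩
    rw [map_add, map_add, Subring.coe_add, add_sub_add_comm]
    exact add_mem hv' hw'
  smul_mem' c p hp := by
    rw [smul_eq_mul]
    induction c using MvPolynomial.induction_on generalizing p with
    | C a =>
      intro d
      obtain ⟨w, hw, hw'⟩ := hp d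
      refine ⟨⟨φ a, range_subset_genRing a⟩ • w, N.smul_mem _ hw, ?_⟩
      rw [homogeneousComponent_C_mul, ordEval_C_mul]
      change φ a * (w : E) - _ ∈ _
      rw [← mul_sub]
      exact coeff_mul_mem_wordFilt _ hw'
    | add c c' hc hc' =>
      intro d
      obtain ⟨v, hv, hv'⟩ := hc p hp d
      obtain ⟨w, hw, hw'⟩ := hc' p hp d
      refine ⟨v + w, add_mem hv hw, ?_⟩
      rw [add_mul, map_add, map_add, Subring.coe_add, add_sub_add_comm]
      exact add_mem hv' hw'
    | mul_X c i hc =>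
      rw [mul_assoc]
      refine hc _ fun d => ?_
      rcases d with _ | d
      · refine ⟨0, zero_mem _, ?_⟩
        have : MvPolynomial.coeff 0 (X i * p) = 0 := by classical simp [coeff_X_mul']
        simp [homogeneousComponent_zero, this]
      · obtain ⟨w, hw, hw'⟩ := hp d
        refine ⟨⟨y i, gen_mem_genRing i⟩ • w, N.smul_mem _ hw, ?_⟩
        have h1 : homogeneousComponent (d + 1) (X i * p) = X i * homogeneousComponent d p := by
          classical
          ext e
          rw [coeff_homogeneousComponent, coeff_X_mul', coeff_X_mul', coeff_homogeneousComponent]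
          by_cases hi : i ∈ e.support
          · have he : Finsupp.single i 1 + (e - Finsupp.single i 1) = e :=
              add_tsub_cancel_of_le (Finsupp.single_le_iff.2
                (Nat.one_le_iff_ne_zero.2 (Finsupp.mem_support_iff.1 hi)))
            have hdeg : e.degree = 1 + (e - Finsupp.single i 1).degree := by
              conv_lhs => rw [← he]
              rw [map_add, Finsupp.degree_single]
            simp only [hi, if_true]
            exact if_congr (by omega) rfl rfl
          · simp [hi]
        rw [h1]
        change y i * (w : E) - _ ∈ _
        have := add_mem (H.gen_mul_mem i hw')
          (H.ordEval_X_mul i _ (homogeneousComponent_isHomogeneous d p))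
        convert this using 1
        noncomm_ring

/-- If `N' ≤ N` have the same symbols, any `w ∈ N` can be corrected by an element of `N'` with the
same leading form; the difference has smaller order, and the induction ends at order index `0`,
where the filtration vanishes. Ascending chains of left ideals are thereby controlled by ideals of a
polynomial ring. -/
lemma AlmostCommuting.symbolIdeal_strictMono (H : AlmostCommuting φ y) :
    StrictMono H.symbolIdeal := by
  intro N' N hlt
  refine lt_of_le_of_ne
    (fun p hp d => (hp d).imp fun w hw => ⟨hlt.le hw.1, hw.2⟩) fun h => hlt.not_ge ?_
  suffices ∀ d, ∀ w ∈ N, (w : E) ∈ wordFilt φ y d → w ∈ N' from fun w hw => by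
    obtain ⟨d, hd⟩ := H.exists_mem_wordFilt w.2
    exact this _ w hw hd
  intro d
  induction d with
  | zero =>
    intro w _ hw
    rw [Subtype.ext (a1 := w) (a2 := 0) (wordFilt_zero hw)]
    exact zero_mem _
  | succ d ih =>
    intro w hwN hw
    obtain ⟨p, hp, hp'⟩ := H.exists_symbol hw
    have hpN : p ∈ H.symbolIdeal N := fun e => by
      rw [homogeneousComponent_of_mem hp]
      split_ifs with he
      · exact ⟨w, hwN, he ▸ hp'⟩
      · exact ⟨0, zero_mem _, by simp⟩
    rw [← h] at hpN
    obtain ⟨w', hw', hw''⟩ := hpN d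
    rw [homogeneousComponent_of_mem hp, if_pos rfl] at hw''
    have := ih (w - w') (sub_mem hwN (hlt.le hw')) (by
      rw [AddSubgroupClass.coe_sub, ← sub_sub_sub_cancel_right _ _ (ordEval φ y p)]
      exact sub_mem hp' hw'')
    simpa using add_mem this hw'

/-- A ring generated by a Noetherian commutative ring and finitely many elements that commute up to
terms of lower degree is left Noetherian. -/
theorem AlmostCommuting.isNoetherianRing [IsNoetherianRing A] [Finite ι]
    (H : AlmostCommuting φ y) : IsNoetherianRing (genRing φ y) := by
  have : WellFoundedGT (Ideal (MvPolynomial ι A)) := inferInstance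
  exact isNoetherian_iff'.2 H.symbolIdeal_strictMono.wellFoundedGT

end HilbertBasis

/-! ### The Rees ring and the Artin–Rees argument. -/

section ArtinRees

open Polynomial

variable {A D ι κ : Type*} [CommRing A] [Ring D] (φ : A →+* D) (y : ι → D) (t : κ → A)

/-- Generators of the Rees ring. -/
noncomputable def reesGen : ι ⊕ κ → D[X] :=
  Sum.elim (fun i => C (y i)) (fun k => monomial 1 (φ (t k)))

/-- The Rees ring generated by `A`, by `y` in degree zero and by `t` in degree one. -/
noncomputable def reesRing : Subring D[X] := genRing (C.comp φ) (reesGen φ y t)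

/-- The commutation relations for operators `y` of degree zero along the ideal generated by `t`. -/
structure ReesRelations [Fintype κ] : Prop where
  coeff : ∀ i a, ∃ b, y i * φ a - φ a * y i = φ b
  gens : ∀ i j, y i * y j - y j * y i ∈ wordFilt φ y 2
  ideal : ∀ i k, ∃ c : κ → A, y i * φ (t k) - φ (t k) * y i = ∑ l, φ (c l) * φ (t l)

variable {φ y t}

lemma C_mem_wordFilt_reesGen {d : ℕ} {w : D} (hw : w ∈ wordFilt φ y d) :
    C w ∈ wordFilt (C.comp φ) (reesGen φ y t) d := by
  induction hw using AddSubgroup.closure_induction with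
  | mem w hw =>
    obtain ⟨a, l, hl, rfl⟩ := hw
    have := word_mem_wordFilt (φ := C.comp φ) (y := reesGen φ y t) a (l := l.map Sum.inl)
      (by simpa using hl)
    convert this using 1
    rw [map_mul, map_list_prod, List.map_map, List.map_map]
    rfl
  | zero => simp
  | add u v _ _ hu hv => rw [map_add]; exact add_mem hu hv
  | neg u _ hu => rw [map_neg]; exact neg_mem hu

/-- The one relation mixing degrees is the commutator of `y i` with `t k` placed in degree 1. It
lies in the ideal of the `t`'s, still in degree 1, so it is a sum of one-letter words in the
degree-1 generators; this is why `ReesRelations.ideal` is assumed. -/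
lemma ReesRelations.almostCommuting [Fintype κ] (H : ReesRelations φ y t) :
    AlmostCommuting (C.comp φ) (reesGen φ y t) := by
  have key : ∀ i k, C (y i) * monomial 1 (φ (t k)) - monomial 1 (φ (t k)) * C (y i) ∈
      wordFilt (C.comp φ) (reesGen φ y t) 2 := fun i k => by
    obtain ⟨c, hc⟩ := H.ideal i k
    rw [C_mul_monomial, monomial_mul_C, ← map_sub, hc, map_sum]
    refine sum_mem fun l _ => ?_
    have := word_mem_wordFilt (φ := C.comp φ) (y := reesGen φ y t) (c l) (l := [Sum.inr l])
      (d := 2) (by simp)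
    simpa [reesGen, C_mul_monomial] using this
  refine ⟨?_, ?_⟩
  · rintro (i | k) a
    · obtain ⟨b, hb⟩ := H.coeff i a
      refine ⟨b, ?_⟩
      simp only [reesGen, Sum.elim_inl, RingHom.comp_apply, ← map_mul, ← map_sub, hb]
    · refine ⟨0, ?_⟩
      simp only [reesGen, Sum.elim_inr, RingHom.comp_apply, monomial_mul_C, C_mul_monomial,
        ← map_mul, mul_comm a, sub_self, map_zero]
  · rintro (i | k) (j | l)
    · simp only [reesGen, Sum.elim_inl, ← map_mul, ← map_sub]
      exact C_mem_wordFilt_reesGen (H.gens i j)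
    · exact key i l
    · rw [← neg_sub]
      exact neg_mem (key j k)
    · simp only [reesGen, Sum.elim_inr, monomial_mul_monomial, ← map_mul, mul_comm (t k), sub_self]
      exact zero_mem _

/-- The polynomials whose `i`-th coefficient lies in `V i` form a subring, by multiplicativity of
the filtration, and this subring contains the generators. -/
lemma coeff_mem_of_mem_reesRing (V : ℕ → AddSubgroup D) (hone : 1 ∈ V 0)
    (hmul : ∀ i j, ∀ p ∈ V i, ∀ q ∈ V j, p * q ∈ V (i + j))
    (hφ : ∀ a, φ a ∈ V 0) (hy : ∀ i, y i ∈ V 0) (ht : ∀ k, φ (t k) ∈ V 1) {r : D[X]}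
    (hr : r ∈ reesRing φ y t) (i : ℕ) : r.coeff i ∈ V i := by
  have hC : ∀ w ∈ V 0, ∀ j, (C w).coeff j ∈ V j := fun w hw j => by
    rw [coeff_C]; split_ifs with h
    · exact h ▸ hw
    · exact zero_mem _
  induction hr using Subring.closure_induction generalizing i with
  | mem w hw =>
    rcases hw with ⟨a, rfl⟩ | ⟨j | k, rfl⟩
    · exact hC _ (hφ a) i
    · exact hC _ (hy j) i
    · rw [reesGen, Sum.elim_inr, coeff_monomial]; split_ifs with h
      · exact h ▸ ht k
      · exact zero_mem _
  | zero => simp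
  | one => exact hC 1 hone i
  | add u v _ _ hu hv => rw [coeff_add]; exact add_mem (hu i) (hv i)
  | neg u _ hu => rw [coeff_neg]; exact neg_mem (hu i)
  | mul u v _ _ hu hv =>
    rw [coeff_mul]
    refine sum_mem fun e he => ?_
    rw [← Finset.HasAntidiagonal.mem_antidiagonal.1 he]
    exact hmul _ _ _ (hu _) _ (hv _)

/-- An Artin-Rees lemma for the filtration of a ring of differential operators along an ideal. -/
theorem ReesRelations.artinRees [IsNoetherianRing A] [Finite ι] [Fintype κ]
    (H : ReesRelations φ y t) (V : ℕ → AddSubgroup D) (hone : 1 ∈ V 0)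
    (hmul : ∀ i j, ∀ p ∈ V i, ∀ q ∈ V j, p * q ∈ V (i + j)) (hanti : Antitone V)
    (hφ : ∀ a, φ a ∈ V 0) (hy : ∀ i, y i ∈ V 0) (ht : ∀ k, φ (t k) ∈ V 1)
    {M : Type*} [AddCommGroup M] [Module D M] {n : ℕ} (g : Fin n → M) (u : M) :
    ∃ d : ℕ, ∀ a : Fin n → D, (∀ k, monomial d (a k) ∈ reesRing φ y t) →
      ∀ P ∈ V 0, ∑ k, a k • g k = P • u → ∃ Q ∈ V 1, ∑ k, a k • g k = Q • u := by
  have hV := fun (r : reesRing φ y t) i => coeff_mem_of_mem_reesRing V hone hmul hφ hy ht r.2 i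
  have : IsNoetherianRing (reesRing φ y t) := H.almostCommuting.isNoetherianRing
  have hadd : ∀ j, ∀ v w : M, (∃ P ∈ V j, v = P • u) → (∃ P ∈ V j, w = P • u) →
      ∃ P ∈ V j, v + w = P • u := by
    rintro j _ _ ⟨P, hP, rfl⟩ ⟨Q, hQ, rfl⟩
    exact ⟨P + Q, add_mem hP hQ, (add_smul _ _ _).symm⟩
  have hexp : ∀ (r : reesRing φ y t) (p : Fin n → reesRing φ y t) (j : ℕ),
      ∑ k, ((r • p) k : D[X]).coeff j • g k = ∑ e ∈ Finset.HasAntidiagonal.antidiagonal j,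
        (r : D[X]).coeff e.1 • ∑ k, (p k : D[X]).coeff e.2 • g k := by
    intro r p j
    simp only [Finset.smul_sum, smul_smul]
    rw [Finset.sum_comm]
    refine Finset.sum_congr rfl fun k _ => ?_
    rw [← Finset.sum_smul]
    congr 1
    exact coeff_mul _ _ _
  -- Vectors of coefficients that, degree by degree, combine the `g k` to an element of `V 0 • u`.
  -- This submodule of a free module of finite rank is finitely generated.
  let N : Submodule (reesRing φ y t) (Fin n → reesRing φ y t) :=
    { carrier := {p | ∀ j, ∃ P ∈ V 0, ∑ k, (p k : D[X]).coeff j • g k = P • u}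
      zero_mem' := fun j => ⟨0, zero_mem _, by simp⟩
      add_mem' := fun {p q} hp hq j => by
        simpa [add_smul, Finset.sum_add_distrib] using hadd 0 _ _ (hp j) (hq j)
      smul_mem' := fun r p hp j => by
        rw [hexp]
        refine Finset.sum_induction _ (fun m => ∃ P ∈ V 0, m = P • u) (hadd 0)
          ⟨0, zero_mem _, (zero_smul _ _).symm⟩ fun e _ => ?_
        obtain ⟨P, hP, h⟩ := hp e.2
        exact ⟨_, hmul 0 0 _ (hanti (Nat.zero_le _) (hV r e.1)) _ hP, by rw [h, smul_smul]⟩ }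
  obtain ⟨S, hS⟩ : N.FG := IsNoetherian.noetherian N
  -- The bound exceeds the degrees of all generators of `N`. In degree `d`, therefore, a multiple `r
  -- • p` of a generator involves only the coefficients of `r` of positive degree, and these lie in
  -- `V 1`.
  refine ⟨1 + S.sup fun p => Finset.univ.sup fun k => (p k : D[X]).natDegree, fun a ha P hP hPu => ?_⟩
  set d := 1 + S.sup fun p => Finset.univ.sup fun k => (p k : D[X]).natDegree with hd
  have hmem : (fun k => (⟨_, ha k⟩ : reesRing φ y t)) ∈ N := fun j => by
    by_cases hj : d = j
    · subst hj
      exact ⟨P, hP, by simpa using hPu⟩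
    · exact ⟨0, zero_mem _, by simp [coeff_monomial, hj]⟩
  obtain ⟨r, -, hr⟩ := Submodule.mem_span_finset.1 (hS ▸ hmem)
  have hterm : ∀ p ∈ S, ∃ Q ∈ V 1, ∑ k, ((r p • p) k : D[X]).coeff d • g k = Q • u := by
    intro p hp
    rw [hexp]
    refine Finset.sum_induction _ (fun m => ∃ Q ∈ V 1, m = Q • u) (hadd 1)
      ⟨0, zero_mem _, (zero_smul _ _).symm⟩ fun e he => ?_
    rcases Nat.eq_zero_or_pos e.1 with h0 | h0
    · refine ⟨0, zero_mem _, ?_⟩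
      have he2 : e.2 = d := by
        have := Finset.HasAntidiagonal.mem_antidiagonal.1 he
        omega
      rw [zero_smul, Finset.sum_eq_zero, smul_zero]
      intro k _
      rw [coeff_eq_zero_of_natDegree_lt, zero_smul]
      have h1 := Finset.le_sup (f := fun k => (p k : D[X]).natDegree) (Finset.mem_univ k)
      have h2 := Finset.le_sup (f := fun p : Fin n → reesRing φ y t =>
        Finset.univ.sup fun k => (p k : D[X]).natDegree) hp
      have := h1.trans h2
      omega
    · have hpN : p ∈ N := hS ▸ Submodule.subset_span hp
      obtain ⟨P, hP, h⟩ := hpN e.2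
      exact ⟨_, hmul 1 0 _ (hanti h0 (hV _ e.1)) _ hP, by rw [h, smul_smul]⟩
  have := Finset.sum_induction _ (fun m => ∃ Q ∈ V 1, m = Q • u) (hadd 1)
      ⟨0, zero_mem _, (zero_smul _ _).symm⟩ hterm
  rw [Finset.sum_comm] at this
  obtain ⟨Q, hQ, h⟩ := this
  refine ⟨Q, hQ, h ▸ Finset.sum_congr rfl fun k _ => ?_⟩
  rw [← Finset.sum_smul, ← finsetSum_coeff]
  congr 1
  have h1 := congrArg (fun p : Fin n → reesRing φ y t => (p k : D[X]).coeff d) hr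
  simp only [coeff_monomial, if_true] at h1
  rw [← h1, Finset.sum_apply, AddSubmonoidClass.coe_finsetSum]

/-- Generators of degree zero over `A` of a ring of differential operators: the derivations `∂_x`
and the products `t_j ∂_{t_k}`. -/
def degZeroGen {ν : Type*} (φ : A →+* D) (t : κ → A) (d : κ ⊕ ν → D) : ν ⊕ (κ × κ) → D :=
  Sum.elim (fun k => d (Sum.inr k)) (fun p => φ (t p.1) * d (Sum.inl p.2))

/-- The operators `t_j ∂_{t_k}` satisfy the relations of the matrix units of `gl_r`: the commutator
of the operators with indices `(j, k)` and `(m, l)` is `δ_{km} t_j ∂_{t_l} - δ_{lj} t_m ∂_{t_k}`.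
They commute with the `∂_x`. -/
lemma reesRelations_degZeroGen {ν : Type*} [Fintype κ] [DecidableEq κ] (d : κ ⊕ ν → D)
    (δ : κ ⊕ ν → A → A)
    (hd : ∀ a c, d a * φ c = φ c * d a + φ (δ a c)) (comm : ∀ a b, Commute (d a) (d b))
    (hl : ∀ j k, δ (Sum.inl j) (t k) = if j = k then 1 else 0)
    (hr : ∀ j k, δ (Sum.inr j) (t k) = 0) :
    ReesRelations φ (degZeroGen φ t d) t := by
  have hφ : ∀ a b w, φ a * (φ b * w) = φ b * (φ a * w) := fun a b w => by
    rw [← mul_assoc, ← map_mul, mul_comm a, map_mul, mul_assoc]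
  have hd' : ∀ a c w, d a * (φ c * w) = φ c * (d a * w) + φ (δ a c) * w := fun a c w => by
    rw [← mul_assoc, hd, add_mul, mul_assoc]
  have hgen : ∀ j, degZeroGen φ t d j ∈ wordFilt φ (degZeroGen φ t d) 2 := fun j => by
    simpa using word_mem_wordFilt (φ := φ) (y := degZeroGen φ t d) 1 (l := [j]) (d := 2) (by simp)
  have key : ∀ k p, degZeroGen φ t d (Sum.inl k) * degZeroGen φ t d (Sum.inr p) =
      degZeroGen φ t d (Sum.inr p) * degZeroGen φ t d (Sum.inl k) := by
    intro k p
    simp only [degZeroGen, Sum.elim_inl, Sum.elim_inr]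
    rw [hd', hr, map_zero, zero_mul, add_zero, (comm _ _).eq, mul_assoc]
  refine ⟨?_, ?_, ?_⟩
  · rintro (k | ⟨j, k⟩) a
    · exact ⟨δ (Sum.inr k) a, by simp only [degZeroGen, Sum.elim_inl, hd, add_sub_cancel_left]⟩
    · refine ⟨t j * δ (Sum.inl k) a, ?_⟩
      simp only [degZeroGen, Sum.elim_inr]
      rw [mul_assoc, hd, mul_add, hφ, add_sub_cancel_left, map_mul]
  · rintro (k | ⟨j, k⟩) (l | ⟨m, l⟩)
    · simp only [degZeroGen, Sum.elim_inl, (comm (Sum.inr k) (Sum.inr l)).eq, sub_self, zero_mem]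
    · rw [key, sub_self]; exact zero_mem _
    · rw [key, sub_self]; exact zero_mem _
    · have h1 : degZeroGen φ t d (Sum.inr (j, k)) * degZeroGen φ t d (Sum.inr (m, l)) -
          degZeroGen φ t d (Sum.inr (m, l)) * degZeroGen φ t d (Sum.inr (j, k)) =
          (if k = m then degZeroGen φ t d (Sum.inr (j, l)) else 0) -
            if l = j then degZeroGen φ t d (Sum.inr (m, k)) else 0 := by
        simp only [degZeroGen, Sum.elim_inr]
        rw [mul_assoc, hd', hl, mul_assoc, hd', hl, (comm (Sum.inl k) (Sum.inl l)).eq,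
          mul_add, mul_add, hφ (t j), add_sub_add_left_eq_sub]
        split_ifs <;> simp
      rw [h1]
      refine sub_mem ?_ ?_ <;> split_ifs
      exacts [hgen _, zero_mem _, hgen _, zero_mem _]
  · rintro (k | ⟨j, k⟩) m
    · refine ⟨0, ?_⟩
      simp [degZeroGen, hd, hr]
    · refine ⟨fun l => if l = j then (if k = m then 1 else 0) else 0, ?_⟩
      simp only [degZeroGen, Sum.elim_inr]
      rw [mul_assoc, hd, mul_add, hφ, add_sub_cancel_left, hl, ← map_mul, mul_comm (t j), map_mul,
        Finset.sum_eq_single j]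
      · rw [if_pos rfl]
      · intro l _ hl
        rw [if_neg hl, map_zero, zero_mul]
      · simp

end ArtinRees

noncomputable section

variable {X Z : Scheme.{0}} {f : X ⟶ Spec (.of ℂ)} {i : Z ⟶ X}

/-! ### Restriction of functions and operators -/

lemma resO_resO {U W W' : X.Opens} (h : W ≤ U) (h' : W' ≤ W) (g : Γ(X, U)) :
    resO h' (resO h g) = resO (h'.trans h) g := by
  simp only [resO, ← CommRingCat.comp_apply, ← Functor.map_comp]
  rfl

@[simp] lemma resO_self {U : X.Opens} (g : Γ(X, U)) : resO le_rfl g = g := by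
  simp [resO]

lemma resO_cst {U W : X.Opens} (h : W ≤ U) (c : ℂ) : resO h (cst f U c) = cst f W c :=
  resO_resO _ _ _

lemma eq_of_locallyOn_resO {U : X.Opens} {g g' : Γ(X, U)}
    (H : LocallyOn U fun _ h => resO h g = resO h g') : g = g' := by
  choose W h hx hW using H
  refine X.sheaf.eq_of_locally_eq' (fun x : U => W x.1 x.2) U (fun x => homOfLE (h x.1 x.2))
    (fun x hxU => TopologicalSpace.Opens.mem_iSup.2 ⟨⟨x, hxU⟩, hx x hxU⟩) g g' fun x => ?_
  exact hW x.1 x.2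

lemma resO_mem_idealOf {U W : X.Opens} (h : W ≤ U) {g : Γ(X, U)} (hg : g ∈ idealOf i U) :
    resO h g ∈ idealOf i W := by
  have hg' : (i.app U).hom g = 0 := hg
  change (i.app W).hom ((X.presheaf.map (homOfLE h).op).hom g) = 0
  have := i.naturality (homOfLE h).op
  rw [← CommRingCat.comp_apply, this, CommRingCat.comp_apply, hg', map_zero]

lemma diffOp_ext {U : X.Opens} {P Q : diffOp f U}
    (H : ∀ (W : X.Opens) (h : W ≤ U) (g : Γ(X, W)), P.1 ⟨W, h⟩ g = Q.1 ⟨W, h⟩ g) : P = Q :=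
  Subtype.ext <| funext fun W => AddMonoidHom.ext fun g => H W.1 W.2 g

lemma mulOp_apply {U W : X.Opens} (h : W ≤ U) (g : Γ(X, U)) (k : Γ(X, W)) :
    (mulOp f g).1 ⟨W, h⟩ k = resO h g * k := rfl

lemma mul_apply {U W : X.Opens} (h : W ≤ U) (P Q : diffOp f U) (k : Γ(X, W)) :
    (P * Q).1 ⟨W, h⟩ k = P.1 ⟨W, h⟩ (Q.1 ⟨W, h⟩ k) := rfl

variable (f) in
/-- Multiplication operators, as a ring homomorphism. -/
def mulOpHom (U : X.Opens) : Γ(X, U) →+* diffOp f U where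
  toFun := mulOp f
  map_one' := diffOp_ext fun W h g => by rw [mulOp_apply, map_one, one_mul]; rfl
  map_mul' a b := diffOp_ext fun W h g => by
    rw [mulOp_apply, mul_apply, mulOp_apply, mulOp_apply, map_mul, mul_assoc]
  map_zero' := diffOp_ext fun W h g => by rw [mulOp_apply, map_zero, zero_mul]; rfl
  map_add' a b := diffOp_ext fun W h g => by
    rw [mulOp_apply, map_add, add_mul]; rfl

lemma mulOp_add {U : X.Opens} (a b : Γ(X, U)) : mulOp f (a + b) = mulOp f a + mulOp f b :=
  map_add (mulOpHom f U) a b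

lemma mulOp_mul {U : X.Opens} (a b : Γ(X, U)) : mulOp f (a * b) = mulOp f a * mulOp f b :=
  map_mul (mulOpHom f U) a b

lemma mulOp_zero {U : X.Opens} : mulOp f (0 : Γ(X, U)) = 0 := map_zero (mulOpHom f U)

lemma mulOp_one {U : X.Opens} : mulOp f (1 : Γ(X, U)) = 1 := map_one (mulOpHom f U)

lemma diffOpRes_mulOp {U W : X.Opens} (h : W ≤ U) (g : Γ(X, U)) :
    diffOpRes f h (mulOp f g) = mulOp f (resO h g) :=
  diffOp_ext fun W' h' k => by
    change resO (h'.trans h) g * k = resO h' (resO h g) * k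
    rw [resO_resO]

lemma diffOpRes_diffOpRes {U W W' : X.Opens} (h : W ≤ U) (h' : W' ≤ W) (P : diffOp f U) :
    diffOpRes f h' (diffOpRes f h P) = diffOpRes f (h'.trans h) P := rfl

lemma Fam.IsVectorField.res {U W : X.Opens} {δ : Fam X U} (hδ : δ.IsVectorField f) (h : W ≤ U) :
    (Fam.res h δ).IsVectorField f :=
  ⟨fun V V' hV hV' g => hδ.natural V V' (hV.trans h) hV' g,
    fun V => hδ.leibniz ⟨V.1, V.2.trans h⟩, fun V => hδ.const ⟨V.1, V.2.trans h⟩⟩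

lemma vfOp_mul_mulOp {U : X.Opens} {δ : Fam X U} (hδ : δ.IsVectorField f) (g : Γ(X, U)) :
    vfOp f δ hδ * mulOp f g = mulOp f g * vfOp f δ hδ + mulOp f (δ ⟨U, le_rfl⟩ g) := by
  refine diffOp_ext fun W h k => ?_
  change δ ⟨W, h⟩ (resO h g * k) = resO h g * δ ⟨W, h⟩ k + resO h (δ ⟨U, le_rfl⟩ g) * k
  rw [hδ.leibniz, hδ.natural U W le_rfl h, mul_comm k]

/-! ### The `V`-filtration of differential operators -/

lemma VD_mul {U : X.Opens} {j k : ℤ} {P Q : diffOp f U} (hP : P ∈ VD f i j U)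
    (hQ : Q ∈ VD f i k U) : P * Q ∈ VD f i (j + k) U := fun W hW l g hg => by
  have := hP W hW _ _ (hQ W hW l g hg)
  rwa [add_assoc, add_comm k] at this

lemma VD_anti {U : X.Opens} {j k : ℤ} (h : j ≤ k) : VD f i k U ≤ VD f i j U :=
  fun _ hP W hW l g hg => Ideal.pow_le_pow_right (by omega) (hP W hW l g hg)

lemma VD_res {U W : X.Opens} (h : W ≤ U) {j : ℤ} {P : diffOp f U} (hP : P ∈ VD f i j U) :
    diffOpRes f h P ∈ VD f i j W := fun W' hW l g hg => hP ⟨W'.1, W'.2.trans h⟩ hW l g hg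

lemma one_mem_VD {U : X.Opens} : (1 : diffOp f U) ∈ VD f i 0 U := (V0D f i U).one_mem

lemma mulOp_mem_VD {U : X.Opens} (g : Γ(X, U)) : mulOp f g ∈ VD f i 0 U := fun W _ l k hk => by
  rw [add_zero]
  exact Ideal.mul_mem_left _ _ hk

lemma mulOp_mem_VD_one {U : X.Opens} {g : Γ(X, U)} (hg : g ∈ idealOf i U) :
    mulOp f g ∈ VD f i 1 U := fun W _ l k hk => by
  have h1 : resO W.2 g * k ∈ idealOf i W.1 ^ (1 + l.toNat) := by
    rw [pow_add, pow_one]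
    exact Ideal.mul_mem_mul (resO_mem_idealOf W.2 hg) hk
  exact Ideal.pow_le_pow_right (by omega) h1

lemma Fam.IsVectorField.apply_mem_pow {U W : X.Opens} {δ : Fam X U} (hδ : δ.IsVectorField f)
    (h : W ≤ U) (I : Ideal Γ(X, W)) (n : ℕ) :
    ∀ g ∈ I ^ (n + 1), δ ⟨W, h⟩ g ∈ I ^ n := by
  induction n with
  | zero => intro g _; simp
  | succ n ih =>
    intro g hg
    rw [pow_succ] at hg
    refine Submodule.mul_induction_on hg (fun a ha b hb => ?_) fun a b ha hb => ?_
    · rw [hδ.leibniz]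
      refine Ideal.add_mem _ (Ideal.mul_mem_right _ _ ha) ?_
      rw [pow_succ']
      exact Ideal.mul_mem_mul hb (ih a ha)
    · rw [map_add]; exact Ideal.add_mem _ ha hb

lemma vfOp_mem_VD {U : X.Opens} {δ : Fam X U} (hδ : δ.IsVectorField f) :
    vfOp f δ hδ ∈ VD f i (-1) U := fun W _ l g hg => by
  rcases le_or_gt l 0 with hl | hl
  · rw [show (l + -1).toNat = 0 by omega]; simp
  · rw [show l.toNat = (l + -1).toNat + 1 by omega] at hg
    exact hδ.apply_mem_pow W.2 _ _ g hg

lemma Coords.t_mem {W : X.Opens} (C : Coords f i W) (hW : IsAffineOpen W) (j : Fin C.r) :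
    C.t j ∈ idealOf i W := by
  rw [C.ideal_eq W le_rfl hW]
  exact Ideal.subset_span ⟨j, by simp⟩

lemma Coords.ideal_eq_span {W : X.Opens} (C : Coords f i W) (hW : IsAffineOpen W) :
    idealOf i W = Ideal.span (Set.range C.t) := by
  simpa using C.ideal_eq W le_rfl hW

/-- Coordinates on a smaller open subset. -/
def Coords.res {W W' : X.Opens} (C : Coords f i W) (h : W' ≤ W) : Coords f i W' where
  r := C.r
  n := C.n
  t j := resO h (C.t j)
  x j := resO h (C.x j)
  dt j := Fam.res h (C.dt j)
  dx j := Fam.res h (C.dx j)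
  dt_vf j := (C.dt_vf j).res h
  dx_vf j := (C.dx_vf j).res h
  dt_t j k := by
    change C.dt j ⟨W', h⟩ _ = _
    rw [← (C.dt_vf j).natural W W' le_rfl h, C.dt_t]
    split_ifs <;> simp
  dt_x j k := by
    change C.dt j ⟨W', h⟩ _ = _
    rw [← (C.dt_vf j).natural W W' le_rfl h, C.dt_x, map_zero]
  dx_t j k := by
    change C.dx j ⟨W', h⟩ _ = _
    rw [← (C.dx_vf j).natural W W' le_rfl h, C.dx_t, map_zero]
  dx_x j k := by
    change C.dx j ⟨W', h⟩ _ = _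
    rw [← (C.dx_vf j).natural W W' le_rfl h, C.dx_x]
    split_ifs <;> simp
  span_vf V hV δ hδ := by
    have := C.span_vf V (hV.trans h) δ hδ
    simp only [resO_resO]
    exact this
  ideal_eq V hV hV' := by
    rw [C.ideal_eq V (hV.trans h) hV']
    simp only [resO_resO]

/-- Multiplication by `t_j` gains one power of the ideal and `∂_{t_j}` loses one. As `W` need not be
affine, membership of `t_j` in the ideal is used on the affine test opens only. -/
lemma Coords.euler_mem_VD {W : X.Opens} (C : Coords f i W) : C.euler ∈ VD f i 0 W := by
  refine sum_mem fun j _ => ?_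
  intro V hV l g hg
  have hV' : (C.res V.2).t j ∈ idealOf i V.1 := (C.res V.2).t_mem hV j
  have h1 : resO V.2 (C.t j) * g ∈ idealOf i V.1 ^ (1 + l.toNat) := by
    rw [pow_add, pow_one]
    exact Ideal.mul_mem_mul hV' hg
  have h2 := vfOp_mem_VD (i := i) (C.dt_vf j) V hV (1 + l.toNat) _ (by
    rw [show (1 + (l.toNat : ℤ)).toNat = 1 + l.toNat by omega]; exact h1)
  exact Ideal.pow_le_pow_right (by omega) h2

lemma mem_VD_of_idealOf_eq_top {U : X.Opens}
    (hU : ∀ W : X.Opens, W ≤ U → IsAffineOpen W → idealOf i W = ⊤) (j : ℤ) (P : diffOp f U) :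
    P ∈ VD f i j U := fun W hW k g _ => by
  rw [hU W.1 W.2 hW, Ideal.top_pow]
  trivial

/-! ### Sections of modules -/

section Modules

variable {M : PresheafOfModules.{0} (diffOpPresheaf f)}

lemma resM_smul {U W : X.Opens} (h : W ≤ U) (P : diffOp f U) (m : Sec M U) :
    resM M h (P • m) = diffOpRes f h P • resM M h m :=
  M.map_smul (homOfLE h).op P m

lemma resM_resM {U W W' : X.Opens} (h : W ≤ U) (h' : W' ≤ W) (m : Sec M U) :
    resM M h' (resM M h m) = resM M (h'.trans h) m :=
  (M.map_comp_apply (homOfLE h).op (homOfLE h').op m).symm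

@[simp] lemma resM_self {U : X.Opens} (m : Sec M U) : resM M le_rfl m = m :=
  ConcreteCategory.congr_hom (M.presheaf.map_id (op U)) m

lemma LocallyOn.mono {U : X.Opens} {P Q : ∀ W : X.Opens, W ≤ U → Prop} (H : LocallyOn U P)
    (hPQ : ∀ W h, P W h → Q W h) : LocallyOn U Q := fun x hx => by
  obtain ⟨W, h, hxW, hW⟩ := H x hx
  exact ⟨W, h, hxW, hPQ W h hW⟩

lemma locallyOn_self {U : X.Opens} {P : ∀ W : X.Opens, W ≤ U → Prop} (H : P U le_rfl) :
    LocallyOn U P := fun _ hx => ⟨U, le_rfl, hx, H⟩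

/-- The sections over `W` whose germ at `x` vanishes. -/
def germKer (M : PresheafOfModules.{0} (diffOpPresheaf f)) (W : X.Opens) (x : X) (hx : x ∈ W) :
    Submodule (diffOp f W) (Sec M W) where
  carrier := {m | ∃ (W' : X.Opens) (h : W' ≤ W), x ∈ W' ∧ resM M h m = 0}
  zero_mem' := ⟨W, le_rfl, hx, map_zero _⟩
  add_mem' := by
    rintro m m' ⟨V, h, hx, hm⟩ ⟨V', h', hx', hm'⟩
    refine ⟨V ⊓ V', inf_le_left.trans h, ⟨hx, hx'⟩, ?_⟩
    rw [map_add, ← resM_resM h inf_le_left, hm, ← resM_resM h' inf_le_right, hm', map_zero,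
      map_zero, add_zero]
  smul_mem' := by
    rintro P m ⟨V, h, hx, hm⟩
    exact ⟨V, h, hx, by rw [resM_smul, hm, smul_zero]⟩

end Modules

end

noncomputable section

variable {X Z : Scheme.{0}} {f : X ⟶ Spec (.of ℂ)} {i : Z ⟶ X}

/-! ### Vector fields -/

lemma Fam.IsVectorField.bracket {U : X.Opens} {δ ε : Fam X U} (hδ : δ.IsVectorField f)
    (hε : ε.IsVectorField f) : (δ * ε - ε * δ).IsVectorField f where
  natural W W' h h' g := by
    change resO h' (δ ⟨W, h⟩ (ε ⟨W, h⟩ g) - ε ⟨W, h⟩ (δ ⟨W, h⟩ g)) = _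
    rw [map_sub, hδ.natural, hε.natural, hε.natural, hδ.natural]
    rfl
  leibniz W g h := by
    change δ W (ε W (g * h)) - ε W (δ W (g * h)) =
      g * (δ W (ε W h) - ε W (δ W h)) + h * (δ W (ε W g) - ε W (δ W g))
    simp only [hδ.leibniz, hε.leibniz, map_add]
    ring
  const W c := by
    change δ W (ε W _) - ε W (δ W _) = 0
    rw [hδ.const, hε.const, map_zero, map_zero, sub_zero]

lemma Fam.IsVectorField.map_one {U : X.Opens} {δ : Fam X U} (hδ : δ.IsVectorField f)
    (W : {W : X.Opens // W ≤ U}) : δ W 1 = 0 := by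
  have := hδ.const W 1
  rwa [_root_.map_one] at this

namespace Coords

variable {W : X.Opens} (C : Coords f i W)

/-- All the coordinates. -/
def z : Fin C.r ⊕ Fin C.n → Γ(X, W) := Sum.elim C.t C.x

/-- All the coordinate vector fields. -/
def dz : Fin C.r ⊕ Fin C.n → Fam X W := Sum.elim C.dt C.dx

lemma dz_vf (a : Fin C.r ⊕ Fin C.n) : (C.dz a).IsVectorField f := by
  rcases a with a | a
  · exact C.dt_vf a
  · exact C.dx_vf a

lemma dz_z (a b : Fin C.r ⊕ Fin C.n) : C.dz a ⟨W, le_rfl⟩ (C.z b) = if a = b then 1 else 0 := by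
  rcases a with a | a <;> rcases b with b | b
  · simpa [z, dz] using C.dt_t a b
  · simpa [z, dz] using C.dt_x a b
  · simpa [z, dz] using C.dx_t a b
  · simpa [z, dz] using C.dx_x a b

lemma span_dz {W' : X.Opens} (h : W' ≤ W) {δ : Fam X W'} (hδ : δ.IsVectorField f) :
    δ = ∑ a, Fam.mulBy (δ ⟨W', le_rfl⟩ (resO h (C.z a))) * Fam.res h (C.dz a) := by
  rw [Fintype.sum_sum_type]
  exact C.span_vf W' h δ hδ

/-- The coordinate vector fields as operators. -/
def dzOp (a : Fin C.r ⊕ Fin C.n) : diffOp f W := vfOp f (C.dz a) (C.dz_vf a)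

/-- The bracket of two coordinate fields is a vector field that kills every coordinate, because the
coordinate fields take constant values on the coordinates. A vector field is determined by these
values. -/
lemma dzOp_commute (a b : Fin C.r ⊕ Fin C.n) : Commute (C.dzOp a) (C.dzOp b) := by
  have h := C.span_dz le_rfl ((C.dz_vf a).bracket (C.dz_vf b))
  have h0 : ∀ c, (C.dz a * C.dz b - C.dz b * C.dz a) ⟨W, le_rfl⟩ (resO le_rfl (C.z c)) = 0 := by
    intro c
    rw [resO_self]
    change C.dz a _ (C.dz b _ _) - C.dz b _ (C.dz a _ _) = 0
    rw [dz_z, dz_z]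
    split_ifs <;> simp [(C.dz_vf _).map_one]
  have hm : (Fam.mulBy (0 : Γ(X, W)) : Fam X W) = 0 :=
    funext fun V => AddMonoidHom.ext fun g => by
      change resO V.2 0 * g = 0
      rw [map_zero, zero_mul]
  simp only [h0, hm, zero_mul, Finset.sum_const_zero] at h
  exact Subtype.ext (sub_eq_zero.1 h)

lemma dzOp_mul_mulOp (a : Fin C.r ⊕ Fin C.n) (g : Γ(X, W)) :
    C.dzOp a * mulOp f g = mulOp f g * C.dzOp a + mulOp f (C.dz a ⟨W, le_rfl⟩ g) :=
  vfOp_mul_mulOp _ _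

lemma dx_mem_pow (hW : IsAffineOpen W) (k : Fin C.n) (d : ℕ) {c : Γ(X, W)}
    (hc : c ∈ idealOf i W ^ d) : C.dz (Sum.inr k) ⟨W, le_rfl⟩ c ∈ idealOf i W ^ d := by
  have hδ := C.dz_vf (Sum.inr k)
  have h1 : ∀ b ∈ idealOf i W, C.dz (Sum.inr k) ⟨W, le_rfl⟩ b ∈ idealOf i W := by
    intro b hb
    rw [C.ideal_eq_span hW] at hb
    refine Submodule.span_induction ?_ ?_ ?_ ?_ hb
    · rintro _ ⟨j, rfl⟩
      have := C.dz_z (Sum.inr k) (Sum.inl j)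
      rw [show C.t j = C.z (Sum.inl j) from rfl, this]
      simp
    · rw [map_zero]; exact zero_mem _
    · intro x y _ _ hx hy
      rw [map_add]; exact add_mem hx hy
    · intro a x hx hx'
      rw [smul_eq_mul, hδ.leibniz]
      refine Ideal.add_mem _ (Ideal.mul_mem_left _ _ hx') (Ideal.mul_mem_right _ _ ?_)
      rw [C.ideal_eq_span hW]
      exact hx
  induction d generalizing c with
  | zero => simp
  | succ d ih =>
    rw [pow_succ] at hc
    refine Submodule.mul_induction_on hc (fun a ha b hb => ?_) fun a b ha hb => ?_
    · rw [hδ.leibniz, pow_succ]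
      refine Ideal.add_mem _ (Ideal.mul_mem_mul ha (h1 b hb)) ?_
      rw [mul_comm b]
      exact Ideal.mul_mem_mul (ih ha) hb
    · rw [map_add]; exact Ideal.add_mem _ ha hb

/-! ### Operators of degree zero -/

/-- The generators `∂_x` and `t_j ∂_{t_k}` of `V^0 𝒟_X` over the functions. -/
def zeroGen : Fin C.n ⊕ (Fin C.r × Fin C.r) → diffOp f W :=
  degZeroGen (mulOpHom f W) C.t C.dzOp

/-- The ring generated by functions and by the operators `∂_x` and `t_j ∂_{t_k}`. -/
def zeroRing : Subring (diffOp f W) := genRing (mulOpHom f W) C.zeroGen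

/-- The number of `t`-derivatives in a word of coordinate vector fields. -/
def tCount {r n : ℕ} (l : List (Fin r ⊕ Fin n)) : ℕ := l.countP Sum.isLeft

lemma mulOp_mem_zeroRing (c : Γ(X, W)) : mulOp f c ∈ C.zeroRing :=
  range_subset_genRing (φ := mulOpHom f W) (y := C.zeroGen) c

lemma mulOp_mul_dx_mem (hW : IsAffineOpen W) (k : Fin C.n) (d : ℕ) (Q : diffOp f W)
    (hQ : ∀ c ∈ idealOf i W ^ d, mulOp f c * Q ∈ C.zeroRing) (c : Γ(X, W))
    (hc : c ∈ idealOf i W ^ d) : mulOp f c * (C.dzOp (Sum.inr k) * Q) ∈ C.zeroRing := by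
  have h1 : C.dzOp (Sum.inr k) ∈ C.zeroRing :=
    gen_mem_genRing (φ := mulOpHom f W) (y := C.zeroGen) (Sum.inl k)
  have h3 := sub_mem (mul_mem h1 (hQ c hc)) (hQ _ (C.dx_mem_pow hW k _ hc))
  rwa [← mul_assoc (C.dzOp (Sum.inr k)), dzOp_mul_mulOp, add_mul, add_sub_cancel_right,
    mul_assoc] at h3

/-- By the Leibniz rule `c t_m ∂_{t_j} Q = t_m ∂_{t_j} (c Q) - t_m ∂_{t_j}(c) Q`. For `c` in the
`d`-th power of the ideal the factor `t_m` restores the power lost by differentiating `c`, so both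
terms fall under the hypothesis on `Q`. -/
lemma mulOp_mul_dt_mem (hW : IsAffineOpen W) (j : Fin C.r) (d : ℕ) (Q : diffOp f W)
    (hQ : ∀ c ∈ idealOf i W ^ d, mulOp f c * Q ∈ C.zeroRing) (c : Γ(X, W))
    (hc : c ∈ idealOf i W ^ (d + 1)) : mulOp f c * (C.dzOp (Sum.inl j) * Q) ∈ C.zeroRing := by
  have key : ∀ m, ∀ c ∈ idealOf i W ^ d,
      mulOp f (c * C.t m) * (C.dzOp (Sum.inl j) * Q) ∈ C.zeroRing := by
    intro m c hc
    have h1 : mulOp f (C.t m) * C.dzOp (Sum.inl j) ∈ C.zeroRing :=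
      gen_mem_genRing (φ := mulOpHom f W) (y := C.zeroGen) (Sum.inr (m, j))
    have h2 : C.t m * C.dz (Sum.inl j) ⟨W, le_rfl⟩ c ∈ idealOf i W ^ d := by
      rcases d with _ | d
      · simp
      · rw [pow_succ']
        exact Ideal.mul_mem_mul (C.t_mem hW m) ((C.dz_vf _).apply_mem_pow le_rfl _ d c hc)
    have h3 := sub_mem (mul_mem h1 (hQ c hc)) (hQ _ h2)
    rwa [mul_assoc, ← mul_assoc (C.dzOp (Sum.inl j)), dzOp_mul_mulOp, add_mul, mul_add,
      ← mul_assoc _ (mulOp f _) Q, ← mulOp_mul, add_sub_cancel_right, mul_assoc,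
      ← mul_assoc, ← mulOp_mul, mul_comm (C.t m)] at h3
  rw [pow_succ] at hc
  refine Submodule.mul_induction_on hc (fun a ha b hb => ?_) fun a b ha hb => ?_
  · rw [C.ideal_eq_span hW] at hb
    refine Submodule.span_induction (p := fun b _ => ∀ a ∈ idealOf i W ^ d,
      mulOp f (a * b) * (C.dzOp (Sum.inl j) * Q) ∈ C.zeroRing) ?_ ?_ ?_ ?_ hb a ha
    · rintro _ ⟨m, rfl⟩ a ha
      exact key m a ha
    · intro a _
      rw [mul_zero, mulOp_zero, zero_mul]
      exact zero_mem _
    · intro x y _ _ hx hy a ha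
      rw [mul_add, mulOp_add, add_mul]
      exact add_mem (hx a ha) (hy a ha)
    · intro b x _ hx a ha
      rw [smul_eq_mul, ← mul_assoc a]
      exact hx (a * b) (Ideal.mul_mem_right _ _ ha)
  · rw [mulOp_add, add_mul]
    exact add_mem ha hb

/-- Each `∂_t` in the word must be compensated by one power of the ideal, each `∂_x` by none. With
`coeff_mem_of_normalForm_mem_VD` this identifies `V^0 𝒟` with `zeroRing` up to denominators. -/
lemma mulOp_mul_word_mem (hW : IsAffineOpen W) (l : List (Fin C.r ⊕ Fin C.n)) :
    ∀ c ∈ idealOf i W ^ tCount l, mulOp f c * (l.map C.dzOp).prod ∈ C.zeroRing := by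
  induction l with
  | nil =>
    intro c _
    rw [List.map_nil, List.prod_nil, mul_one]
    exact C.mulOp_mem_zeroRing c
  | cons a l ih =>
    rw [List.map_cons, List.prod_cons]
    rcases a with j | k
    · have hc : tCount (Sum.inl j :: l) = tCount l + 1 := List.countP_cons_of_pos rfl
      rw [hc]
      exact C.mulOp_mul_dt_mem hW j _ _ ih
    · have hc : tCount (Sum.inr k :: l) = tCount l := List.countP_cons_of_neg (by simp)
      rw [hc]
      exact C.mulOp_mul_dx_mem hW k _ _ ih

lemma zeroRing_le : C.zeroRing ≤ V0D f i W := by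
  refine Subring.closure_le.2 ?_
  rintro _ (⟨c, rfl⟩ | ⟨k | ⟨j, k⟩, rfl⟩)
  · exact mulOp_mem_VD c
  · intro V hV l g hg
    rw [add_zero]
    exact (C.res V.2).dx_mem_pow hV k _ hg
  · intro V hV l g hg
    have h1 := vfOp_mem_VD (i := i) (C.dt_vf k) V hV l g hg
    have h2 := Ideal.mul_mem_mul ((C.res V.2).t_mem hV j) h1
    rw [← pow_succ'] at h2
    exact Ideal.pow_le_pow_right (by omega) h2

lemma reesRelations : ReesRelations (mulOpHom f W) C.zeroGen C.t :=
  reesRelations_degZeroGen C.dzOp (fun a => C.dz a ⟨W, le_rfl⟩) C.dzOp_mul_mulOp C.dzOp_commute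
    C.dt_t C.dx_t

end Coords

end

noncomputable section

variable {X Z : Scheme.{0}} {f : X ⟶ Spec (.of ℂ)} {i : Z ⟶ X}

lemma isUnit_natCast (f : X ⟶ Spec (.of ℂ)) (W : X.Opens) {n : ℕ} (hn : n ≠ 0) :
    IsUnit (n : Γ(X, W)) := by
  rw [← map_natCast (cst f W)]
  exact (IsUnit.mk0 (n : ℂ) (Nat.cast_ne_zero.2 hn)).map _

namespace Coords

variable {W : X.Opens} (C : Coords f i W)

/-! ### Normal forms -/

/-- The operator with given coefficients of the monomials in the coordinate vector fields. -/
def normalForm : MvPolynomial (Fin C.r ⊕ Fin C.n) Γ(X, W) →+ diffOp f W :=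
  ordEval (mulOpHom f W) C.dzOp

lemma normalForm_monomial (e : Fin C.r ⊕ Fin C.n →₀ ℕ) (c : Γ(X, W)) :
    C.normalForm (MvPolynomial.monomial e c) =
      mulOp f c * ((Finsupp.toMultiset e).toList.map C.dzOp).prod :=
  ordEval_monomial _ _

lemma normalForm_C_mul (c : Γ(X, W)) (p : MvPolynomial (Fin C.r ⊕ Fin C.n) Γ(X, W)) :
    C.normalForm (MvPolynomial.C c * p) = mulOp f c * C.normalForm p :=
  ordEval_C_mul _ _

lemma exists_dzOp_mul_normalForm (a : Fin C.r ⊕ Fin C.n)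
    (p : MvPolynomial (Fin C.r ⊕ Fin C.n) Γ(X, W)) :
    ∃ q, C.dzOp a * C.normalForm p = C.normalForm q := by
  induction p using MvPolynomial.induction_on' with
  | monomial e c =>
    refine ⟨MvPolynomial.monomial (Finsupp.single a 1 + e) c +
      MvPolynomial.monomial e (C.dz a ⟨W, le_rfl⟩ c), ?_⟩
    have hperm : (a :: (Finsupp.toMultiset e).toList).Perm
        (Finsupp.toMultiset (Finsupp.single a 1 + e)).toList := by
      rw [← Multiset.coe_eq_coe, ← Multiset.cons_coe, Multiset.coe_toList, Multiset.coe_toList,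
        map_add, Finsupp.toMultiset_single, one_smul, Multiset.singleton_add]
    have h := (hperm.map C.dzOp).prod_eq' (List.pairwise_map.2
      (List.pairwise_of_forall fun a b => C.dzOp_commute a b))
    rw [map_add, normalForm_monomial, normalForm_monomial, normalForm_monomial, ← h,
      List.map_cons, List.prod_cons, ← mul_assoc, dzOp_mul_mulOp, add_mul, mul_assoc]
  | add p q hp hq =>
    obtain ⟨p', hp⟩ := hp
    obtain ⟨q', hq⟩ := hq
    exact ⟨p' + q', by rw [map_add, mul_add, hp, hq, map_add]⟩

/-- Normal forms are stable under left multiplication by functions and, through the expansion in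
coordinate fields, by vector fields; apply this to the normal form `1`. -/
lemma exists_normalForm (P : diffOp f W) (hP : P.1 ∈ Subring.closure (opGens f W)) :
    ∃ p, P = C.normalForm p := by
  suffices ∀ Q ∈ Subring.closure (opGens f W), ∀ p, ∃ q,
      Q * (C.normalForm p).1 = (C.normalForm q).1 by
    obtain ⟨q, hq⟩ := this P.1 hP (MvPolynomial.monomial 0 1)
    refine ⟨q, Subtype.ext ?_⟩
    rw [← hq, normalForm_monomial]
    simp [mulOp_one]
  intro Q hQ
  induction hQ using Subring.closure_induction with
  | mem Q hQ =>
    intro p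
    rcases hQ with ⟨g, rfl⟩ | hδ
    · exact ⟨MvPolynomial.C g * p, by rw [normalForm_C_mul]; rfl⟩
    · choose q hq using fun a => C.exists_dzOp_mul_normalForm a p
      refine ⟨∑ a, MvPolynomial.C (Q ⟨W, le_rfl⟩ (C.z a)) * q a, ?_⟩
      have h1 := C.span_dz le_rfl hδ
      simp only [resO_self] at h1
      have h2 : vfOp f Q hδ = ∑ a, mulOp f (Q ⟨W, le_rfl⟩ (C.z a)) * C.dzOp a := by
        refine Subtype.ext ?_
        rw [AddSubmonoidClass.coe_finsetSum]
        exact h1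
      change (vfOp f Q hδ * C.normalForm p).1 = _
      rw [h2, Finset.sum_mul, map_sum]
      congr 1
      refine Finset.sum_congr rfl fun a _ => ?_
      rw [mul_assoc, hq]
      rw [normalForm_C_mul]
  | zero => exact fun p => ⟨0, by rw [zero_mul, map_zero]; rfl⟩
  | one => exact fun p => ⟨p, one_mul _⟩
  | add u v _ _ hu hv =>
    intro p
    obtain ⟨q, hq⟩ := hu p
    obtain ⟨q', hq'⟩ := hv p
    exact ⟨q + q', by rw [add_mul, hq, hq', map_add]; rfl⟩
  | neg u _ hu =>
    intro p
    obtain ⟨q, hq⟩ := hu p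
    exact ⟨-q, (neg_mul u _).trans (by rw [hq, map_neg]; rfl)⟩
  | mul u v _ _ hu hv =>
    intro p
    obtain ⟨q, hq⟩ := hv p
    obtain ⟨q', hq'⟩ := hu q
    exact ⟨q', by rw [mul_assoc, hq, hq']⟩

/-- Monomials in the coordinates. -/
def zMon (s : Multiset (Fin C.r ⊕ Fin C.n)) : Γ(X, W) := (s.map C.z).prod

/-- The degree in the coordinates `t`. -/
def tDeg {r n : ℕ} (s : Multiset (Fin r ⊕ Fin n)) : ℕ := s.countP (fun a => a.isLeft)

lemma tCount_toList {r n : ℕ} (s : Multiset (Fin r ⊕ Fin n)) : tCount s.toList = tDeg s := by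
  conv_rhs => rw [← Multiset.coe_toList s]
  rw [tDeg, tCount, Multiset.coe_countP]
  simp

lemma zMon_mem (hW : IsAffineOpen W) (s : Multiset (Fin C.r ⊕ Fin C.n)) :
    C.zMon s ∈ idealOf i W ^ tDeg s := by
  induction s using Multiset.induction_on with
  | empty => simp [tDeg]
  | cons a s ih =>
    rw [zMon, Multiset.map_cons, Multiset.prod_cons]
    rcases a with j | k
    · rw [tDeg, Multiset.countP_cons_of_pos _ (by simp), pow_succ']
      exact Ideal.mul_mem_mul (C.t_mem hW j) ih
    · rw [tDeg, Multiset.countP_cons_of_neg _ (by simp)]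
      exact Ideal.mul_mem_left _ _ ih

lemma dz_zMon (a : Fin C.r ⊕ Fin C.n) (s : Multiset (Fin C.r ⊕ Fin C.n)) :
    C.dz a ⟨W, le_rfl⟩ (C.zMon s) = s.count a • C.zMon (s.erase a) := by
  induction s using Multiset.induction_on with
  | empty => simp [zMon, (C.dz_vf a).map_one]
  | cons b s ih =>
    have hcons : ∀ c s, C.zMon (c ::ₘ s) = C.z c * C.zMon s := fun c s => by
      rw [zMon, Multiset.map_cons, Multiset.prod_cons]; rfl
    rw [hcons, (C.dz_vf a).leibniz, dz_z, ih]
    by_cases h : a = b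
    · subst h
      rw [if_pos rfl, Multiset.count_cons_self, Multiset.erase_cons_head, mul_one, add_smul,
        one_smul, mul_smul_comm, ← hcons]
      by_cases ha : a ∈ s
      · rw [Multiset.cons_erase ha]
      · rw [Multiset.count_eq_zero_of_notMem ha, zero_smul, zero_smul]
    · rw [if_neg h, Multiset.count_cons_of_ne h, Multiset.erase_cons_tail _ (Ne.symm h), mul_zero,
        add_zero, mul_smul_comm, hcons]

/-- If `l` is not contained in `s`, the constant is zero and the truncated difference `s - l` is
irrelevant. -/
lemma word_zMon (l : List (Fin C.r ⊕ Fin C.n)) (s : Multiset (Fin C.r ⊕ Fin C.n)) :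
    ∃ c : ℕ, (l.map C.dzOp).prod.1 ⟨W, le_rfl⟩ (C.zMon s) = c • C.zMon (s - l) ∧
      (c ≠ 0 ↔ (l : Multiset _) ≤ s) := by
  induction l with
  | nil => exact ⟨1, by simp, by simp⟩
  | cons a l ih =>
    obtain ⟨c, hc, hc'⟩ := ih
    refine ⟨c * (s - l).count a, ?_, ?_⟩
    · rw [List.map_cons, List.prod_cons, mul_apply, hc, map_nsmul]
      change c • C.dz a ⟨W, le_rfl⟩ _ = _
      rw [dz_zMon, smul_smul, ← Multiset.cons_coe, ← Multiset.sub_singleton,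
        ← tsub_add_eq_tsub_tsub, add_comm, Multiset.singleton_add]
    · rw [mul_ne_zero_iff, hc', ← Multiset.cons_coe, Multiset.le_iff_count, Multiset.le_iff_count,
        Multiset.count_sub]
      constructor
      · rintro ⟨h1, h2⟩ b
        by_cases hb : b = a
        · subst hb
          rw [Multiset.count_cons_self]; omega
        · rw [Multiset.count_cons_of_ne hb]; exact h1 b
      · intro h
        refine ⟨fun b => (Multiset.count_le_count_cons b a l).trans (h b), ?_⟩
        have := h a
        rw [Multiset.count_cons_self] at this
        omega

/-- Apply the operator to the coordinate monomial `z^e`, which lies in the power `tDeg e` of the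
ideal. Terms with exponent not below `e` vanish, terms with `e' < e` are in that power by induction,
and what remains is the coefficient of `e` times a nonzero integer, which is invertible over `ℂ`. -/
lemma coeff_mem_of_normalForm_mem_VD (hW : IsAffineOpen W)
    (p : MvPolynomial (Fin C.r ⊕ Fin C.n) Γ(X, W)) (hp : C.normalForm p ∈ VD f i 0 W)
    (e : Fin C.r ⊕ Fin C.n →₀ ℕ) : p.coeff e ∈ idealOf i W ^ tDeg (Finsupp.toMultiset e) := by
  induction hd : Multiset.card (Finsupp.toMultiset e) using Nat.strong_induction_on
    generalizing e with
  | _ d ih =>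
  by_cases he : e ∈ p.support
  swap
  · rw [MvPolynomial.notMem_support_iff.1 he]; exact zero_mem _
  have h1 := hp ⟨W, le_rfl⟩ hW (tDeg (Finsupp.toMultiset e)) (C.zMon (Finsupp.toMultiset e))
    (by rw [Int.toNat_natCast]; exact C.zMon_mem hW _)
  rw [add_zero, Int.toNat_natCast] at h1
  have h2 : (C.normalForm p).1 ⟨W, le_rfl⟩ (C.zMon (Finsupp.toMultiset e)) =
      ∑ e' ∈ p.support, p.coeff e' * ((Finsupp.toMultiset e').toList.map C.dzOp).prod.1
        ⟨W, le_rfl⟩ (C.zMon (Finsupp.toMultiset e)) := by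
    conv_lhs => rw [p.as_sum, map_sum, AddSubmonoidClass.coe_finsetSum, Finset.sum_apply]
    refine (AddMonoidHom.finsetSum_apply _ _ _).trans ?_
    refine Finset.sum_congr rfl fun e' _ => ?_
    rw [normalForm_monomial]
    refine (mul_apply _ _ _ _).trans ?_
    rw [mulOp_apply, resO_self]
  rw [h2, ← Finset.add_sum_erase _ _ he] at h1
  have h3 : ∀ e' ∈ p.support.erase e, p.coeff e' * ((Finsupp.toMultiset e').toList.map C.dzOp).prod.1
        ⟨W, le_rfl⟩ (C.zMon (Finsupp.toMultiset e)) ∈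
          idealOf i W ^ tDeg (Finsupp.toMultiset e) := by
    intro e' he'
    obtain ⟨c, hc, hc'⟩ := C.word_zMon (Finsupp.toMultiset e').toList (Finsupp.toMultiset e)
    rw [Multiset.coe_toList] at hc hc'
    rw [hc]
    by_cases hle : Finsupp.toMultiset e' ≤ Finsupp.toMultiset e
    · have hlt : Finsupp.toMultiset e' < Finsupp.toMultiset e :=
        lt_of_le_of_ne hle fun h =>
          (Finset.mem_erase.1 he').1 (by simpa using congrArg Multiset.toFinsupp h)
      have h4 := ih _ (hd ▸ Multiset.card_lt_card hlt) e' rfl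
      have h5 := Ideal.mul_mem_mul h4 (C.zMon_mem hW
        (Finsupp.toMultiset e - Finsupp.toMultiset e'))
      rw [← pow_add, tDeg, tDeg, ← Multiset.countP_add, add_tsub_cancel_of_le hle] at h5
      rw [mul_smul_comm]
      exact (idealOf i W ^ _).smul_of_tower_mem c h5
    · rw [not_ne_iff.1 (hc'.not.2 hle), zero_smul, mul_zero]
      exact zero_mem _
  have h6 := (Ideal.add_mem_iff_left _ (sum_mem h3)).1 h1
  obtain ⟨c, hc, hc'⟩ := C.word_zMon (Finsupp.toMultiset e).toList (Finsupp.toMultiset e)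
  rw [Multiset.coe_toList] at hc hc'
  rw [hc, tsub_self, show C.zMon 0 = 1 by simp [zMon], nsmul_eq_mul, mul_one, mul_comm] at h6
  exact (Ideal.unit_mul_mem_iff_mem _ (isUnit_natCast f W (hc'.2 le_rfl))).1 h6

lemma res_word {V : X.Opens} (h : V ≤ W) (l : List (Fin C.r ⊕ Fin C.n)) :
    diffOpRes f h (l.map C.dzOp).prod =
      (l.map (C.res h).dzOp : List (diffOp f V)).prod := by
  rw [map_list_prod, List.map_map]
  refine congrArg List.prod (List.map_congr_left fun a _ => ?_)
  rcases a with a | a <;> rfl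

/-- Locally, an operator of degree zero is a quotient of an element of `zeroRing` by a function. -/
lemma exists_mulOp_mul_eq (hW : IsAffineOpen W) {W' : X.Opens} (hW' : W' ≤ W) {x : X}
    (hx : x ∈ W') {P : diffOp f W'} (hP : P ∈ VD f i 0 W') :
    ∃ (V : X.Opens) (hV : V ≤ W'), x ∈ V ∧ ∃ h : Γ(X, W), IsUnit (resO (hV.trans hW') h) ∧
      ∃ Q ∈ C.zeroRing, mulOp f (resO (hV.trans hW') h) * diffOpRes f hV P =
        diffOpRes f (hV.trans hW') Q := by
  obtain ⟨W₁, hW₁, hxW₁, hP₁⟩ := P.2.2 x hx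
  -- A basic open of `W` on which `P` is a polynomial in functions and vector fields, hence has a
  -- normal form. Over a basic open, denominators are powers of `h`.
  obtain ⟨h, hh, hxh⟩ := hW.exists_basicOpen_le ⟨x, hxW₁⟩ (hW' hx)
  have hD := X.basicOpen_le h
  have hDa : IsAffineOpen (X.basicOpen h) := hW.basicOpen h
  have hu : IsUnit (resO hD h) := RingedSpace.isUnit_res_basicOpen _ h
  obtain ⟨p, hp⟩ := (C.res hD).exists_normalForm (diffOpRes f (hh.trans hW₁) P)
    (res_mem_closure f hh hP₁)
  have hcoeff := (C.res hD).coeff_mem_of_normalForm_mem_VD hDa p (hp ▸ VD_res _ hP)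
  have key : ∃ N : ℕ, ∃ Q ∈ C.zeroRing, mulOp f (resO hD (h ^ N)) * (C.res hD).normalForm p =
      diffOpRes f hD Q := by
    rw [p.as_sum, map_sum]
    refine Finset.sum_induction _ (fun T => ∃ N : ℕ, ∃ Q ∈ C.zeroRing,
      mulOp f (resO hD (h ^ N)) * T = diffOpRes f hD Q) ?_ ?_ ?_
    · rintro S T ⟨N, Q, hQ, hN⟩ ⟨N', Q', hQ', hN'⟩
      refine ⟨N + N', mulOp f (h ^ N') * Q + mulOp f (h ^ N) * Q',
        add_mem (mul_mem (C.mulOp_mem_zeroRing _) hQ) (mul_mem (C.mulOp_mem_zeroRing _) hQ'), ?_⟩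
      rw [map_add, map_mul, map_mul, ← hN, ← hN', diffOpRes_mulOp, diffOpRes_mulOp, ← mul_assoc,
        ← mul_assoc, ← mulOp_mul, ← mulOp_mul, ← map_mul, ← map_mul, ← pow_add, ← pow_add,
        add_comm N', mul_add]
    · exact ⟨0, 0, zero_mem _, by rw [mul_zero, map_zero]⟩
    · intro e _
      have he := hcoeff e
      rw [(C.res hD).ideal_eq_span hDa] at he
      have hmap : Ideal.span (Set.range (C.res hD).t) = (idealOf i W).map (resO hD) := by
        rw [C.ideal_eq_span hW, Ideal.map_span, ← Set.range_comp]; rfl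
      rw [hmap, ← Ideal.map_pow] at he
      let : Algebra Γ(X, W) Γ(X, X.basicOpen h) := (resO hD).toAlgebra
      have : IsLocalization.Away h Γ(X, X.basicOpen h) := hW.isLocalization_basicOpen h
      -- The coefficient lies in the localized power of the ideal, so a power of `h` moves it into
      -- the power of the ideal over `W` itself.
      obtain ⟨⟨⟨c, hc⟩, ⟨_, N, rfl⟩⟩, hcN⟩ :=
        (IsLocalization.mem_map_algebraMap_iff (Submonoid.powers h) Γ(X, X.basicOpen h)).1 he
      refine ⟨N, _, C.mulOp_mul_word_mem hW (Finsupp.toMultiset e).toList c ?_, ?_⟩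
      · exact (tCount_toList _).symm ▸ hc
      · rw [normalForm_monomial, map_mul, diffOpRes_mulOp, ← mul_assoc, ← mulOp_mul,
          mul_comm (resO hD (h ^ N))]
        refine (congrArg (fun c => mulOp f c * _) hcN).trans ?_
        exact congrArg (fun T => mulOp f (resO hD c) * T)
          (C.res_word hD (Finsupp.toMultiset e).toList).symm
  obtain ⟨N, Q, hQ, hN⟩ := key
  exact ⟨X.basicOpen h, hh.trans hW₁, hxh, h ^ N, by rw [map_pow]; exact hu.pow N, Q, hQ,
    hp ▸ hN⟩

end Coords

end

/-! ### Functions adapted to a smooth closed subscheme. -/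

section AdaptedCoordinates

open Module KaehlerDifferential TensorProduct

variable {k A B : Type*} [CommRing k] [CommRing A] [CommRing B] [Algebra k A] [Algebra k B]
  [Algebra A B] [IsScalarTower k A B]

/-- For a smooth closed subscheme of a smooth scheme, the conormal sequence splits. -/
lemma exists_conormal_retraction [Algebra.FormallySmooth k A] [Algebra.FormallySmooth k B]
    (hAB : Function.Surjective (algebraMap A B)) :
    ∃ l : Ω[A⁄k] →ₗ[A] (RingHom.ker (algebraMap A B)).Cotangent,
      ∀ a : RingHom.ker (algebraMap A B), l (D k A a) = Ideal.toCotangent _ a := by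
  obtain ⟨l, hl⟩ := (Algebra.FormallySmooth.iff_split_injection (R := k) hAB).1 inferInstance
  refine ⟨l ∘ₗ TensorProduct.mk A B _ 1, fun a => ?_⟩
  exact congrArg (fun g => g (Ideal.toCotangent _ a)) hl

/-- The values of the coefficients of the differential of a function at a point. -/
noncomputable def diffAt {ι : Type*} (e : Basis ι A Ω[A⁄k]) (m : Ideal A) (a : A) : ι → A ⧸ m :=
  fun j => Ideal.Quotient.mk m (e.repr (D k A a) j)

attribute [local instance] Ideal.Quotient.field in
lemma span_diffAt_eq_top {ι : Type*} [Finite ι] (e : Basis ι A Ω[A⁄k]) (m : Ideal A)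
    [m.IsMaximal] : Submodule.span (A ⧸ m) (Set.range (diffAt e m)) = ⊤ := by
  have := Fintype.ofFinite ι
  classical
  rw [eq_top_iff, ← (Pi.basisFun (A ⧸ m) ι).span_eq, Submodule.span_le]
  rintro _ ⟨j, rfl⟩
  have key : ∀ ω : Ω[A⁄k], (fun j => Ideal.Quotient.mk m (e.repr ω j)) ∈
      Submodule.span (A ⧸ m) (Set.range (diffAt e m)) := by
    intro ω
    have hω : ω ∈ Submodule.span A (Set.range (D k A)) := by
      rw [span_range_derivation]; trivial
    induction hω using Submodule.span_induction with
    | mem ω h => obtain ⟨a, rfl⟩ := h; exact Submodule.subset_span ⟨a, rfl⟩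
    | zero =>
      simp only [map_zero, Finsupp.coe_zero, Pi.zero_apply]
      exact zero_mem (Submodule.span (A ⧸ m) (Set.range (diffAt e m)))
    | add u v _ _ hu hv => simpa using! add_mem hu hv
    | smul c u _ hu => simpa using! Submodule.smul_mem _ (Ideal.Quotient.mk m c) hu
  convert! key (e j)
  rename_i i
  rw [Pi.basisFun_apply, e.repr_self, Pi.single_apply, Finsupp.single_apply]
  split_ifs with h h' h' <;> simp_all

attribute [local instance] Ideal.Quotient.field in
/-- Near a point of a smooth closed subscheme of a smooth scheme, there are functions whose
differentials form a basis and some of which generate the ideal. -/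
theorem exists_adapted_coordinates [IsNoetherianRing A] [Algebra.FormallySmooth k A]
    [Algebra.FormallySmooth k B] (hAB : Function.Surjective (algebraMap A B))
    [Module.Free A Ω[A⁄k]] [Module.Finite A Ω[A⁄k]] (m : Ideal A) [m.IsMaximal]
    (hm : RingHom.ker (algebraMap A B) ≤ m) :
    ∃ (r n : ℕ) (t : Fin r → A) (x : Fin n → A) (e : Basis (Fin r ⊕ Fin n) A Ω[A⁄k]) (h : A),
      h ∉ m ∧ (∀ j, t j ∈ RingHom.ker (algebraMap A B)) ∧
      (∀ c ∈ RingHom.ker (algebraMap A B), h * c ∈ Ideal.span (Set.range t)) ∧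
      e.det (fun a => D k A (Sum.elim t x a)) ∣ h := by
  classical
  set I := RingHom.ker (algebraMap A B) with hI
  have : Nontrivial A := (Ideal.Quotient.mk m).domain_nontrivial
  let e := Module.Free.chooseBasis A Ω[A⁄k]
  -- Choose functions in the ideal whose differentials at `m` form a basis of the span of all
  -- differentials of the ideal there; these become the `t`. Completing them by arbitrary functions
  -- to a basis of the whole cotangent space gives the `x`.
  obtain ⟨b₁, hb₁, -, hb₁s, hb₁i⟩ := exists_linearIndepOn_extension (K := A ⧸ m)
    (v := diffAt e m) (linearIndepOn_empty _ _) (Set.empty_subset (I : Set A))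
  obtain ⟨b₂, -, hb₂, hb₂s, hb₂i⟩ := exists_linearIndepOn_extension (K := A ⧸ m)
    (v := diffAt e m) hb₁i (Set.subset_univ _)
  have hfin : Finite b₂ := hb₂i.finite
  have hfin₁ : Finite b₁ := hb₁i.finite
  have hfin₃ : Finite (b₂ \ b₁ : Set A) := Set.Finite.subset (Set.toFinite b₂) Set.sdiff_subset
  obtain ⟨r, ⟨σ⟩⟩ := Finite.exists_equiv_fin b₁
  obtain ⟨n, ⟨τ⟩⟩ := Finite.exists_equiv_fin (b₂ \ b₁ : Set A)
  let ρ : Fin r ⊕ Fin n ≃ b₂ := (Equiv.sumCongr σ.symm τ.symm).trans (Equiv.Set.sumDiffSubset hb₂)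
  let t : Fin r → A := fun j => σ.symm j
  let x : Fin n → A := fun j => τ.symm j
  have hρ : ∀ a, (ρ a : A) = Sum.elim t x a := by
    rintro (a | a)
    · rfl
    · rfl
  have hli : LinearIndependent (A ⧸ m) fun a => diffAt e m (Sum.elim t x a) := by
    have := LinearIndependent.comp hb₂i ρ ρ.injective
    simpa only [Function.comp_def, hρ] using this
  have hsp : ⊤ ≤ Submodule.span (A ⧸ m) (Set.range fun a => diffAt e m (Sum.elim t x a)) := by
    rw [Set.image_univ] at hb₂s
    have h1 := Submodule.span_le.2 hb₂s
    rw [span_diffAt_eq_top] at h1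
    refine h1.trans (Submodule.span_mono ?_)
    rintro _ ⟨a, ha, rfl⟩
    exact ⟨ρ.symm ⟨a, ha⟩, by simp only [← hρ, Equiv.apply_symm_apply]⟩
  let bas := Basis.mk hli hsp
  let ε := bas.indexEquiv (Pi.basisFun (A ⧸ m) _)
  let e' := e.reindex ε.symm
  have hdet : e'.det (fun a => D k A (Sum.elim t x a)) ∉ m := by
    have h1 : IsUnit ((Pi.basisFun (A ⧸ m) _).reindex ε.symm |>.det
        fun a => diffAt e m (Sum.elim t x a)) :=
      (Basis.is_basis_iff_det _).1 ⟨hli, top_le_iff.1 hsp⟩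
    have h2 : ((Pi.basisFun (A ⧸ m) _).reindex ε.symm).det
        (fun a => diffAt e m (Sum.elim t x a)) =
        Ideal.Quotient.mk m (e'.det (fun a => D k A (Sum.elim t x a))) := by
      rw [Basis.det_apply, Basis.det_apply, RingHom.map_det]
      congr 1
    rw [h2] at h1
    exact fun h => h1.ne_zero (Ideal.Quotient.eq_zero_iff_mem.2 h)
  have ht : ∀ j, t j ∈ I := fun j => hb₁ (σ.symm j).2
  obtain ⟨l, hl⟩ := exists_conormal_retraction (k := k) hAB
  -- Subtract from `c ∈ I` a combination of the `t j` with the same differential at `m`. The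
  -- difference has differential in `m Ω`, so the retraction onto `I / I²` places its class in `m (I
  -- / I²)`; as `I² ≤ m I`, the difference is in `m I`.
  have hle : I ≤ Ideal.span (Set.range t) ⊔ m • I := by
    intro c hc
    have h1 : diffAt e m c ∈ Submodule.span (A ⧸ m) (Set.range fun j => diffAt e m (t j)) := by
      refine Submodule.span_mono ?_ (hb₁s ⟨c, hc, rfl⟩)
      rintro _ ⟨a, ha, rfl⟩
      exact ⟨σ ⟨a, ha⟩, by simp [t]⟩
    obtain ⟨q, hq⟩ := (Submodule.mem_span_range_iff_exists_fun _).1 h1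
    choose q' hq' using fun j => Ideal.Quotient.mk_surjective (q j)
    have hw : c - ∑ j, q' j * t j ∈ I :=
      sub_mem hc (sum_mem fun j _ => Ideal.mul_mem_left _ _ (ht j))
    have h2 : (⟨_, hw⟩ : I) = ⟨c, hc⟩ - ∑ j, q' j • ⟨t j, ht j⟩ := by
      ext; simp
    have h3 : Ideal.toCotangent I ⟨_, hw⟩ = l (D k A c - ∑ j, q' j • D k A (t j)) := by
      rw [h2, map_sub, map_sum, map_sub, map_sum]
      congr 1
      · exact (hl ⟨c, hc⟩).symm
      · refine Finset.sum_congr rfl fun j _ => ?_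
        rw [map_smul, map_smul]
        exact congrArg _ (hl ⟨t j, ht j⟩).symm
    have h4 : Ideal.toCotangent I ⟨_, hw⟩ ∈ m • (⊤ : Submodule A I.Cotangent) := by
      rw [h3, ← e.sum_repr (D k A c - ∑ j, q' j • D k A (t j)), map_sum]
      refine sum_mem fun i _ => ?_
      rw [map_smul]
      refine Submodule.smul_mem_smul ?_ trivial
      rw [← Ideal.Quotient.eq_zero_iff_mem]
      have := congrFun hq i
      simp only [Finset.sum_apply, Pi.smul_apply, smul_eq_mul, ← hq'] at this
      simp only [diffAt] at this
      simp [← this]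
    have h5 : c - ∑ j, q' j * t j ∈ m • I := by
      rw [← Ideal.toCotangent_range, ← Submodule.map_top, ← Submodule.map_smul''] at h4
      obtain ⟨w, hw', hww⟩ := h4
      have h6 := Submodule.mem_map_of_mem (f := I.subtype) hw'
      rw [Submodule.map_smul'', Submodule.map_top, Submodule.range_subtype] at h6
      have h7 := (Ideal.toCotangent_eq I).1 hww.symm
      rw [pow_two] at h7
      simpa using! add_mem (Ideal.mul_mono_left hm h7) h6
    have h8 : ∑ j, q' j * t j ∈ Ideal.span (Set.range t) :=
      sum_mem fun j _ => Ideal.mul_mem_left _ _ (Ideal.subset_span ⟨j, rfl⟩)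
    simpa using Submodule.add_mem_sup h8 h5
  -- Nakayama's lemma, in the form with a multiplier congruent to `1` modulo `m`. Inverting it
  -- together with the determinant gives coordinates near the point.
  obtain ⟨s, hs, hs'⟩ := Submodule.exists_sub_one_mem_and_smul_le_of_fg_of_le_sup
    (IsNoetherian.noetherian I) le_rfl hle
  refine ⟨r, n, t, x, e', s * e'.det (fun a => D k A (Sum.elim t x a)), ?_, ht, ?_,
    Dvd.intro_left _ rfl⟩
  · rw [Ideal.IsPrime.mul_mem_iff_mem_or_mem inferInstance, not_or]
    refine ⟨fun h => ?_, hdet⟩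
    have h1 := sub_mem h hs
    rw [sub_sub_cancel] at h1
    exact (Ideal.ne_top_iff_one m).1 (Ideal.IsPrime.ne_top inferInstance) h1
  · intro c hc
    rw [mul_assoc, mul_comm _ c, ← mul_assoc]
    refine Ideal.mul_mem_right _ _ (hs' ?_)
    exact Submodule.smul_mem_pointwise_smul c s _ hc

end AdaptedCoordinates

noncomputable section

variable {X : Scheme.{0}} {W : X.Opens}

/-! ### Extension of derivations from an affine open to a sheaf -/

lemma eq_zero_of_locallyOn_resO {U : X.Opens} {g : Γ(X, U)}
    (H : LocallyOn U fun _ h => resO h g = 0) : g = 0 :=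
  eq_of_locallyOn_resO (H.mono fun _ _ hW => by rw [hW, map_zero])

/-- On an affine open `W`, every section over a smaller open is locally a fraction. -/
lemma exists_local_fraction (hW : IsAffineOpen W) {W' : X.Opens} (hW' : W' ≤ W) (s : Γ(X, W')) :
    LocallyOn W' fun _ hV => ∃ c a : Γ(X, W), IsUnit (resO (hV.trans hW') c) ∧
      resO (hV.trans hW') c * resO hV s = resO (hV.trans hW') a := by
  intro x hx
  obtain ⟨g, hg, hxg⟩ := hW.exists_basicOpen_le ⟨x, hx⟩ (hW' hx)
  let : Algebra Γ(X, W) Γ(X, X.basicOpen g) := (resO (X.basicOpen_le g)).toAlgebra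
  have : IsLocalization.Away g Γ(X, X.basicOpen g) := hW.isLocalization_basicOpen g
  obtain ⟨⟨a, ⟨c, hc⟩⟩, hac⟩ := IsLocalization.surj (Submonoid.powers g) (resO hg s)
  refine ⟨X.basicOpen g, hg, hxg, c, a, ?_, ?_⟩
  · exact IsLocalization.map_units Γ(X, X.basicOpen g) (⟨c, hc⟩ : Submonoid.powers g)
  · rw [mul_comm]; exact hac

/-- On a small basic open the vanishing of `a` means `c a = 0` with `c` invertible there;
differentiating this equation shows that `δ a` vanishes as well. -/
lemma derivation_resO_eq_zero (hW : IsAffineOpen W) (δ : Derivation ℤ Γ(X, W) Γ(X, W))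
    {V : X.Opens} (hV : V ≤ W) {a : Γ(X, W)} (ha : resO hV a = 0) : resO hV (δ a) = 0 := by
  refine eq_zero_of_locallyOn_resO fun x hx => ?_
  obtain ⟨g, hg, hxg⟩ := hW.exists_basicOpen_le ⟨x, hx⟩ (hV hx)
  refine ⟨X.basicOpen g, hg, hxg, ?_⟩
  have hag : resO (X.basicOpen_le g) a = 0 := by
    rw [← resO_resO hV hg, ha, map_zero]
  let : Algebra Γ(X, W) Γ(X, X.basicOpen g) := (resO (X.basicOpen_le g)).toAlgebra
  have : IsLocalization.Away g Γ(X, X.basicOpen g) := hW.isLocalization_basicOpen g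
  obtain ⟨⟨c, hc⟩, hca⟩ := (IsLocalization.map_eq_zero_iff (Submonoid.powers g)
    Γ(X, X.basicOpen g) a).1 hag
  have hu : IsUnit (resO (X.basicOpen_le g) c) :=
    IsLocalization.map_units Γ(X, X.basicOpen g) (⟨c, hc⟩ : Submonoid.powers g)
  have h1 := congrArg δ hca
  rw [δ.leibniz, map_zero] at h1
  have h2 := congrArg (resO (X.basicOpen_le g)) h1
  rw [map_add, smul_eq_mul, smul_eq_mul, map_mul, map_mul, hag, zero_mul, add_zero,
    map_zero] at h2
  exact (resO_resO hV hg _).trans (hu.mul_right_eq_zero.1 h2)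

/-- `s'` is the derivative of the section `s` with respect to a derivation of the functions on `W`. -/
def IsDerivativeOf (δ : Derivation ℤ Γ(X, W) Γ(X, W)) {W' : X.Opens} (hW' : W' ≤ W)
    (s s' : Γ(X, W')) : Prop :=
  ∀ (V : X.Opens) (hV : V ≤ W') (a b : Γ(X, W)),
    resO (hV.trans hW') b * resO hV s = resO (hV.trans hW') a →
    resO (hV.trans hW') b * resO hV s' + resO (hV.trans hW') (δ b) * resO hV s =
      resO (hV.trans hW') (δ a)

section

variable {δ : Derivation ℤ Γ(X, W) Γ(X, W)} {W' : X.Opens} {hW' : W' ≤ W}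

lemma IsDerivativeOf.res {s s' : Γ(X, W')} (H : IsDerivativeOf δ hW' s s') {V : X.Opens}
    (hV : V ≤ W') : IsDerivativeOf δ (hV.trans hW') (resO hV s) (resO hV s') := by
  intro V' hV' a b h
  rw [resO_resO] at h ⊢
  rw [resO_resO]
  exact H V' (hV'.trans hV) a b h

lemma IsDerivativeOf.eq_of_fraction {s s' s'' : Γ(X, W')} (H : IsDerivativeOf δ hW' s s')
    {c a : Γ(X, W)} (hc : IsUnit (resO hW' c)) (hca : resO hW' c * s = resO hW' a)
    (h : resO hW' c * s'' + resO hW' (δ c) * s = resO hW' (δ a)) : s' = s'' := by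
  have h1 := H W' le_rfl a c (by rwa [resO_self])
  rw [resO_self, resO_self, ← h] at h1
  exact hc.mul_left_cancel (add_right_cancel h1)

/-- One fraction with invertible denominator determines the derivative: for another presentation `b
s = a'` the function `c a' - b a` vanishes on the smaller open, hence so does its derivative, and
the quotient rules agree. -/
lemma isDerivativeOf_of_fraction (hW : IsAffineOpen W) {s s' : Γ(X, W')} {c a : Γ(X, W)}
    (hc : IsUnit (resO hW' c)) (hca : resO hW' c * s = resO hW' a)
    (h : resO hW' c * s' + resO hW' (δ c) * s = resO hW' (δ a)) : IsDerivativeOf δ hW' s s' := by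
  intro V hV a' b hb
  have hcV := hc.map (resO hV)
  rw [resO_resO] at hcV
  have h1 := congrArg (resO hV) hca
  have h2 := congrArg (resO hV) h
  simp only [map_mul, map_add, resO_resO] at h1 h2
  have h3 : resO (hV.trans hW') (c * a' - b * a) = 0 := by
    rw [map_sub, map_mul, map_mul, ← h1, ← hb]; ring
  have h4 := derivation_resO_eq_zero hW δ _ h3
  simp only [map_sub, δ.leibniz, smul_eq_mul, map_add, map_mul] at h4
  refine hcV.mul_left_cancel ?_
  linear_combination resO (hV.trans hW') b * h2 - h4 + resO (hV.trans hW') (δ b) * h1 -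
    resO (hV.trans hW') (δ c) * hb

lemma IsDerivativeOf.unique (hW : IsAffineOpen W) {s s' s'' : Γ(X, W')}
    (H : IsDerivativeOf δ hW' s s') (H' : IsDerivativeOf δ hW' s s'') : s' = s'' := by
  refine eq_of_locallyOn_resO ((exists_local_fraction hW hW' s).mono ?_)
  rintro V hV ⟨c, a, hc, hca⟩
  exact (H.res hV).eq_of_fraction hc hca (H' V hV a c hca)

/-- Locally the quotient rule defines the derivative; uniqueness makes the local derivatives agree
on overlaps, so they glue. -/
lemma exists_isDerivativeOf (hW : IsAffineOpen W) (δ : Derivation ℤ Γ(X, W) Γ(X, W))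
    (hW' : W' ≤ W) (s : Γ(X, W')) : ∃ s', IsDerivativeOf δ hW' s s' := by
  have hloc : LocallyOn W' fun V hV => ∃ s', IsDerivativeOf δ (hV.trans hW') (resO hV s) s' := by
    refine (exists_local_fraction hW hW' s).mono ?_
    rintro V hV ⟨c, a, hc, hca⟩
    obtain ⟨u, hu⟩ := hc
    refine ⟨↑u⁻¹ * (resO (hV.trans hW') (δ a) - resO (hV.trans hW') (δ c) * resO hV s),
      isDerivativeOf_of_fraction hW (hu ▸ u.isUnit) hca ?_⟩
    rw [← mul_assoc, ← hu, Units.mul_inv, one_mul, sub_add_cancel]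
  choose V hV hx t ht using hloc
  obtain ⟨s₀, hs₀, -⟩ := X.sheaf.existsUnique_gluing' (fun x : W' => V x.1 x.2) W'
    (fun x => homOfLE (hV x.1 x.2))
    (fun x hxU => TopologicalSpace.Opens.mem_iSup.2 ⟨⟨x, hxU⟩, hx x hxU⟩)
    (fun x => t x.1 x.2) (fun x y => by
      have h1 := (ht x.1 x.2).res (inf_le_left : V x.1 x.2 ⊓ V y.1 y.2 ≤ _)
      have h2 := (ht y.1 y.2).res (inf_le_right : V x.1 x.2 ⊓ V y.1 y.2 ≤ _)
      rw [resO_resO] at h1 h2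
      exact h1.unique hW h2)
  obtain ⟨s', hs'⟩ : ∃ s' : Γ(X, W'), ∀ x (hx : x ∈ W'), resO (hV x hx) s' = t x hx :=
    ⟨s₀, fun x hx => hs₀ ⟨x, hx⟩⟩
  refine ⟨s', fun U hU a b h => ?_⟩
  refine eq_of_locallyOn_resO fun x hxU => ?_
  have h1 : resO (hV x (hU hxU)) s' = t x (hU hxU) := hs' x (hU hxU)
  refine ⟨U ⊓ V x (hU hxU), inf_le_left, ⟨hxU, hx _ _⟩, ?_⟩
  have h2 := ht x (hU hxU) (U ⊓ V x (hU hxU)) inf_le_right a b (by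
    have := congrArg (resO (inf_le_left : U ⊓ V x (hU hxU) ≤ U)) h
    simpa only [map_mul, resO_resO] using this)
  have h3 : resO (inf_le_right : U ⊓ V x (hU hxU) ≤ _) (t x (hU hxU)) =
      resO (inf_le_left.trans hU) s' := by
    rw [← h1, resO_resO]
  rw [h3] at h2
  simpa only [map_add, map_mul, resO_resO] using h2

lemma isDerivativeOf_resO (hW : IsAffineOpen W) (δ : Derivation ℤ Γ(X, W) Γ(X, W))
    (hW' : W' ≤ W) (a : Γ(X, W)) : IsDerivativeOf δ hW' (resO hW' a) (resO hW' (δ a)) :=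
  isDerivativeOf_of_fraction (c := 1) (a := a) hW (by rw [map_one]; exact isUnit_one)
    (by rw [map_one, one_mul]) (by simp)

lemma IsDerivativeOf.add (hW : IsAffineOpen W) {s s' u u' : Γ(X, W')}
    (hs : IsDerivativeOf δ hW' s s') (hu : IsDerivativeOf δ hW' u u') :
    IsDerivativeOf δ hW' (s + u) (s' + u') := by
  obtain ⟨v, hv⟩ := exists_isDerivativeOf hW δ hW' (s + u)
  convert hv using 1
  symm
  refine eq_of_locallyOn_resO fun x hx => ?_
  obtain ⟨V, hV, hxV, c, a, hc, hca⟩ := exists_local_fraction hW hW' s x hx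
  obtain ⟨V', hV', hxV', c', a', hc', hca'⟩ := exists_local_fraction hW hW' u x hx
  have hl : V ⊓ V' ≤ W' := inf_le_left.trans hV
  refine ⟨V ⊓ V', hl, ⟨hxV, hxV'⟩, ?_⟩
  have h1 := hc.map (resO (inf_le_left : V ⊓ V' ≤ V))
  have h1' := hc'.map (resO (inf_le_right : V ⊓ V' ≤ V'))
  have h2 := congrArg (resO (inf_le_left : V ⊓ V' ≤ V)) hca
  have h2' := congrArg (resO (inf_le_right : V ⊓ V' ≤ V')) hca'
  simp only [map_mul, resO_resO] at h1 h1' h2 h2'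
  have h3 := hs _ hl a c h2
  have h3' := hu _ hl a' c' h2'
  refine (hv.res hl).eq_of_fraction (c := c * c') (a := c' * a + c * a')
    (by rw [map_mul]; exact h1.mul h1') ?_ ?_
  · simp only [map_mul, map_add, ← h2, ← h2']; ring
  · simp only [δ.leibniz, smul_eq_mul, map_mul, map_add, ← h2, ← h2', ← h3, ← h3']; ring

lemma IsDerivativeOf.mul (hW : IsAffineOpen W) {s s' u u' : Γ(X, W')}
    (hs : IsDerivativeOf δ hW' s s') (hu : IsDerivativeOf δ hW' u u') :
    IsDerivativeOf δ hW' (s * u) (s * u' + u * s') := by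
  obtain ⟨v, hv⟩ := exists_isDerivativeOf hW δ hW' (s * u)
  convert hv using 1
  symm
  refine eq_of_locallyOn_resO fun x hx => ?_
  obtain ⟨V, hV, hxV, c, a, hc, hca⟩ := exists_local_fraction hW hW' s x hx
  obtain ⟨V', hV', hxV', c', a', hc', hca'⟩ := exists_local_fraction hW hW' u x hx
  have hl : V ⊓ V' ≤ W' := inf_le_left.trans hV
  refine ⟨V ⊓ V', hl, ⟨hxV, hxV'⟩, ?_⟩
  have h1 := hc.map (resO (inf_le_left : V ⊓ V' ≤ V))
  have h1' := hc'.map (resO (inf_le_right : V ⊓ V' ≤ V'))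
  have h2 := congrArg (resO (inf_le_left : V ⊓ V' ≤ V)) hca
  have h2' := congrArg (resO (inf_le_right : V ⊓ V' ≤ V')) hca'
  simp only [map_mul, resO_resO] at h1 h1' h2 h2'
  have h3 := hs _ hl a c h2
  have h3' := hu _ hl a' c' h2'
  refine (hv.res hl).eq_of_fraction (c := c * c') (a := a * a')
    (by rw [map_mul]; exact h1.mul h1') ?_ ?_
  · simp only [map_mul, ← h2, ← h2']; ring
  · simp only [δ.leibniz, smul_eq_mul, map_mul, map_add, ← h2, ← h2', ← h3, ← h3']; ring

end

/-- The extension of a derivation of the functions on an affine open to the structure sheaf. -/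
def extendDerivation (hW : IsAffineOpen W) (δ : Derivation ℤ Γ(X, W) Γ(X, W)) : Fam X W :=
  fun W' => AddMonoidHom.mk' (fun s => (exists_isDerivativeOf hW δ W'.2 s).choose) fun s u =>
    (exists_isDerivativeOf hW δ W'.2 (s + u)).choose_spec.unique hW
      ((exists_isDerivativeOf hW δ W'.2 s).choose_spec.add hW
        (exists_isDerivativeOf hW δ W'.2 u).choose_spec)

lemma extendDerivation_spec (hW : IsAffineOpen W) (δ : Derivation ℤ Γ(X, W) Γ(X, W))
    {W' : X.Opens} (hW' : W' ≤ W) (s : Γ(X, W')) :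
    IsDerivativeOf δ hW' s (extendDerivation hW δ ⟨W', hW'⟩ s) :=
  (exists_isDerivativeOf hW δ hW' s).choose_spec

lemma extendDerivation_resO (hW : IsAffineOpen W) (δ : Derivation ℤ Γ(X, W) Γ(X, W))
    {W' : X.Opens} (hW' : W' ≤ W) (a : Γ(X, W)) :
    extendDerivation hW δ ⟨W', hW'⟩ (resO hW' a) = resO hW' (δ a) :=
  (extendDerivation_spec hW δ hW' _).unique hW (isDerivativeOf_resO hW δ hW' a)

lemma extendDerivation_isVectorField {f : X ⟶ Spec (.of ℂ)} (hW : IsAffineOpen W)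
    (δ : Derivation ℤ Γ(X, W) Γ(X, W)) (hδ : ∀ c, δ (cst f W c) = 0) :
    (extendDerivation hW δ).IsVectorField f where
  natural V V' h h' g := ((extendDerivation_spec hW δ h g).res h').unique hW
    (extendDerivation_spec hW δ (h'.trans h) _)
  leibniz V g h := (extendDerivation_spec hW δ V.2 (g * h)).unique hW
    ((extendDerivation_spec hW δ V.2 g).mul hW (extendDerivation_spec hW δ V.2 h))
  const V c := by
    have := extendDerivation_resO hW δ V.2 (cst f W c)
    rwa [resO_cst, hδ, map_zero] at this

/-- A vector field on an open subset of an affine open is determined by its values on the functions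
on the affine open. -/
lemma Fam.IsVectorField.ext_of_affine {f : X ⟶ Spec (.of ℂ)} (hW : IsAffineOpen W)
    {W' : X.Opens} (hW' : W' ≤ W) {δ ε : Fam X W'} (hδ : δ.IsVectorField f)
    (hε : ε.IsVectorField f)
    (h : ∀ a : Γ(X, W), δ ⟨W', le_rfl⟩ (resO hW' a) = ε ⟨W', le_rfl⟩ (resO hW' a)) : δ = ε := by
  refine funext fun V => AddMonoidHom.ext fun s => ?_
  refine eq_of_locallyOn_resO ((exists_local_fraction hW (V.2.trans hW') s).mono ?_)
  rintro U hU ⟨c, a, hc, hca⟩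
  have hres : ∀ (ζ : Fam X W'), ζ.IsVectorField f → ∀ b : Γ(X, W),
      ζ ⟨U, hU.trans V.2⟩ (resO (hU.trans (V.2.trans hW')) b) =
        resO (hU.trans V.2) (ζ ⟨W', le_rfl⟩ (resO hW' b)) := by
    intro ζ hζ b
    rw [hζ.natural W' U le_rfl (hU.trans V.2), resO_resO]
  have key : ∀ (ζ : Fam X W'), ζ.IsVectorField f →
      resO (hU.trans (V.2.trans hW')) c * resO hU (ζ V s) =
        resO (hU.trans V.2) (ζ ⟨W', le_rfl⟩ (resO hW' a)) -
          resO hU s * resO (hU.trans V.2) (ζ ⟨W', le_rfl⟩ (resO hW' c)) := by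
    intro ζ hζ
    rw [← hres ζ hζ, ← hres ζ hζ, hζ.natural V.1 U V.2 hU, ← hca, hζ.leibniz]
    ring
  refine hc.mul_left_cancel ?_
  refine (key δ hδ).trans (Eq.trans ?_ (key ε hε).symm)
  rw [h, h]

end

/-! ### Dual derivations after a localization -/

-- Inverting `h` inverts the determinant, so the differentials of the `z a` become a basis of `Ω`
-- over the localization. The derivations are the coordinate functionals of this basis composed with
-- the universal derivation. The target `N` is general in order to cover vector fields on smaller
-- opens.
open KaehlerDifferential in
lemma exists_dual_derivations {k A A' : Type} [CommRing k] [CommRing A] [CommRing A'] [Algebra k A]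
    [Algebra k A'] [Algebra A A'] [IsScalarTower k A A'] {h : A} [IsLocalization.Away h A']
    {ι : Type} [Fintype ι] [DecidableEq ι] (e : Module.Basis ι A Ω[A⁄k]) (z : ι → A)
    (hdet : e.det (fun a => D k A (z a)) ∣ h) :
    ∃ δ : ι → Derivation k A' A',
      (∀ a b, δ a (algebraMap A A' (z b)) = if a = b then 1 else 0) ∧
      ∀ {N : Type} [AddCommGroup N] [Module A' N] [Module k N] [IsScalarTower k A' N]
        (d : Derivation k A' N) (c : A'), d c = ∑ a, δ a c • d (algebraMap A A' (z a)) := by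
  let b₀ : Module.Basis ι A' Ω[A'⁄k] :=
    e.ofIsLocalizedModule A' (Submonoid.powers h) (KaehlerDifferential.map k k A A')
  have hb₀ : b₀.toMatrix (fun a => D k A' (algebraMap A A' (z a))) =
      (algebraMap A A').mapMatrix (e.toMatrix fun a => D k A (z a)) := by
    ext a c
    rw [Module.Basis.toMatrix_apply, RingHom.mapMatrix_apply, Matrix.map_apply,
      Module.Basis.toMatrix_apply, ← map_D k k A A' (z c)]
    exact e.ofIsLocalizedModule_repr_apply A' (Submonoid.powers h)
      (KaehlerDifferential.map k k A A') _ a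
  have hunit : IsUnit (b₀.det fun a => D k A' (algebraMap A A' (z a))) := by
    rw [Module.Basis.det_apply, hb₀, ← RingHom.map_det, ← Module.Basis.det_apply]
    exact isUnit_of_dvd_unit (map_dvd (algebraMap A A') hdet)
      (IsLocalization.Away.algebraMap_isUnit h)
  obtain ⟨hli, hsp⟩ := (Module.Basis.is_basis_iff_det b₀).2 hunit
  let b := Module.Basis.mk hli hsp.ge
  have hb : ∀ a, b a = D k A' (algebraMap A A' (z a)) := fun a => Module.Basis.mk_apply hli hsp.ge a
  refine ⟨fun a => (b.coord a).compDer (D k A'), fun a c => ?_, fun {N} _ _ _ _ d c => ?_⟩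
  · change b.coord a (D k A' _) = _
    rw [← hb, Module.Basis.coord_apply, Module.Basis.repr_self, Finsupp.single_apply]
    simp only [eq_comm]
  · have h1 := congrArg d.liftKaehlerDifferential (b.sum_repr (D k A' c))
    rw [map_sum, Derivation.liftKaehlerDifferential_comp_D] at h1
    rw [← h1]
    refine Finset.sum_congr rfl fun a _ => ?_
    rw [map_smul, hb, Derivation.liftKaehlerDifferential_comp_D]
    rfl

noncomputable section

variable {X Z : Scheme.{0}} {f : X ⟶ Spec (.of ℂ)} {i : Z ⟶ X}

/-! ### Existence of local coordinates -/

lemma Fam.IsVectorField.zero {U : X.Opens} : (0 : Fam X U).IsVectorField f where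
  natural _ _ _ h' _ := map_zero (resO h')
  leibniz _ g h := by
    change (0 : Γ(X, _)) = g * 0 + h * 0
    rw [mul_zero, mul_zero, add_zero]
  const _ _ := rfl

lemma Fam.IsVectorField.add {U : X.Opens} {δ ε : Fam X U} (hδ : δ.IsVectorField f)
    (hε : ε.IsVectorField f) : (δ + ε).IsVectorField f where
  natural V V' h h' g := (map_add (resO h') _ _).trans
    (congrArg₂ (· + ·) (hδ.natural V V' h h' g) (hε.natural V V' h h' g))
  leibniz V g h := by
    change δ V (g * h) + ε V (g * h) = g * (δ V h + ε V h) + h * (δ V g + ε V g)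
    rw [hδ.leibniz, hε.leibniz]; ring
  const V c := by
    change δ V _ + ε V _ = 0
    rw [hδ.const, hε.const, add_zero]

lemma Fam.IsVectorField.mulBy {U : X.Opens} {δ : Fam X U} (hδ : δ.IsVectorField f)
    (a : Γ(X, U)) : (Fam.mulBy a * δ).IsVectorField f where
  natural V V' h h' g := by
    change resO h' (resO h a * δ ⟨V, h⟩ g) = resO (h'.trans h) a * δ ⟨V', h'.trans h⟩ (resO h' g)
    rw [map_mul, resO_resO, hδ.natural]
  leibniz V g h := by
    change resO V.2 a * δ V (g * h) = g * (resO V.2 a * δ V h) + h * (resO V.2 a * δ V g)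
    rw [hδ.leibniz]; ring
  const V c := by
    change resO V.2 a * δ V _ = 0
    rw [hδ.const, mul_zero]

lemma Fam.IsVectorField.sum {U : X.Opens} {ι : Type} (s : Finset ι) {δ : ι → Fam X U}
    (hδ : ∀ a, (δ a).IsVectorField f) : (∑ a ∈ s, δ a).IsVectorField f :=
  Finset.sum_induction _ (fun ε => Fam.IsVectorField f ε) (fun _ _ => .add) .zero fun a _ => hδ a

lemma cst_eq_appLE (f : X ⟶ Spec (.of ℂ)) (W : X.Opens) :
    cst f W = (f.appLE ⊤ W le_top).hom.comp (Scheme.ΓSpecIso (.of ℂ)).inv.hom := by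
  rfl

lemma smooth_cst (f : X ⟶ Spec (.of ℂ)) [Smooth f] {W : X.Opens} (hW : IsAffineOpen W) :
    (cst f W).Smooth := by
  rw [cst_eq_appLE]
  exact RingHom.Smooth.respectsIso.2 _ (Scheme.ΓSpecIso (.of ℂ)).symm.commRingCatIsoToRingEquiv
    (f.smooth_appLE (isAffineOpen_top _) hW le_top)

/-- The base has a single point, so the open subset of it occurring in local standard smoothness is
the whole base. Standard smoothness supplies the freeness of `Ω` used for adapted coordinates. -/
lemma exists_isStandardSmooth_cst (f : X ⟶ Spec (.of ℂ)) [Smooth f] (x : X) :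
    ∃ W : X.Opens, IsAffineOpen W ∧ x ∈ W ∧ (cst f W).IsStandardSmooth := by
  obtain ⟨U, hU, W, hW, hx, e, h⟩ := Smooth.exists_isStandardSmooth f x
  have hU' : U = ⊤ := by
    refine top_le_iff.1 fun y _ => ?_
    have : Subsingleton (PrimeSpectrum ℂ) := inferInstance
    have hy : y = f x := Subsingleton.elim (α := PrimeSpectrum ℂ) _ _
    rw [hy]
    exact e hx
  subst hU'
  refine ⟨W, hW, hx, ?_⟩
  rw [cst_eq_appLE]
  exact RingHom.isStandardSmooth_respectsIso.2 _
    (Scheme.ΓSpecIso (.of ℂ)).symm.commRingCatIsoToRingEquiv h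

lemma app_comp_cst (f : X ⟶ Spec (.of ℂ)) (i : Z ⟶ X) (W : X.Opens) :
    (i.app W).hom.comp (cst f W) = cst (i ≫ f) (i ⁻¹ᵁ W) := by
  rw [cst_eq_appLE, cst_eq_appLE, ← RingHom.comp_assoc, ← CommRingCat.hom_comp]
  congr 2
  rw [Scheme.Hom.app_eq_appLE]
  exact Scheme.Hom.appLE_comp_appLE i f ⊤ W (i ⁻¹ᵁ W) le_top le_rfl

lemma idealOf_eq_map [IsClosedImmersion i] {W W' : X.Opens} (hW : IsAffineOpen W)
    (hW' : IsAffineOpen W') (h : W' ≤ W) : idealOf i W' = (idealOf i W).map (resO h) := by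
  have := i.ker.map_ideal (U := ⟨W', hW'⟩) (V := ⟨W, hW⟩) h
  rw [Scheme.Hom.ker_apply, Scheme.Hom.ker_apply] at this
  exact this.symm

lemma isNoetherianRing_of_isAffineOpen (f : X ⟶ Spec (.of ℂ)) [Smooth f] {W : X.Opens}
    (hW : IsAffineOpen W) : IsNoetherianRing Γ(X, W) := by
  have := LocallyOfFiniteType.isLocallyNoetherian f
  exact IsLocallyNoetherian.component_noetherian ⟨W, hW⟩

/-- Local coordinates from derivations dual to functions on an affine open. -/
lemma nonempty_coords_of_dual {W : X.Opens} (hW : IsAffineOpen W) {r n : ℕ}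
    (t : Fin r → Γ(X, W)) (x : Fin n → Γ(X, W))
    (δ : Fin r ⊕ Fin n → Derivation ℤ Γ(X, W) Γ(X, W)) (hδ : ∀ a c, δ a (cst f W c) = 0)
    (hdual : ∀ a b, δ a (Sum.elim t x b) = if a = b then 1 else 0)
    (hspan : ∀ (W' : X.Opens) (h : W' ≤ W) (ε : Fam X W'), ε.IsVectorField f → ∀ c : Γ(X, W),
      ε ⟨W', le_rfl⟩ (resO h c) =
        ∑ a, resO h (δ a c) * ε ⟨W', le_rfl⟩ (resO h (Sum.elim t x a)))
    (hideal : ∀ (W' : X.Opens) (h : W' ≤ W), IsAffineOpen W' →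
      idealOf i W' = Ideal.span (Set.range fun j => resO h (t j))) :
    Nonempty (Coords f i W) := by
  have hvf : ∀ a, (extendDerivation hW (δ a)).IsVectorField f := fun a =>
    extendDerivation_isVectorField hW (δ a) (hδ a)
  have heval : ∀ a c, extendDerivation hW (δ a) ⟨W, le_rfl⟩ c = δ a c := fun a c => by
    have := extendDerivation_resO hW (δ a) le_rfl c
    rwa [resO_self, resO_self] at this
  refine ⟨{ r := r, n := n, t := t, x := x
            dt := fun j => extendDerivation hW (δ (Sum.inl j))
            dx := fun j => extendDerivation hW (δ (Sum.inr j))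
            dt_vf := fun j => hvf _
            dx_vf := fun j => hvf _
            dt_t := fun j k => (heval _ _).trans ((hdual (.inl j) (.inl k)).trans (by simp))
            dt_x := fun j k => (heval _ _).trans ((hdual (.inl j) (.inr k)).trans (by simp))
            dx_t := fun j k => (heval _ _).trans ((hdual (.inr j) (.inl k)).trans (by simp))
            dx_x := fun j k => (heval _ _).trans ((hdual (.inr j) (.inr k)).trans (by simp))
            span_vf := fun W' h ε hε => ?_
            ideal_eq := hideal }⟩
  have hres : ∀ a, (Fam.res h (extendDerivation hW (δ a))).IsVectorField f := fun a => (hvf a).res h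
  have key : ε = ∑ a, Fam.mulBy (ε ⟨W', le_rfl⟩ (resO h (Sum.elim t x a))) *
      Fam.res h (extendDerivation hW (δ a)) := by
    refine hε.ext_of_affine hW h (Fam.IsVectorField.sum _ fun a => (hres a).mulBy _) fun c => ?_
    rw [hspan W' h ε hε c, Finset.sum_apply]
    refine Eq.trans ?_ (AddMonoidHom.finsetSum_apply _ _ _).symm
    refine Finset.sum_congr rfl fun a _ => ?_
    change _ = resO le_rfl (ε ⟨W', le_rfl⟩ (resO h (Sum.elim t x a))) *
      extendDerivation hW (δ a) ⟨W', h⟩ (resO h c)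
    rw [resO_self, extendDerivation_resO, mul_comm]
  rw [Fintype.sum_sum_type] at key
  exact key

/-- Around every point of `Z` there are local coordinates. -/
lemma exists_coords (f : X ⟶ Spec (.of ℂ)) [Smooth f] (i : Z ⟶ X) [IsClosedImmersion i]
    [Smooth (i ≫ f)] (z : Z) :
    ∃ W : X.Opens, IsAffineOpen W ∧ i z ∈ W ∧ Nonempty (Coords f i W) := by
  obtain ⟨W, hW, hx, hstd⟩ := exists_isStandardSmooth_cst f (i z)
  let : Algebra ℂ Γ(X, W) := (cst f W).toAlgebra
  let : Algebra Γ(X, W) Γ(Z, i ⁻¹ᵁ W) := (i.app W).hom.toAlgebra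
  let : Algebra ℂ Γ(Z, i ⁻¹ᵁ W) := ((i.app W).hom.comp (cst f W)).toAlgebra
  have : IsScalarTower ℂ Γ(X, W) Γ(Z, i ⁻¹ᵁ W) := .of_algebraMap_eq fun _ => rfl
  have : Algebra.IsStandardSmooth ℂ Γ(X, W) := hstd
  have : Algebra.Smooth ℂ Γ(Z, i ⁻¹ᵁ W) := by
    have := smooth_cst (i ≫ f) (hW.preimage i)
    rw [← app_comp_cst] at this
    exact this
  have := isNoetherianRing_of_isAffineOpen f hW
  let P : Ideal Γ(X, W) :=
    (IsLocalRing.maximalIdeal (X.presheaf.stalk (i z))).comap (X.presheaf.germ W (i z) hx).hom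
  have hP : P.IsPrime := Ideal.comap_isPrime _ _
  have hPmem : ∀ c, c ∉ P → i z ∈ X.basicOpen c := fun c hc => by
    rw [X.mem_basicOpen c (i z) hx]
    exact not_not.1 hc
  -- The point need not be closed. Working at a maximal ideal above its prime suffices, since `h ∉
  -- m` implies `h ∉ P`.
  obtain ⟨m, hm, hPm⟩ := Ideal.exists_le_maximal P hP.ne_top
  have hker : RingHom.ker (algebraMap Γ(X, W) Γ(Z, i ⁻¹ᵁ W)) ≤ P := by
    intro c hc
    by_contra hcP
    have h1 : z ∈ i ⁻¹ᵁ X.basicOpen c := hPmem c hcP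
    have h2 : (i.app W).hom c = 0 := hc
    rw [Scheme.preimage_basicOpen, h2, Scheme.basicOpen_zero] at h1
    exact h1
  obtain ⟨r, n, t, x, e, h, hh, ht, hth, hdet⟩ := exists_adapted_coordinates (k := ℂ)
    (A := Γ(X, W)) (B := Γ(Z, i ⁻¹ᵁ W)) (i.app_surjective W hW) m (hker.trans hPm)
  have hW' : IsAffineOpen (X.basicOpen h) := hW.basicOpen h
  have hle : X.basicOpen h ≤ W := X.basicOpen_le h
  let : Algebra Γ(X, W) Γ(X, X.basicOpen h) := (resO hle).toAlgebra
  let : Algebra ℂ Γ(X, X.basicOpen h) := (cst f (X.basicOpen h)).toAlgebra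
  have : IsScalarTower ℂ Γ(X, W) Γ(X, X.basicOpen h) :=
    .of_algebraMap_eq fun c => (resO_cst hle c).symm
  have : IsLocalization.Away h Γ(X, X.basicOpen h) := hW.isLocalization_basicOpen h
  obtain ⟨δ, hδ, hspan⟩ := exists_dual_derivations (A' := Γ(X, X.basicOpen h)) e (Sum.elim t x) hdet
  have hunit : IsUnit (resO hle h) := IsLocalization.Away.algebraMap_isUnit h
  have helim : ∀ a, Sum.elim (fun j => resO hle (t j)) (fun j => resO hle (x j)) a =
      resO hle (Sum.elim t x a) := by
    rintro (a | a) <;> rfl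
  refine ⟨_, hW', hPmem h fun hc => hh (hPm hc), nonempty_coords_of_dual hW'
    (fun j => resO hle (t j)) (fun j => resO hle (x j)) (fun a => (δ a).restrictScalars ℤ)
    (fun a c => (δ a).map_algebraMap c) (fun a b => ?_) (fun W'' h'' ε hε c => ?_)
    (fun W'' h'' hW'' => ?_)⟩
  · rw [helim]
    exact hδ a b
  · let : Algebra Γ(X, X.basicOpen h) Γ(X, W'') := (resO h'').toAlgebra
    let : Algebra ℂ Γ(X, W'') := (cst f W'').toAlgebra
    have : IsScalarTower ℂ Γ(X, X.basicOpen h) Γ(X, W'') :=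
      .of_algebraMap_eq fun c => (resO_cst h'' c).symm
    let d : Derivation ℂ Γ(X, X.basicOpen h) Γ(X, W'') := Derivation.mk'
      { toFun := fun c => ε ⟨W'', le_rfl⟩ (resO h'' c)
        map_add' := fun a b => by rw [map_add, map_add]
        map_smul' := fun a b => by
          rw [Algebra.smul_def, map_mul, hε.leibniz]
          change _ + _ * ε ⟨W'', le_rfl⟩ (resO h'' (cst f _ a)) = _
          rw [resO_cst, hε.const, mul_zero, add_zero, RingHom.id_apply, Algebra.smul_def]
          congr 1
          exact resO_cst h'' a }
      (fun a b => by
        change ε ⟨W'', le_rfl⟩ (resO h'' (a * b)) = resO h'' a * ε ⟨W'', le_rfl⟩ (resO h'' b) +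
          resO h'' b * ε ⟨W'', le_rfl⟩ (resO h'' a)
        rw [map_mul, hε.leibniz])
    refine (hspan d c).trans (Finset.sum_congr rfl fun a _ => ?_)
    rw [helim]
    rfl
  · rw [idealOf_eq_map hW hW'' (h''.trans hle)]
    refine le_antisymm (Ideal.map_le_iff_le_comap.2 fun c hc => ?_) (Ideal.span_le.2 ?_)
    · have h1 := Ideal.mem_map_of_mem (resO (h''.trans hle)) (hth c hc)
      rw [Ideal.map_span, map_mul, ← Set.range_comp, ← resO_resO hle h'' h] at h1
      have h2 := (Ideal.unit_mul_mem_iff_mem _ (hunit.map (resO h''))).1 h1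
      simpa only [Ideal.mem_comap, Function.comp_def, resO_resO] using h2
    · rintro _ ⟨j, rfl⟩
      beta_reduce
      rw [resO_resO]
      exact Ideal.mem_map_of_mem _ (ht j)

end

noncomputable section

variable {X Z : Scheme.{0}} {f : X ⟶ Spec (.of ℂ)} {i : Z ⟶ X}
  {M : PresheafOfModules.{0} (diffOpPresheaf f)} {V : ℝ → ∀ U : X.Opens, AddSubgroup (Sec M U)}

/-! ### Finitely many neighbourhoods, finitely many denominators, compactness -/

lemma exists_common_nhd {ι : Type} [Finite ι] {U : X.Opens} {x : X} (hx : x ∈ U) {W : ι → X.Opens}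
    (hW : ∀ k, x ∈ W k) : ∃ V ≤ U, x ∈ V ∧ ∀ k, V ≤ W k := by
  have := Fintype.ofFinite ι
  refine ⟨U ⊓ Finset.univ.inf W, inf_le_left, ⟨hx, ?_⟩, fun k =>
    inf_le_right.trans (Finset.inf_le (Finset.mem_univ k))⟩
  refine (Finset.inf_induction (p := fun V : X.Opens => x ∈ V) trivial (fun _ h _ h' => ⟨h, h'⟩)
    fun k _ => hW k)

lemma exists_common_multiple {ι R : Type} [Finite ι] [CommRing R] (h : ι → R) :
    ∃ (d : R) (c : ι → R), (∀ k, d = c k * h k) ∧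
      ∀ {S : Type} [CommRing S] (φ : R →+* S), (∀ k, IsUnit (φ (h k))) → IsUnit (φ d) := by
  classical
  have := Fintype.ofFinite ι
  refine ⟨∏ k, h k, fun k => ∏ l ∈ Finset.univ.erase k, h l, fun k =>
    (Finset.prod_erase_mul _ _ (Finset.mem_univ k)).symm, fun φ hφ => ?_⟩
  rw [map_prod]
  exact IsUnit.prod_univ_iff.2 hφ

/-- Finitely many neighbourhoods cover `U`, and the supremum of their indices serves everywhere. For
decreasing conditions such as membership in `V^α` it is applied with the order dual. -/
lemma exists_forall_locallyOn {κ : Type} [SemilatticeSup κ] [Nonempty κ] {U : X.Opens}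
    (hU : IsCompact (U : Set X)) {P : κ → ∀ W : X.Opens, W ≤ U → Prop}
    (hP : ∀ β γ, β ≤ γ → ∀ W h, P β W h → P γ W h)
    (H : LocallyOn U fun W h => ∃ β, P β W h) : ∃ β, LocallyOn U (P β) := by
  obtain ⟨β, hβ⟩ := hU.induction_on
    (p := fun s => ∃ β, ∀ x ∈ s, ∃ (W : X.Opens) (h : W ≤ U), x ∈ W ∧ P β W h)
    ⟨Classical.arbitrary κ, by simp⟩ (fun s t hst ⟨β, hβ⟩ => ⟨β, fun x hx => hβ x (hst hx)⟩)
    (fun s t ⟨β, hβ⟩ ⟨γ, hγ⟩ => ⟨β ⊔ γ, fun x hx => by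
      rcases hx with hx | hx
      · obtain ⟨W, h, hxW, hW⟩ := hβ x hx
        exact ⟨W, h, hxW, hP _ _ le_sup_left _ _ hW⟩
      · obtain ⟨W, h, hxW, hW⟩ := hγ x hx
        exact ⟨W, h, hxW, hP _ _ le_sup_right _ _ hW⟩⟩)
    (fun x hx => by
      obtain ⟨W, h, hxW, β, hW⟩ := H x hx
      exact ⟨W, mem_nhdsWithin_of_mem_nhds (W.2.mem_nhds hxW), β, fun y hy => ⟨W, h, hy, hW⟩⟩)
  exact ⟨β, hβ⟩

lemma isCompact_opens (f : X ⟶ Spec (.of ℂ)) [Smooth f] [QuasiCompact f] (U : X.Opens) :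
    IsCompact (U : Set X) := by
  have := LocallyOfFiniteType.isLocallyNoetherian f
  have : CompactSpace X := QuasiCompact.compactSpace_of_compactSpace f
  have : IsNoetherian X := {}
  exact TopologicalSpace.NoetherianSpace.isCompact _

/-! ### An Artin–Rees lemma for germs -/

lemma C_mem_reesRing {A D ι κ : Type} [CommRing A] [Ring D] {φ : A →+* D} {y : ι → D} {t : κ → A}
    {w : D} (hw : w ∈ genRing φ y) : Polynomial.C w ∈ reesRing φ y t := by
  have h : genRing φ y ≤ (reesRing φ y t).comap Polynomial.C := by
    refine Subring.closure_le.2 ?_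
    rintro _ (⟨a, rfl⟩ | ⟨k, rfl⟩)
    · exact range_subset_genRing (φ := Polynomial.C.comp φ) (y := reesGen φ y t) a
    · exact gen_mem_genRing (φ := Polynomial.C.comp φ) (y := reesGen φ y t) (Sum.inl k)
  exact h hw

lemma mulOp_smul_mulOp_smul {W : X.Opens} (a b : Γ(X, W)) (m : Sec M W) :
    mulOp f a • mulOp f b • m = mulOp f (a * b) • m := by
  rw [smul_smul, mulOp_mul]

lemma mulOp_smul_mulOp_smul_eq_sum {W W' : X.Opens} (hW' : W' ≤ W) {e c h t : Γ(X, W)}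
    (hec : e = c * h) {v : Sec M W'} {n : ℕ} {a : Fin n → diffOp f W} {g : Fin n → Sec M W'}
    (hv : mulOp f (resO hW' h) • v = ∑ k, diffOpRes f hW' (a k) • g k) :
    mulOp f (resO hW' e) • mulOp f (resO hW' t) • v =
      ∑ k, diffOpRes f hW' (mulOp f t * (mulOp f c * a k)) • g k := by
  have h1 : ∀ k, diffOpRes f hW' (mulOp f t * (mulOp f c * a k)) • g k =
      mulOp f (resO hW' (t * c)) • diffOpRes f hW' (a k) • g k := fun k => by
    rw [smul_smul, ← mul_assoc, ← mulOp_mul, map_mul, diffOpRes_mulOp]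
  rw [Finset.sum_congr rfl fun k _ => h1 k, ← Finset.smul_sum, ← hv, mulOp_smul_mulOp_smul,
    mulOp_smul_mulOp_smul, ← map_mul, ← map_mul, hec]
  congr 3
  ring

section Germ

variable {W : X.Opens} (C : Coords f i W) {n : ℕ} {g : Fin n → Sec M W} {α₀ : ℝ}

/-- If `w` is a section of `V^{α₀ + d}`, then after multiplication with a unit it is a combination
of generators of `V^{α₀}` with coefficients of degree `d` in the Rees ring. -/
lemma exists_reesRing_combination (hW : IsAffineOpen W)
    (hsum : ∀ α ≥ α₀, ∀ (W : X.Opens) (C : Coords f i W) (m : Sec M W),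
      m ∈ V (α + 1) W → LocallyOn W fun W' h => ∃ v : Fin C.r → Sec M W', (∀ j, v j ∈ V α W') ∧
        resM M h m = ∑ j, mulOp f (resO h (C.t j)) • v j)
    (hgen : ∀ (W' : X.Opens) (h : W' ≤ W), ∀ m ∈ V α₀ W', LocallyOn W' fun W'' h' =>
      ∃ a : Fin n → diffOp f W'', (∀ k, a k ∈ V0D f i W'') ∧
        resM M h' m = ∑ k, a k • resM M (h'.trans h) (g k))
    (d : ℕ) : ∀ (W₁ : X.Opens) (hW₁ : W₁ ≤ W), ∀ w ∈ V (α₀ + d) W₁, LocallyOn W₁ fun _ h₂ =>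
      ∃ h : Γ(X, W), IsUnit (resO (h₂.trans hW₁) h) ∧ ∃ a : Fin n → diffOp f W,
        (∀ k, Polynomial.monomial d (a k) ∈ reesRing (mulOpHom f W) C.zeroGen C.t) ∧
        mulOp f (resO (h₂.trans hW₁) h) • resM M h₂ w =
          ∑ k, diffOpRes f (h₂.trans hW₁) (a k) • resM M (h₂.trans hW₁) (g k) := by
  induction d with
  | zero =>
    intro W₁ hW₁ w hw x hx
    rw [Nat.cast_zero, add_zero] at hw
    obtain ⟨W₂, h₂, hx₂, a, ha, hwa⟩ := hgen W₁ hW₁ w hw x hx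
    choose T hT hxT h hu Q hQ heq using fun k =>
      C.exists_mulOp_mul_eq hW (h₂.trans hW₁) hx₂ (ha k)
    obtain ⟨W₃, h₃, hx₃, hle⟩ := exists_common_nhd hx₂ hxT
    obtain ⟨e, c, hec, he⟩ := exists_common_multiple h
    refine ⟨W₃, h₃.trans h₂, hx₃, e, he _ fun k => ?_, fun k => mulOp f (c k) * Q k,
      fun k => C_mem_reesRing (mul_mem (C.mulOp_mem_zeroRing _) (hQ k)), ?_⟩
    · have := (hu k).map (resO (hle k))
      rwa [resO_resO] at this
    · rw [← resM_resM h₂ h₃, hwa, map_sum, Finset.smul_sum]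
      refine Finset.sum_congr rfl fun k _ => ?_
      rw [resM_smul, resM_resM, smul_smul, map_mul, diffOpRes_mulOp]
      congr 1
      have := congrArg (diffOpRes f (hle k)) (heq k)
      rw [map_mul, diffOpRes_mulOp, resO_resO] at this
      rw [hec k, map_mul, mulOp_mul, mul_assoc]
      exact congrArg _ this
  | succ d ih =>
    intro W₁ hW₁ w hw x hx
    rw [Nat.cast_succ, ← add_assoc] at hw
    -- From `α₀` on, each further step of the filtration is multiplication by the `t_j`, which are
    -- the degree-1 generators of the Rees ring.
    obtain ⟨W₂, h₂, hx₂, v, hv, hwv⟩ := hsum (α₀ + d) (by simp) W₁ (C.res hW₁) w hw x hx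
    change Fin C.r → Sec M W₂ at v
    choose T hT hxT h hu a ha heq using fun j => ih W₂ (h₂.trans hW₁) (v j) (hv j) x hx₂
    obtain ⟨W₃, h₃, hx₃, hle⟩ := exists_common_nhd hx₂ hxT
    obtain ⟨e, c, hec, he⟩ := exists_common_multiple h
    refine ⟨W₃, h₃.trans h₂, hx₃, e, he _ fun k => ?_,
      fun k => ∑ j : Fin C.r, mulOp f (C.t j) * (mulOp f (c j) * a j k), fun k => ?_, ?_⟩
    · have := (hu k).map (resO (hle k))
      rwa [resO_resO] at this
    · rw [map_sum]
      refine sum_mem fun j _ => ?_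
      have h1 : Polynomial.monomial 1 (mulOp f (C.t j)) ∈
          reesRing (mulOpHom f W) C.zeroGen C.t :=
        gen_mem_genRing (φ := Polynomial.C.comp (mulOpHom f W))
          (y := reesGen (mulOpHom f W) C.zeroGen C.t) (Sum.inr j)
      have h2 := mul_mem h1 (mul_mem (C_mem_reesRing (t := C.t) (C.mulOp_mem_zeroRing (c j))) (ha j k))
      rwa [Polynomial.C_mul_monomial, Polynomial.monomial_mul_monomial, add_comm 1] at h2
    · have h1 : resM M (h₃.trans h₂) w =
          ∑ j : Fin C.r, mulOp f (resO (h₃.trans (h₂.trans hW₁)) (C.t j)) • resM M h₃ (v j) := by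
        rw [← resM_resM h₂ h₃, hwv, map_sum]
        refine Finset.sum_congr rfl fun j _ => ?_
        rw [resM_smul, diffOpRes_mulOp, resO_resO]
        exact congrArg (fun s => mulOp f s • resM M h₃ (v j)) (resO_resO _ _ _)
      rw [h1, Finset.smul_sum]
      simp only [map_sum, Finset.sum_smul]
      rw [Finset.sum_comm]
      refine Finset.sum_congr rfl fun j _ => ?_
      have h2 := congrArg (resM M (hle j)) (heq j)
      simp only [map_sum, resM_smul, resM_resM, diffOpRes_mulOp, resO_resO] at h2
      exact mulOp_smul_mulOp_smul_eq_sum _ (hec j) h2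

end Germ

end

noncomputable section

variable {X Z : Scheme.{0}} {f : X ⟶ Spec (.of ℂ)} {i : Z ⟶ X}
  {M : PresheafOfModules.{0} (diffOpPresheaf f)} {V : ℝ → ∀ U : X.Opens, AddSubgroup (Sec M U)}

lemma exists_resM_eq_of_mk_eq {W : X.Opens} {x : X} {hx : x ∈ W} {m m' : Sec M W}
    (h : (germKer M W x hx).mkQ m = (germKer M W x hx).mkQ m') :
    ∃ (V : X.Opens) (hV : V ≤ W), x ∈ V ∧ resM M hV m = resM M hV m' := by
  obtain ⟨V, hV, hxV, h0⟩ := (Submodule.Quotient.eq _).1 h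
  rw [map_sub, sub_eq_zero] at h0
  exact ⟨V, hV, hxV, h0⟩

lemma mkQ_eq_of_resM_eq {W V : X.Opens} {x : X} {hx : x ∈ W} {m m' : Sec M W}
    (hV : V ≤ W) (hxV : x ∈ V) (h : resM M hV m = resM M hV m') :
    (germKer M W x hx).mkQ m = (germKer M W x hx).mkQ m' :=
  (Submodule.Quotient.eq _).2 ⟨V, hV, hxV, by rw [map_sub, h, sub_self]⟩

-- Dividing the sections over `W` by those vanishing near `x` gives a module over the operators on
-- `W`, so one Noetherian Rees ring handles the germs at `x`. Given `P`, denominators are cleared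
-- both in `P` and in the expression of `P u` by the `g k`. The Artin–Rees lemma over `W` applies to
-- the resulting identity, and the denominators, being units near `x`, are divided out again.
set_option maxHeartbeats 1000000 in
lemma artinRees_germ [Smooth f] {W : X.Opens} (C : Coords f i W) {n : ℕ} {g : Fin n → Sec M W}
    {α₀ : ℝ} (hW : IsAffineOpen W)
    (hsum : ∀ α ≥ α₀, ∀ (W : X.Opens) (C : Coords f i W) (m : Sec M W),
      m ∈ V (α + 1) W → LocallyOn W fun W' h => ∃ v : Fin C.r → Sec M W', (∀ j, v j ∈ V α W') ∧
        resM M h m = ∑ j, mulOp f (resO h (C.t j)) • v j)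
    (hgen : ∀ (W' : X.Opens) (h : W' ≤ W), ∀ m ∈ V α₀ W', LocallyOn W' fun W'' h' =>
      ∃ a : Fin n → diffOp f W'', (∀ k, a k ∈ V0D f i W'') ∧
        resM M h' m = ∑ k, a k • resM M (h'.trans h) (g k))
    (u : Sec M W) {x : X} (hx : x ∈ W) :
    ∃ d : ℕ, ∀ (W₁ : X.Opens) (h₁ : W₁ ≤ W), x ∈ W₁ → ∀ P ∈ VD f i 0 W₁,
      P • resM M h₁ u ∈ V (α₀ + d) W₁ → ∃ (W₂ : X.Opens) (h₂ : W₂ ≤ W₁), x ∈ W₂ ∧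
        ∃ Q ∈ VD f i 1 W₂, resM M h₂ (P • resM M h₁ u) = Q • resM M (h₂.trans h₁) u := by
  have := isNoetherianRing_of_isAffineOpen f hW
  obtain ⟨d, hd⟩ := C.reesRelations.artinRees (fun j => VD f i j W) one_mem_VD
    (fun j k P hP Q hQ => by
      have := VD_mul hP hQ
      rwa [← Nat.cast_add] at this)
    (fun j k hjk => VD_anti (by exact_mod_cast hjk)) (fun a => mulOp_mem_VD a)
    (fun k => C.zeroRing_le (gen_mem_genRing k)) (fun k => mulOp_mem_VD_one (C.t_mem hW k))
    (fun k => (germKer M W x hx).mkQ (g k)) ((germKer M W x hx).mkQ u)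
  refine ⟨d, fun W₁ h₁ hx₁ P hP hPu => ?_⟩
  obtain ⟨T, hT, hxT, h, hu, a, ha, heq⟩ :=
    exists_reesRing_combination C hW hsum hgen d W₁ h₁ _ hPu x hx₁
  obtain ⟨T', hT', hxT', h', hu', Q, hQ, heq'⟩ := C.exists_mulOp_mul_eq hW h₁ hx₁ hP
  have hTl : T ⊓ T' ≤ W₁ := inf_le_left.trans hT
  have hTW : T ⊓ T' ≤ W := hTl.trans h₁
  have e1 := congrArg (resM M (inf_le_left : T ⊓ T' ≤ T)) heq
  simp only [map_sum, resM_smul, resM_resM, diffOpRes_mulOp, resO_resO, diffOpRes_diffOpRes] at e1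
  have e2 := congrArg (diffOpRes f (inf_le_right : T ⊓ T' ≤ T')) heq'
  simp only [map_mul, diffOpRes_mulOp, resO_resO, diffOpRes_diffOpRes] at e2
  have key : mulOp f (resO hTW (h' * h)) • diffOpRes f hTl P • resM M hTW u =
      ∑ k, diffOpRes f hTW (mulOp f h' * a k) • resM M hTW (g k) := by
    rw [map_mul, ← mulOp_smul_mulOp_smul, e1, Finset.smul_sum]
    refine Finset.sum_congr rfl fun k _ => ?_
    rw [smul_smul, map_mul, diffOpRes_mulOp]
  have key' : mulOp f (resO hTW (h' * h)) • diffOpRes f hTl P • resM M hTW u =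
      diffOpRes f hTW (mulOp f h * Q) • resM M hTW u := by
    rw [mul_comm, map_mul, ← mulOp_smul_mulOp_smul, map_mul, diffOpRes_mulOp, ← e2]
    simp only [smul_smul]
  have h1 : ∑ k, (mulOp f h' * a k) • (germKer M W x hx).mkQ (g k) =
      (mulOp f h * Q) • (germKer M W x hx).mkQ u := by
    simp only [← map_smul, ← map_sum]
    refine mkQ_eq_of_resM_eq hTW ⟨hxT, hxT'⟩ ?_
    rw [map_sum, resM_smul, ← key', key]
    exact Finset.sum_congr rfl fun k _ => resM_smul _ _ _
  obtain ⟨R, hR, h2⟩ := hd _ (fun k => by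
    have := mul_mem (C_mem_reesRing (t := C.t) (C.mulOp_mem_zeroRing h')) (ha k)
    rwa [Polynomial.C_mul_monomial] at this) (mulOp f h * Q)
      (V0D f i W |>.mul_mem (mulOp_mem_VD h) (C.zeroRing_le hQ)) h1
  rw [h1, ← map_smul, ← map_smul] at h2
  obtain ⟨T'', hT'', hxT'', h3⟩ := exists_resM_eq_of_mk_eq h2
  have hle : T ⊓ T' ⊓ T'' ≤ T ⊓ T' := inf_le_left
  have hunit : IsUnit (resO hTW (h' * h)) := by
    have h4 := hu.map (resO (inf_le_left : T ⊓ T' ≤ T))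
    have h5 := hu'.map (resO (inf_le_right : T ⊓ T' ≤ T'))
    rw [resO_resO] at h4 h5
    rw [map_mul]
    exact h5.mul h4
  obtain ⟨c, hc⟩ := hunit.exists_left_inv
  refine ⟨T ⊓ T' ⊓ T'', hle.trans hTl, ⟨⟨hxT, hxT'⟩, hxT''⟩,
    mulOp f (resO hle c) * diffOpRes f (hle.trans hTW) R, ?_, ?_⟩
  · have := VD_mul (mulOp_mem_VD (f := f) (i := i) (resO hle c)) (VD_res (hle.trans hTW) hR)
    rwa [zero_add] at this
  · have h6 := congrArg (resM M (inf_le_right : T ⊓ T' ⊓ T'' ≤ T'')) h3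
    rw [resM_resM, resM_resM, resM_smul, resM_smul] at h6
    have h7 := congrArg (resM M hle) key'
    simp only [resM_smul, resM_resM, diffOpRes_mulOp, diffOpRes_diffOpRes] at h7
    have h8 : diffOpRes f (hle.trans hTl) P • resM M (hle.trans hTW) u =
        mulOp f (resO hle c) • mulOp f (resO hle (resO hTW (h' * h))) •
          diffOpRes f (hle.trans hTl) P • resM M (hle.trans hTW) u := by
      rw [mulOp_smul_mulOp_smul, ← map_mul, hc, map_one, mulOp_one, one_smul]
    rw [resM_smul, resM_resM, ← smul_smul, ← h6, ← h7]
    exact h8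

end

/-! ### From germs to a uniform Artin–Rees bound. -/

noncomputable section

variable {X Z : Scheme.{0}} {f : X ⟶ Spec (.of ℂ)} {i : Z ⟶ X}
  {M : PresheafOfModules.{0} (diffOpPresheaf f)} {V : ℝ → ∀ U : X.Opens, AddSubgroup (Sec M U)}

lemma IsVFiltration.smul_mem (hV : IsVFiltration i M V) {α : ℝ} {U : X.Opens} {P : diffOp f U}
    (hP : P ∈ VD f i 0 U) {m : Sec M U} (hm : m ∈ V α U) : P • m ∈ V α U := by
  have := hV.VD_smul α 0 U P hP m hm
  rwa [Int.cast_zero, add_zero] at this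

lemma exists_isAffineOpen_le {U : X.Opens} {x : X} (hx : x ∈ U) :
    ∃ W : X.Opens, IsAffineOpen W ∧ x ∈ W ∧ W ≤ U := by
  obtain ⟨_, ⟨W, hW, rfl⟩, hxW, hWU⟩ := X.isBasis_affineOpens.exists_subset_of_mem_open hx U.2
  exact ⟨W, hW, hxW, hWU⟩

-- The neighbourhood in `artinRees_germ` depends on the operator. By coherence, the operators in
-- `V^0 𝒟` sending `u` into `V^β` are locally generated by finitely many `ρ p 0`, the
-- `u`-coefficients of the relations between `u` and generators of `V^β`. Treating these finitely
-- many operators yields one neighbourhood for all.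
set_option maxHeartbeats 1000000 in
lemma IsVFiltration.artinRees_of_mem_range [Smooth f] [IsClosedImmersion i] [Smooth (i ≫ f)]
    (hV : IsVFiltration i M V) {U : X.Opens} (u : Sec M U) {z : Z} (hx : i z ∈ U) :
    ∃ (W : X.Opens) (h : W ≤ U), i z ∈ W ∧ ∃ β : ℝ, ∀ (W' : X.Opens) (h' : W' ≤ W),
      ∀ P ∈ VD f i 0 W', P • resM M (h'.trans h) u ∈ V β W' →
        InVDu i M 1 u (h'.trans h) (P • resM M (h'.trans h) u) := by
  obtain ⟨α₀, hα₀⟩ := hV.sum_t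
  obtain ⟨Wc, -, hxc, ⟨C⟩⟩ := exists_coords f i z
  obtain ⟨Wg, -, hxg, n, g, hg, hgen⟩ := (hV.coherent α₀).finite_type (i z) trivial
  obtain ⟨We, he, hxe, α₁, hα₁⟩ := hV.exhaustive U u (i z) hx
  obtain ⟨W, hW, hxW, hWle⟩ := exists_isAffineOpen_le
    (show i z ∈ Wc ⊓ Wg ⊓ We from ⟨⟨hxc, hxg⟩, hxe⟩)
  have hWc : W ≤ Wc := hWle.trans (inf_le_left.trans inf_le_left)
  have hWg : W ≤ Wg := hWle.trans (inf_le_left.trans inf_le_right)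
  have hWe : W ≤ We := hWle.trans inf_le_right
  have hWU : W ≤ U := hWe.trans he
  obtain ⟨d, hd⟩ := artinRees_germ (V := V) (C.res hWc) (g := fun k => resM M hWg (g k)) hW
    (fun α hα W C m hm => (hα₀ α hα W C m).1 hm)
    (fun W' h m hm => (hgen W' (h.trans hWg) m hm).mono fun W'' h' ⟨a, ha, e⟩ =>
      ⟨a, ha, by simpa only [resM_resM] using e⟩) (resM M hWU u) hxW
  simp only [resM_resM] at hd
  set β := α₀ + d
  obtain ⟨Wb, -, hxb, l, w, hw, hwgen⟩ := (hV.coherent β).finite_type (i z) trivial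
  have h₁ : W ⊓ Wb ≤ W := inf_le_left
  have h₁b : W ⊓ Wb ≤ Wb := inf_le_right
  have hu : resM M (h₁.trans hWU) u ∈ V (min α₁ β) (W ⊓ Wb) := by
    refine hV.decreasing _ _ (min_le_left _ _) _ ?_
    rw [← resM_resM he (h₁.trans hWe)]
    exact (hV.subsheaf _).res_mem _ _ _ _ hα₁
  -- The index `min α₁ β` is a single step of the filtration containing both `u` and the generators
  -- of `V^β`.
  obtain ⟨W₂, h₂, hx₂, q, ρ, hρ, hrel⟩ := (hV.coherent (min α₁ β)).relations (W ⊓ Wb) (l + 1)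
    (Fin.cons (resM M (h₁.trans hWU) u) fun k => resM M h₁b (w k))
    (Fin.cases hu fun k => hV.decreasing _ _ (min_le_right _ _) _
      ((hV.subsheaf _).res_mem _ _ _ _ (hw k))) (i z) ⟨hxW, hxb⟩
  simp only [Fin.sum_univ_succ, Fin.cons_zero, Fin.cons_succ, resM_resM] at hρ hrel
  have hρV : ∀ p, ρ p 0 • resM M (h₂.trans (h₁.trans hWU)) u ∈ V β W₂ := fun p => by
    rw [eq_neg_of_add_eq_zero_left (hρ p).2]
    exact neg_mem (sum_mem fun k _ => hV.smul_mem ((hρ p).1 _)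
      ((hV.subsheaf _).res_mem _ _ _ _ (hw k)))
  choose T hT hxT Q hQ hQeq using fun p =>
    hd W₂ (h₂.trans h₁) hx₂ (ρ p 0) ((hρ p).1 0) (hρV p)
  obtain ⟨W₃, h₃, hx₃, hle⟩ := exists_common_nhd hx₂ hxT
  refine ⟨W₃, h₃.trans (h₂.trans (h₁.trans hWU)), hx₃, β, fun W' h' P hP hPu y hy => ?_⟩
  obtain ⟨W'', h'', hy'', a, ha, hPa⟩ := hwgen W' (h'.trans (h₃.trans (h₂.trans h₁b))) _ hPu y hy
  -- Writing `P u` as a combination of the `w k` is a relation with first coefficient `P`, so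
  -- locally `P` is a `V^0 𝒟`-combination of the `ρ p 0`.
  obtain ⟨W₄, h₄, hy₄, c, hc, hceq⟩ := hrel W'' (h''.trans (h'.trans h₃))
    (Fin.cons (diffOpRes f h'' P) fun k => -a k)
    (Fin.cases (VD_res h'' hP) fun k => neg_mem (ha k)) (by
      simp only [Fin.cons_zero, Fin.cons_succ, neg_smul, Finset.sum_neg_distrib]
      rw [← hPa, resM_smul, resM_resM, add_neg_cancel]) y hy''
  refine ⟨W₄, h₄.trans h'', hy₄, ∑ p, c p *
    diffOpRes f ((h₄.trans (h''.trans h')).trans (hle p)) (Q p), sum_mem fun p _ => ?_, ?_⟩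
  · have := VD_mul (hc p) (VD_res ((h₄.trans (h''.trans h')).trans (hle p)) (hQ p))
    rwa [zero_add] at this
  · have e0 := hceq 0
    rw [Fin.cons_zero, diffOpRes_diffOpRes] at e0
    rw [resM_smul, e0, resM_resM, Finset.sum_smul, Finset.sum_smul]
    refine Finset.sum_congr rfl fun p _ => ?_
    have e1 := congrArg (resM M ((h₄.trans (h''.trans h')).trans (hle p))) (hQeq p)
    rw [resM_smul, resM_smul, resM_smul, diffOpRes_diffOpRes, resM_resM, resM_resM, resM_resM] at e1
    rw [← smul_smul, ← smul_smul]
    exact congrArg (c p • ·) e1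

/-- The open complement of `Z`. -/
def complOpen (i : Z ⟶ X) [IsClosedImmersion i] : X.Opens :=
  ⟨(Set.range i)ᶜ, i.isClosedEmbedding.isClosed_range.isOpen_compl⟩

lemma mem_VD_of_le_complOpen [IsClosedImmersion i] {W : X.Opens} (hW : W ≤ complOpen i) (j : ℤ)
    (P : diffOp f W) : P ∈ VD f i j W := by
  refine mem_VD_of_idealOf_eq_top (fun W' h' _ => ?_) j P
  have : i ⁻¹ᵁ W' = ⊥ := by
    refine le_bot_iff.1 fun z hz => ?_
    exact hW (h' hz) ⟨z, rfl⟩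
  rw [Ideal.eq_top_iff_one]
  change (i.app W').hom 1 = 0
  have hs : Subsingleton Γ(Z, i ⁻¹ᵁ W') := by
    rw [this]
    infer_instance
  exact Subsingleton.elim _ _

lemma InVDu.res {U W W' : X.Opens} {u : Sec M U} {h : W ≤ U} {j : ℤ} {m : Sec M W}
    (H : InVDu i M j u h m) (h' : W' ≤ W) : InVDu i M j u (h'.trans h) (resM M h' m) := by
  intro x hx
  obtain ⟨T, hT, hxT, P, hP, e⟩ := H x (h' hx)
  refine ⟨T ⊓ W', inf_le_right, ⟨hxT, hx⟩, diffOpRes f inf_le_left P, VD_res _ hP, ?_⟩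
  have := congrArg (resM M (inf_le_left : T ⊓ W' ≤ T)) e
  rw [resM_resM, resM_smul, resM_resM] at this
  rw [resM_resM]
  exact this

lemma InVDu.of_locallyOn {U W : X.Opens} {u : Sec M U} {h : W ≤ U} {j : ℤ} {m : Sec M W}
    (H : LocallyOn W fun _ h' => InVDu i M j u (h'.trans h) (resM M h' m)) :
    InVDu i M j u h m := by
  intro x hx
  obtain ⟨T, hT, hxT, hH⟩ := H x hx
  obtain ⟨T', hT', hxT', P, hP, e⟩ := hH x hxT
  exact ⟨T', hT'.trans hT, hxT', P, hP, by rwa [resM_resM] at e⟩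

lemma InVDu.of_le_complOpen [IsClosedImmersion i] {U W : X.Opens} {u : Sec M U} {h : W ≤ U}
    {j : ℤ} {m : Sec M W} (H : InVDu i M j u h m) (hW : W ≤ complOpen i) (k : ℤ) :
    InVDu i M k u h m :=
  LocallyOn.mono H fun _ h' ⟨P, _, e⟩ => ⟨P, mem_VD_of_le_complOpen (h'.trans hW) k P, e⟩

/-- For `β` large, the sections of `V^β` in `V^0 𝒟_X u` are in `V^1 𝒟_X u`. -/
theorem IsVFiltration.artinRees [Smooth f] [QuasiCompact f] [IsClosedImmersion i]
    [Smooth (i ≫ f)] (hV : IsVFiltration i M V) {U : X.Opens} (u : Sec M U) :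
    ∃ β : ℝ, ∀ (W : X.Opens) (h : W ≤ U), ∀ m ∈ V β W, InVDu i M 0 u h m → InVDu i M 1 u h m := by
  obtain ⟨β, hβ⟩ := exists_forall_locallyOn (isCompact_opens f U)
    (P := fun (β : ℝ) W h => ∀ (W' : X.Opens) (h' : W' ≤ W), ∀ m ∈ V β W',
      InVDu i M 0 u (h'.trans h) m → InVDu i M 1 u (h'.trans h) m)
    (fun β γ hβγ W h H W' h' m hm => H W' h' m (hV.decreasing β γ hβγ W' hm))
    (fun x hx => by
      by_cases hxZ : x ∈ Set.range i
      · obtain ⟨z, rfl⟩ := hxZ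
        obtain ⟨W, h, hxW, β, H⟩ := hV.artinRees_of_mem_range u hx
        refine ⟨W, h, hxW, β, fun W' h' m hm hmu => InVDu.of_locallyOn fun y hy => ?_⟩
        obtain ⟨T, hT, hyT, P, hP, e⟩ := hmu y hy
        refine ⟨T, hT, hyT, ?_⟩
        beta_reduce
        rw [e]
        refine H T (hT.trans h') P hP ?_
        rw [← e]
        exact (hV.subsheaf β).res_mem _ _ _ _ hm
      · exact ⟨U ⊓ complOpen i, inf_le_left, ⟨hx, hxZ⟩, 0, fun W' h' m _ hmu =>
          hmu.of_le_complOpen (h'.trans inf_le_right) 1⟩)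
  refine ⟨β, fun W h m hm hmu => InVDu.of_locallyOn fun x hx => ?_⟩
  obtain ⟨T, hT, hxT, H⟩ := hβ x (h hx)
  exact ⟨T ⊓ W, inf_le_right, ⟨hxT, hx⟩, H (T ⊓ W) inf_le_left _
    ((hV.subsheaf β).res_mem _ _ _ _ hm) (hmu.res inf_le_right)⟩

end

noncomputable section

variable {X Z : Scheme.{0}} {f : X ⟶ Spec (.of ℂ)} {i : Z ⟶ X}
  {M : PresheafOfModules.{0} (diffOpPresheaf f)} {V : ℝ → ∀ U : X.Opens, AddSubgroup (Sec M U)}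

/-! ### Polynomials in the Euler operator -/

lemma Coords.commute_cstOp_euler {W : X.Opens} (C : Coords f i W) (c : ℂ) :
    Commute (cstOp f W c) C.euler := by
  refine Commute.sum_right _ _ _ fun j _ => Commute.mul_right ?_ ?_
  · have h := vfOp_mul_mulOp (C.dt_vf j) (cst f W c)
    rw [(C.dt_vf j).const ⟨W, le_rfl⟩, mulOp_zero, add_zero] at h
    exact h.symm
  · exact (Commute.all (cst f W c) (C.t j)).map (mulOpHom f W)

/-- The action of polynomials in `s = -∑_j ∂_{t_j} t_j`. -/
def Coords.polyOp {W : X.Opens} (C : Coords f i W) : Polynomial ℂ →+* diffOp f W :=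
  Polynomial.eval₂RingHom' (cstOp f W) (-C.euler) fun c => (C.commute_cstOp_euler c).neg_right

lemma Coords.polyOp_apply {W : X.Opens} (C : Coords f i W) (p : Polynomial ℂ) :
    C.polyOp p = p.eval₂ (cstOp f W) (-C.euler) := rfl

lemma Coords.polyOp_mem {W : X.Opens} (C : Coords f i W) (p : Polynomial ℂ) :
    C.polyOp p ∈ V0D f i W := by
  rw [polyOp_apply, Polynomial.eval₂_eq_sum]
  exact sum_mem fun n _ => (V0D f i W).mul_mem (mulOp_mem_VD _)
    ((V0D f i W).pow_mem ((V0D f i W).neg_mem C.euler_mem_VD) n)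

lemma Coords.polyOp_X_add_C_pow {W : X.Opens} (C : Coords f i W) (a : ℂ) (N : ℕ) :
    C.polyOp ((Polynomial.X + Polynomial.C a) ^ N) =
      (-1) ^ N * (C.euler - cstOp f W a) ^ N := by
  rw [map_pow, map_add, polyOp_apply, polyOp_apply, Polynomial.eval₂_X, Polynomial.eval₂_C,
    neg_add_eq_sub, ← neg_sub C.euler]
  exact neg_pow (C.euler - cstOp f W a) N

lemma eval_X_add_C_prod_eq_zero {F : Finset ℝ} {N : ℝ → ℕ} {z : ℂ}
    (h : (∏ a ∈ F, (Polynomial.X + Polynomial.C (a : ℂ)) ^ N a).eval z = 0) :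
    ∃ a ∈ F, z = -(a : ℂ) := by
  rw [Polynomial.eval_prod, Finset.prod_eq_zero_iff] at h
  obtain ⟨a, ha, h⟩ := h
  rw [Polynomial.eval_pow, Polynomial.eval_add, Polynomial.eval_X, Polynomial.eval_C] at h
  exact ⟨a, ha, eq_neg_of_add_eq_zero_left (eq_zero_of_pow_eq_zero h)⟩

/-- A monic complex polynomial with rational roots has rational coefficients. -/
lemma exists_map_eq_of_roots_rational {b : Polynomial ℂ} (hb : b.Monic)
    (h : ∀ z ∈ b.roots, ∃ q : ℚ, algebraMap ℚ ℂ q = z) :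
    ∃ b' : Polynomial ℚ, b'.map (algebraMap ℚ ℂ) = b := by
  obtain ⟨s, hs⟩ : ∃ s : Multiset ℚ, s.map (algebraMap ℚ ℂ) = b.roots := by
    have : CanLift ℂ ℚ (algebraMap ℚ ℂ) fun z => ∃ q : ℚ, algebraMap ℚ ℂ q = z := ⟨fun _ hz => hz⟩
    exact CanLift.prf (cond := fun s : Multiset ℂ => ∀ z ∈ s, ∃ q : ℚ, algebraMap ℚ ℂ q = z) _ h
  refine ⟨(s.map fun q => Polynomial.X - Polynomial.C q).prod, ?_⟩
  conv_rhs => rw [(IsAlgClosed.splits b).eq_prod_roots_of_monic hb, ← hs]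
  rw [Polynomial.map_multiset_prod, Multiset.map_map, Multiset.map_map]
  simp

/-! ### Jumps of the filtration -/

section Filtration

variable [Smooth f] [QuasiCompact f] (hV : IsVFiltration i M V)
include hV

lemma IsVFiltration.exists_mem {U : X.Opens} (u : Sec M U) : ∃ α, u ∈ V α U := by
  obtain ⟨α, hα⟩ := exists_forall_locallyOn (κ := ℝᵒᵈ) (isCompact_opens f U)
    (P := fun α W h => resM M h u ∈ V (OrderDual.ofDual α) W)
    (fun α β h W _ hu => hV.decreasing _ _ h W hu) (hV.exhaustive U u)
  exact ⟨_, (hV.subsheaf _).of_local U u hα⟩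

lemma IsVFiltration.exists_mem_of_inVgt {α : ℝ} {U : X.Opens} {u : Sec M U}
    (hu : InVgt M V α U u) : ∃ β > α, u ∈ V β U := by
  have : Nonempty (Set.Ioi α)ᵒᵈ := ⟨OrderDual.toDual ⟨α + 1, by simp⟩⟩
  obtain ⟨β, hβ⟩ := exists_forall_locallyOn (κ := (Set.Ioi α)ᵒᵈ) (isCompact_opens f U)
    (P := fun β W h => resM M h u ∈ V (OrderDual.ofDual β).1 W)
    (fun β γ h W _ hu => hV.decreasing _ _ h W hu)
    (LocallyOn.mono hu fun _ _ ⟨β, hβ, h⟩ => ⟨OrderDual.toDual ⟨β, hβ⟩, h⟩)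
  exact ⟨_, (OrderDual.ofDual β).2, (hV.subsheaf _).of_local U u hβ⟩

/-- The candidate is the supremum of the indices `γ ≤ β` with `u ∈ V^γ`. It is attained by
left-continuity; if it is smaller than `β`, membership in `V^{>s}` would contradict maximality. -/
lemma IsVFiltration.mem_or_exists_jump {α : ℝ} (β : ℝ) {U : X.Opens} {u : Sec M U}
    (hu : u ∈ V α U) : u ∈ V β U ∨ ∃ s, α ≤ s ∧ s < β ∧ u ∈ V s U ∧ ¬ InVgt M V s U u := by
  rcases le_total β α with hβ | hβ
  · exact Or.inl (hV.decreasing _ _ hβ U hu)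
  let S : Set ℝ := {γ | γ ≤ β ∧ u ∈ V γ U}
  have hS : BddAbove S := ⟨β, fun γ hγ => hγ.1⟩
  have hαS : α ∈ S := ⟨hβ, hu⟩
  have hs : u ∈ V (sSup S) U := hV.left_continuous _ U u fun γ hγ => by
    obtain ⟨γ', hγ', h⟩ := exists_lt_of_lt_csSup ⟨α, hαS⟩ hγ
    exact hV.decreasing _ _ h.le U hγ'.2
  rcases (csSup_le ⟨α, hαS⟩ fun γ hγ => hγ.1 : sSup S ≤ β).eq_or_lt with h | h
  · exact Or.inl (h ▸ hs)
  · refine Or.inr ⟨sSup S, le_csSup hS hαS, h, hs, fun hgt => ?_⟩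
    obtain ⟨γ, hγ, hγu⟩ := hV.exists_mem_of_inVgt hgt
    exact absurd (le_csSup hS ⟨min_le_right γ β, hV.decreasing _ _ (min_le_left γ β) U hγu⟩)
      (not_le.2 (lt_min hγ h))

/-- A section not yet in `V^β` sits at a jump `s ∈ F`; the factor at `s` pushes it strictly beyond
`s`, and the remaining jumps are those in `F` without `s`. -/
lemma IsVFiltration.polyOp_smul_mem {N : ℝ → ℕ} (hN : ∀ (α : ℝ) (W : X.Opens) (C : Coords f i W),
      ∀ m ∈ V α W, InVgt M V α W ((C.euler - cstOp f W (α : ℂ)) ^ N α • m))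
    (β : ℝ) {W : X.Opens} (C : Coords f i W) (F : Finset ℝ) :
    ∀ (α : ℝ), (∀ s, α ≤ s → s < β → GrNonzero M V s → s ∈ F) → ∀ m ∈ V α W,
      C.polyOp (∏ a ∈ F, (Polynomial.X + Polynomial.C (a : ℂ)) ^ N a) • m ∈ V β W := by
  induction F using Finset.strongInduction with
  | H F ih =>
    intro α hF m hm
    rcases hV.mem_or_exists_jump β hm with h | ⟨s, hαs, hsβ, hs, hjump⟩
    · exact hV.smul_mem (C.polyOp_mem _) h
    · have hsF : s ∈ F := hF s hαs hsβ ⟨W, m, hs, hjump⟩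
      obtain ⟨γ, hγ, hmem⟩ := hV.exists_mem_of_inVgt (hN s W C m hs)
      rw [← Finset.prod_erase_mul F _ hsF, map_mul, ← smul_smul]
      refine ih _ (Finset.erase_ssubset hsF) γ (fun s' h h' hs' => Finset.mem_erase.2
        ⟨fun e => absurd (e ▸ h) (not_le.2 hγ), hF s' (hαs.trans (hγ.le.trans h)) h' hs'⟩) _ ?_
      rw [C.polyOp_X_add_C_pow, ← smul_smul]
      exact hV.smul_mem (pow_mem (neg_mem (one_mem (V0D f i W))) _) hmem

end Filtration

/-! ### The Bernstein–Sato polynomial -/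

lemma InVDu.add {U W : X.Opens} {u : Sec M U} {h : W ≤ U} {j : ℤ} {m m' : Sec M W}
    (H : InVDu i M j u h m) (H' : InVDu i M j u h m') : InVDu i M j u h (m + m') := by
  intro x hx
  obtain ⟨T, hT, hxT, P, hP, e⟩ := H x hx
  obtain ⟨T', hT', hxT', P', hP', e'⟩ := H' x hx
  refine ⟨T ⊓ T', inf_le_left.trans hT, ⟨hxT, hxT'⟩,
    diffOpRes f inf_le_left P + diffOpRes f inf_le_right P', add_mem (VD_res _ hP) (VD_res _ hP'), ?_⟩
  have h1 := congrArg (resM M (inf_le_left : T ⊓ T' ≤ T)) e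
  have h2 := congrArg (resM M (inf_le_right : T ⊓ T' ≤ T')) e'
  rw [resM_resM, resM_smul, resM_resM] at h1 h2
  rw [map_add, add_smul]
  exact congrArg₂ (· + ·) h1 h2

lemma InVDu.smul {U W : X.Opens} {u : Sec M U} {h : W ≤ U} {j : ℤ} {m : Sec M W}
    (H : InVDu i M j u h m) {P : diffOp f W} (hP : P ∈ VD f i 0 W) : InVDu i M j u h (P • m) :=
  LocallyOn.mono H fun T hT ⟨Q, hQ, e⟩ => ⟨diffOpRes f hT P * Q, by
    have := VD_mul (VD_res hT hP) hQ
    rwa [zero_add] at this, by rw [resM_smul, e, smul_smul]⟩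

lemma InVDu.mem (hV : IsVFiltration i M V) {U W : X.Opens} {u : Sec M U} {h : W ≤ U} {j : ℤ}
    {m : Sec M W} (H : InVDu i M j u h m) {α : ℝ} (hu : u ∈ V α U) : m ∈ V (α + j) W :=
  (hV.subsheaf _).of_local W m <| LocallyOn.mono H fun T hT ⟨P, hP, e⟩ => by
    rw [e]
    exact hV.VD_smul α j T P hP _ ((hV.subsheaf α).res_mem _ _ _ _ hu)

/-- The ideal of the polynomials that act as zero on `V^0 𝒟_X u / V^1 𝒟_X u`. -/
def annihilatorIdeal (i : Z ⟶ X) {U : X.Opens} (u : Sec M U) : Ideal (Polynomial ℂ) where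
  carrier := {p | Annihilates i M u p}
  zero_mem' := fun W h C m _ x hx => ⟨W, le_rfl, hx, 0, zero_mem _, by
    rw [← C.polyOp_apply, map_zero]
    exact (congrArg (resM M _) (zero_smul (diffOp f W) m)).trans
      ((map_zero _).trans (zero_smul (diffOp f W) (resM M (le_rfl.trans h) u)).symm)⟩
  add_mem' := fun {p q} hp hq W h C m hm => by
    rw [Polynomial.eval₂_add, add_smul]
    exact (hp W h C m hm).add (hq W h C m hm)
  smul_mem' := fun q p hp W h C m hm => by
    rw [smul_eq_mul, ← C.polyOp_apply, map_mul, ← smul_smul]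
    exact (hp W h C m hm).smul (C.polyOp_mem q)

lemma exists_isBernsteinSato {U : X.Opens} {u : Sec M U} {p : Polynomial ℂ} (hp : p ≠ 0)
    (h : Annihilates i M u p) : ∃ b, IsBernsteinSato i M u b := by
  let I := annihilatorIdeal i u
  have hI : ∀ q, Annihilates i M u q ↔ Submodule.IsPrincipal.generator I ∣ q := fun q =>
    Submodule.IsPrincipal.mem_iff_generator_dvd I
  have h0 : Submodule.IsPrincipal.generator I ≠ 0 := fun h0 =>
    hp (zero_dvd_iff.1 (h0 ▸ (hI p).1 h))
  exact ⟨normalize (Submodule.IsPrincipal.generator I), Polynomial.monic_normalize h0,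
    (hI _).2 (dvd_normalize_iff.2 dvd_rfl), fun q hq => normalize_dvd_iff.2 ((hI q).1 hq)⟩

section Filtration

variable [Smooth f] [QuasiCompact f] [IsClosedImmersion i] [Smooth (i ≫ f)]
  (hV : IsVFiltration i M V)
include hV

/-- If `u` is in `V^α`, a product of linear factors with roots `-a`, where `α ≤ a` and `a` is
rational, acts as zero. -/
lemma IsVFiltration.exists_annihilates {α : ℝ} {U : X.Opens} {u : Sec M U} (hu : u ∈ V α U) :
    ∃ p : Polynomial ℂ, p ≠ 0 ∧ Annihilates i M u p ∧
      ∀ z, p.eval z = 0 → ∃ a : ℝ, α ≤ a ∧ (∃ q : ℚ, a = q) ∧ z = -(a : ℂ) := by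
  obtain ⟨β, hβ⟩ := hV.artinRees u
  -- The nilpotency exponent depends on `α` only and not on the coordinates, so one polynomial
  -- serves for all charts.
  choose N hN using hV.nilpotent
  have hfin := hV.discrete α β
  refine ⟨∏ a ∈ hfin.toFinset, (Polynomial.X + Polynomial.C (a : ℂ)) ^ N a,
    Finset.prod_ne_zero_iff.2 fun a _ => pow_ne_zero _ (Polynomial.X_add_C_ne_zero _),
    fun W h C m hm => ?_, fun z hz => ?_⟩
  · have hmα : m ∈ V α W := by
      have := hm.mem hV hu
      rwa [Int.cast_zero, add_zero] at this
    rw [← C.polyOp_apply]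
    refine hβ W h _ (hV.polyOp_smul_mem hN β C _ α (fun s h h' hs => ?_) m hmα)
      (hm.smul (C.polyOp_mem _))
    exact hfin.mem_toFinset.2 ⟨⟨h, h'.le⟩, hs⟩
  · obtain ⟨a, ha, rfl⟩ := eval_X_add_C_prod_eq_zero hz
    have ha' := hfin.mem_toFinset.1 ha
    exact ⟨a, ha'.1.1, hV.rational a ha'.2, rfl⟩

lemma IsVFiltration.inVgt_of_isBernsteinSato {U : X.Opens} {u : Sec M U} {s : ℝ}
    (hu : u ∈ V s U) {b : Polynomial ℂ} (hb : Annihilates i M u b)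
    (hs : b.eval (-(s : ℂ)) ≠ 0) : InVgt M V s U u := by
  intro x hx
  by_cases hxZ : x ∈ Set.range i
  · obtain ⟨z, rfl⟩ := hxZ
    obtain ⟨Wc, -, hxc, ⟨C⟩⟩ := exists_coords f i z
    have hWU : Wc ⊓ U ≤ U := inf_le_right
    have hm : resM M hWU u ∈ V s (Wc ⊓ U) := (hV.subsheaf s).res_mem _ _ _ _ hu
    let C' := C.res (inf_le_left : Wc ⊓ U ≤ Wc)
    obtain ⟨N, hN⟩ := hV.nilpotent s
    obtain ⟨γ, hγ, hγm⟩ := hV.exists_mem_of_inVgt (hN _ C' _ hm)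
    have h1 : C'.polyOp b • resM M hWU u ∈ V (s + 1) (Wc ⊓ U) := by
      have := (hb _ hWU C' (resM M hWU u) (locallyOn_self ⟨1, one_mem_VD, by
        rw [one_smul, resM_self]⟩)).mem hV hu
      rwa [Int.cast_one] at this
    have h2 : C'.polyOp ((Polynomial.X + Polynomial.C (s : ℂ)) ^ N) • resM M hWU u ∈
        V γ (Wc ⊓ U) := by
      rw [C'.polyOp_X_add_C_pow, ← smul_smul]
      exact hV.smul_mem (pow_mem (neg_mem (one_mem (V0D f i _))) _) hγm
    -- Since `-s` is not a root of `b`, the prime `X + s` does not divide it. The Bézout identity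
    -- then writes `u` as a sum of a section of `V^γ` and one of `V^{s+1}`, both beyond `s`.
    have hcop : IsCoprime ((Polynomial.X + Polynomial.C (s : ℂ)) ^ N) b := by
      refine IsCoprime.pow_left ?_
      rw [← sub_neg_eq_add, ← Polynomial.C_neg]
      refine ((Polynomial.prime_X_sub_C _).coprime_iff_not_dvd).2 fun h => hs ?_
      exact Polynomial.dvd_iff_isRoot.1 h
    obtain ⟨p, q, hpq⟩ := hcop
    refine ⟨_, hWU, ⟨hxc, hx⟩, min γ (s + 1), lt_min hγ (lt_add_one s), ?_⟩
    have h3 := congrArg (fun p => C'.polyOp p • resM M hWU u) hpq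
    simp only [map_add, map_mul, map_one, one_smul, add_smul, ← smul_smul] at h3
    rw [← h3]
    exact add_mem
      (hV.smul_mem (C'.polyOp_mem p) (hV.decreasing _ _ (min_le_left _ _) _ h2))
      (hV.smul_mem (C'.polyOp_mem q) (hV.decreasing _ _ (min_le_right _ _) _ h1))
  -- Away from `Z` the operator `1` lies in `V^1 𝒟`, so `V^s = V^{s+1}` and there are no jumps.
  · refine ⟨U ⊓ complOpen i, inf_le_left, ⟨hx, hxZ⟩, s + 1, lt_add_one s, ?_⟩
    have := hV.VD_smul s 1 _ 1 (mem_VD_of_le_complOpen inf_le_right 1 _) _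
      ((hV.subsheaf s).res_mem _ _ (inf_le_left : U ⊓ complOpen i ≤ U) _ hu)
    rwa [one_smul, Int.cast_one] at this

end Filtration

end

end VFilt

theorem mainTheorem4 {X Z : Scheme.{0}} (f : X ⟶ Spec (.of ℂ)) [Smooth f] [IsSeparated f]
    [QuasiCompact f] (i : Z ⟶ X) [IsClosedImmersion i] [Smooth (i ≫ f)]
    (M : PresheafOfModules.{0} (VFilt.diffOpPresheaf f)) (hM : VFilt.IsCoherentDModule M)
    (V : ℝ → ∀ U : X.Opens, AddSubgroup (VFilt.Sec M U)) (hV : VFilt.IsVFiltration i M V) :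
    (∀ (U : X.Opens) (u : VFilt.Sec M U), ∃ b : Polynomial ℚ,
      VFilt.IsBernsteinSato i M u (b.map (algebraMap ℚ ℂ)) ∧ b ≠ 0 ∧
      ∀ z : ℂ, (b.map (algebraMap ℚ ℂ)).IsRoot z → ∃ q : ℚ, z = q) ∧
    ∀ (α : ℝ) (U : X.Opens) (u : VFilt.Sec M U),
      u ∈ V α U ↔ ∀ b : Polynomial ℂ, VFilt.IsBernsteinSato i M u b →
        ∀ c : ℝ, b.eval (-(c : ℂ)) = 0 → α ≤ c := by
  have hroots : ∀ {α : ℝ} {U : X.Opens} {u : VFilt.Sec M U}, u ∈ V α U → ∀ b : Polynomial ℂ,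
      VFilt.IsBernsteinSato i M u b → ∀ z, b.eval z = 0 →
        ∃ a : ℝ, α ≤ a ∧ (∃ q : ℚ, a = q) ∧ z = -(a : ℂ) := by
    intro α U u hu b hb z hz
    obtain ⟨p, -, hp, hpz⟩ := hV.exists_annihilates hu
    exact hpz z (Polynomial.eval_eq_zero_of_dvd_of_eval_eq_zero (hb.minimal p hp) hz)
  have hex : ∀ (U : X.Opens) (u : VFilt.Sec M U), ∃ b, VFilt.IsBernsteinSato i M u b := by
    intro U u
    obtain ⟨α, hα⟩ := hV.exists_mem u
    obtain ⟨p, hp0, hp, -⟩ := hV.exists_annihilates hα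
    exact VFilt.exists_isBernsteinSato hp0 hp
  refine ⟨fun U u => ?_, fun α U u => ⟨fun hu b hb c hc => ?_, fun h => ?_⟩⟩
  · obtain ⟨α, hα⟩ := hV.exists_mem u
    obtain ⟨b, hb⟩ := hex U u
    have hrat : ∀ z : ℂ, b.eval z = 0 → ∃ q : ℚ, z = q := by
      intro z hz
      obtain ⟨a, -, ⟨q, rfl⟩, rfl⟩ := hroots hα b hb z hz
      exact ⟨-q, by push_cast; rfl⟩
    obtain ⟨b', rfl⟩ := VFilt.exists_map_eq_of_roots_rational hb.monic fun z hz => by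
      obtain ⟨q, rfl⟩ := hrat z (Polynomial.isRoot_of_mem_roots hz)
      exact ⟨q, rfl⟩
    refine ⟨b', hb, ?_, hrat⟩
    rintro rfl
    exact hb.monic.ne_zero (Polynomial.map_zero _)
  · obtain ⟨a, ha, -, hca⟩ := hroots hu b hb _ hc
    -- The root `-c` is one of the known roots `-a` with `α ≤ a`, whence `c = a`.
    rwa [Complex.ofReal_injective (neg_injective hca)]
  · obtain ⟨b, hb⟩ := hex U u
    obtain ⟨γ, hγ⟩ := hV.exists_mem u
    -- A jump `s < α` of `u` would make `-s` a root of `b`, contrary to the assumption on the roots.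
    refine (hV.mem_or_exists_jump α hγ).resolve_right ?_
    rintro ⟨s, -, hsα, hs, hjump⟩
    exact hjump (hV.inVgt_of_isBernsteinSato hs hb.annihilates fun h0 =>
      absurd (h b hb s h0) (not_le.2 hsα))
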